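/- **Corollary (contraction of the Euler-Maruyama chain in $L^1$-Wasserstein distance).** *Setting.* Let $d\ge 1$, $\kappa>0$, $R\ge 0$, and let $U:\mathbb R^d\to\mathbb R$ be differentiable with $L$-Lipschitz gradient and $(\nabla U(x)-\nabla U(y))\cdot(x-y)\ge\kappa|x-y|^2$ whenever $|x-y|>R$. Write $U(x)=\frac12x^TKx+G(x)$, where $K$ is symmetric with smallest eigenvalue $\kappa$ and operator norm $L_K$, $\nabla G$ is $L_G$-Lipschitz, and $(\nabla G(x)-\nabla G(y))\cdot(x-y)\ge0$ whenever $|x-y|>R$. For $\gamma,h>0$ the Euler chain is $$X_{k+1}=X_k+hV_k,\qquad V_{k+1}=V_k-h\nabla U(X_k)-h\gamma V_k+\sqrt{2\gamma h}\,\xi_{k+1},$$ with $(\xi_k)$ i.i.d. $\mathcal N(0,I_d)$, independent of $(X_0,V_0)$. For probability measures $\mu_0,\nu_0$ on $\mathbb R^{2d}$, let $\mu_k,\nu_k$ be the laws of $(X_k,V_k)$ when $(X_0,V_0)\sim\mu_0$, resp. $\nu_0$. For a distance function $\rho$ let $\mathcal W_\rho(\nu,\eta)=\inf_\omega\int\rho\,d\omega\in[0,\infty]$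 over all couplings $\omega$ of $\nu,\eta$; $\mathcal W_1$ is the case of the Euclidean distance on $\mathbb R^{2d}$. *Distance and constants.* Put $\tau=\min(\frac18,\frac{\kappa}{4\gamma^2})$, $\alpha=2L\gamma^{-2}$, $\epsilon=\frac12\min\big(1,\frac{2\alpha}{3\sqrt{L_K}\gamma^{-1}},\alpha\big)$, $\mathcal E=\min\big(\frac{\sqrt\kappa\gamma^{-1}}{\sqrt8\alpha},\frac12\big)$, $\mathcal R=\tau^{-1}L_GR^2\gamma^{-2}$. For $z=x-x'$, $w=v-v'$ let $$r_l^2=\gamma^{-2}z^TKz+\tfrac12|(1-2\tau)z+\gamma^{-1}w|^2+\tfrac12\gamma^{-2}|w|^2,\qquad r_s=\alpha|z|+|z+\gamma^{-1}w|,\qquad \Delta=r_s-\epsilon r_l,$$ $\mathcal K=\{(z,w):\kappa\gamma^{-2}|z|^2+\frac12|z+\gamma^{-1}w|^2+\frac12|\gamma^{-1}w|^2\le\mathcal R\}$, $D_{\mathcal K}=\sup_{(z,w)\in\mathcal K}\Delta$, $R_1=\sup_{\Delta\le D_{\mathcal K}}r_s$. Let $\phi(s)=\exp(-64\alpha\gamma^2(s\wedge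 R_1)^2)$, $\Phi(s)=\int_0^s\phi$, $\hat c=\big(\gamma\int_0^{R_1}\Phi/\phi\big)^{-1}$, $\psi(s)=1-\frac{\hat c\gamma}2\int_0^{s\wedge R_1}\Phi/\phi$, $f(r)=\int_0^r\phi\psi$, and $$\rho=f(\Delta\wedge D_{\mathcal K}+\epsilon r_l),\qquad \mathbf M=f'(R_1)^{-1}\,\frac{2\max(\gamma(1+\alpha),1)}{\epsilon\min(\sqrt{2\kappa},1)},$$ $$c=\min\Big(f'(R_1)\tfrac{\epsilon\kappa\gamma^{-1}}8\mathcal E,\ f'(R_1)\tfrac{\epsilon\gamma}{16}\mathcal E,\ f'(R_1)\tfrac\gamma8,\ f'(R_1)\tfrac{\gamma\alpha}2,\ \tfrac{9\hat c}{640},\ \tfrac{\hat c}{32(4\alpha+1)}\Big).$$ If $R_1=0$, then $\hat c=\infty$: the two terms of $c$ with $\hat c$ are dropped, and $\psi=1$. *Claim.* Suppose $\gamma\ge 4L_G/\sqrt\kappa$ and $$L\gamma^{-1}h\le\min\Big(\frac1{8LR_1^2},\ \frac1{256\cdot75(2L\gamma^{-2}+1)},\ \frac{L\gamma^{-2}}8,\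 \frac L{32L_K}\Big)$$ (the first term is $+\infty$ if $R_1=0$). Then $c>0$ and $\mathbf M>0$ depend only on $\kappa,L,L_G,L_K,R,\gamma$ (not on $d$, $h$, nor otherwise on $U$, $K$, $G$), and for all probability measures $\mu_0,\nu_0$ on $\mathbb R^{2d}$ and all $k\in\mathbb N$, $$\mathcal W_\rho(\mu_k,\nu_k)\le e^{-ckh}\,\mathcal W_\rho(\mu_0,\nu_0),\qquad \mathcal W_1(\mu_k,\nu_k)\le\mathbf M e^{-ckh}\,\mathcal W_1(\mu_0,\nu_0).$$ Moreover, the chain has exactly one invariant probability measure $\mu_{h,\infty}$; it has a finite first moment, and for all $\mu_0$ and $k\in\mathbb N$, $$\mathcal W_\rho(\mu_k,\mu_{h,\infty})\le e^{-ckh}\,\mathcal W_\rho(\mu_0,\mu_{h,\infty}),\qquad \mathcal W_1(\mu_k,\mu_{h,\infty})\le\mathbf M e^{-ckh}\,\mathcal W_1(\mu_0,\mu_{h,\infty}).$$ -/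

import Mathlib

open MeasureTheory ProbabilityTheory

open scoped RealInnerProductSpace Gradient ENNReal

noncomputable section

namespace KineticLangevin

/-- The Euclidean space `ℝ^d`. -/
abbrev Pos (d : ℕ) := EuclideanSpace ℝ (Fin d)

/-- The phase space `ℝ^{2d}` of pairs `(x, v)`. Distances on it are always written out explicitly
(the sup norm of the product is never used). -/
abbrev Phase (d : ℕ) := Pos d × Pos d

/-! ### Wasserstein distances -/

/-- The Euclidean distance on `ℝ^{2d}`. -/
def euclid {d : ℕ} (a b : Phase d) : ℝ :=
  √(‖a.1 - b.1‖ ^ 2 + ‖a.2 - b.2‖ ^ 2)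

/-- The `L¹`-Wasserstein distance with respect to a distance function `dist`, as the infimum of the
transport cost over all couplings. It may be infinite when moments are missing. -/
def wasserstein {d : ℕ} (dist : Phase d → Phase d → ℝ) (ν η : Measure (Phase d)) : ℝ≥0∞ :=
  ⨅ ω ∈ {ω : Measure (Phase d × Phase d) | ω.fst = ν ∧ ω.snd = η},
    ∫⁻ p, ENNReal.ofReal (dist p.1 p.2) ∂ω

/-! ### The Euler-Maruyama chain -/

/-- One Euler step from `a = (x, v)` with Gaussian input `ξ`. -/
def eulerStep {d : ℕ} (U : Pos d → ℝ) (γ h : ℝ) (a : Phase d) (ξ : Pos d) : Phase d :=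
  (a.1 + h • a.2,
    a.2 - h • ∇ U a.1 - (h * γ) • a.2 + √(2 * γ * h) • ξ)

/-- The Euler chain `(X_k, V_k)` started in `a` and driven by the sequence `ξ`. -/
def eulerChain {d : ℕ} (U : Pos d → ℝ) (γ h : ℝ) (a : Phase d) (ξ : ℕ → Pos d) : ℕ → Phase d
  | 0 => a
  | k + 1 => eulerStep U γ h (eulerChain U γ h a ξ k) (ξ (k + 1))

/-- The law of `(X_k, V_k)` when `(X_0, V_0)` has law `μ₀` and is independent of the i.i.d.
`N(0, I_d)` sequence `ξ`. -/
def eulerLaw {d : ℕ} (U : Pos d → ℝ) (γ h : ℝ) (μ₀ : Measure (Phase d)) (k : ℕ) :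
    Measure (Phase d) :=
  (μ₀.prod (Measure.infinitePi fun _ : ℕ => stdGaussian (Pos d))).map
    fun p => eulerChain U γ h p.1 p.2 k

/-- `μ` is an invariant probability measure of the Euler chain: it is preserved by one step. -/
def IsInvariantMeasure {d : ℕ} (U : Pos d → ℝ) (γ h : ℝ) (μ : Measure (Phase d)) : Prop :=
  IsProbabilityMeasure μ ∧ eulerLaw U γ h μ 1 = μ

/-! ### Assumptions -/

/-- The scalar parameters: convexity constant `κ`, Lipschitz constants `L`, `LG`, `LK` of
`∇ U`, `∇ G` and `x ↦ K x`, radius `R`, and friction `γ`. -/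
structure Params where
  κ : ℝ
  L : ℝ
  LG : ℝ
  LK : ℝ
  R : ℝ
  γ : ℝ

/-- `U` is `κ`-strongly convex outside a Euclidean ball of radius `R`, with `L`-Lipschitz gradient. -/
structure PotentialAssumption {d : ℕ} (p : Params) (U : Pos d → ℝ) : Prop where
  differentiable : Differentiable ℝ U
  strongly_convex : ∀ x y : Pos d, p.R < ‖x - y‖ → p.κ * ‖x - y‖ ^ 2 ≤ ⟪∇ U x - ∇ U y, x - y⟫
  lipschitz : ∀ x y : Pos d, ‖∇ U x - ∇ U y‖ ≤ p.L * ‖x - y‖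

/-- A splitting `U x = ½ xᵀ K x + G x` with `K` symmetric with smallest eigenvalue `κ` and
Lipschitz constant (operator norm) `LK`, and `G` convex outside a ball of radius `R` with
`LG`-Lipschitz gradient. -/
structure IsSplitting {d : ℕ} (p : Params) (U : Pos d → ℝ) (K : Pos d →L[ℝ] Pos d)
    (G : Pos d → ℝ) : Prop where
  split : ∀ x, U x = 1 / 2 * ⟪x, K x⟫ + G x
  symmetric : ∀ x y, ⟪K x, y⟫ = ⟪x, K y⟫
  smallest_eigenvalue :
    IsLeast {t : ℝ | Module.End.HasEigenvalue (K : Pos d →ₗ[ℝ] Pos d) t} p.κ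
  norm_eq : ‖K‖ = p.LK
  convex_outside : ∀ x y : Pos d, p.R < ‖x - y‖ → 0 ≤ ⟪∇ G x - ∇ G y, x - y⟫
  lipschitz : ∀ x y : Pos d, ‖∇ G x - ∇ G y‖ ≤ p.LG * ‖x - y‖

/-! ### The distance function and the constants -/

/-- `τ = min(1/8, γ⁻² κ / 4)`. -/
def tau (p : Params) : ℝ := min (1 / 8) (p.γ⁻¹ ^ 2 * p.κ / 4)

/-- `α = 2 L γ⁻²`. -/
def alpha (p : Params) : ℝ := 2 * p.L * p.γ⁻¹ ^ 2

/-- `ε = ½ min(1, 2α / (3 √LK γ⁻¹), α)`. -/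
def eps (p : Params) : ℝ :=
  1 / 2 * min (min 1 (2 * alpha p / (3 * √p.LK * p.γ⁻¹))) (alpha p)

/-- `ℰ = min(√κ γ⁻¹ / (√8 α), 1/2)`. -/
def calE (p : Params) : ℝ := min (√p.κ * p.γ⁻¹ / (√8 * alpha p)) (1 / 2)

/-- `ℛ = τ⁻¹ LG R² γ⁻²`. -/
def calR (p : Params) : ℝ := (tau p)⁻¹ * p.LG * p.R ^ 2 * p.γ⁻¹ ^ 2

/-- The large-distance metric `r_l`. -/
def rl {d : ℕ} (p : Params) (K : Pos d →L[ℝ] Pos d) (a b : Phase d) : ℝ :=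
  √(p.γ⁻¹ ^ 2 * ⟪a.1 - b.1, K (a.1 - b.1)⟫
    + 1 / 2 * ‖(1 - 2 * tau p) • (a.1 - b.1) + p.γ⁻¹ • (a.2 - b.2)‖ ^ 2
    + 1 / 2 * p.γ⁻¹ ^ 2 * ‖a.2 - b.2‖ ^ 2)

/-- The small-distance metric `r_s`. -/
def rs {d : ℕ} (p : Params) (a b : Phase d) : ℝ :=
  alpha p * ‖a.1 - b.1‖ + ‖(a.1 - b.1) + p.γ⁻¹ • (a.2 - b.2)‖

/-- `Δ = r_s - ε r_l`. -/
def Delta {d : ℕ} (p : Params) (K : Pos d →L[ℝ] Pos d) (a b : Phase d) : ℝ :=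
  rs p a b - eps p * rl p K a b

/-- The compact set `𝒦` of differences `(z, w)`. -/
def compactSet (d : ℕ) (p : Params) : Set (Phase d) :=
  {c | p.κ * p.γ⁻¹ ^ 2 * ‖c.1‖ ^ 2 + 1 / 2 * ‖c.1 + p.γ⁻¹ • c.2‖ ^ 2
    + 1 / 2 * ‖p.γ⁻¹ • c.2‖ ^ 2 ≤ calR p}

/-- `D_𝒦`, the supremum of `Δ` over pairs whose difference lies in `𝒦`. -/
def DK {d : ℕ} (p : Params) (K : Pos d →L[ℝ] Pos d) : ℝ :=
  sSup {t | ∃ a b : Phase d, a - b ∈ compactSet d p ∧ t = Delta p K a b}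

/-- `R₁`, the supremum of `r_s` over pairs with `Δ ≤ D_𝒦`. -/
def R1 {d : ℕ} (p : Params) (K : Pos d →L[ℝ] Pos d) : ℝ :=
  sSup {t | ∃ a b : Phase d, Delta p K a b ≤ DK p K ∧ t = rs p a b}

/-- `φ(s) = exp(-128 α γ² (s ∧ R₁)² / 2)`. -/
def phi {d : ℕ} (p : Params) (K : Pos d →L[ℝ] Pos d) (s : ℝ) : ℝ :=
  Real.exp (-128 * alpha p * p.γ ^ 2 * (min s (R1 p K) ^ 2 / 2))

/-- `Φ(s) = ∫₀ˢ φ`. -/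
def capPhi {d : ℕ} (p : Params) (K : Pos d →L[ℝ] Pos d) (s : ℝ) : ℝ :=
  ∫ x in (0 : ℝ)..s, phi p K x

/-- `ĉ = 1 / (γ ∫₀^{R₁} Φ / φ)`. If `R₁ = 0` this is `+∞` mathematically and `0` in the code;
see `psi` and `rate` for this case. -/
def cHat {d : ℕ} (p : Params) (K : Pos d →L[ℝ] Pos d) : ℝ :=
  1 / (p.γ * ∫ s in (0 : ℝ)..(R1 p K), capPhi p K s * (phi p K s)⁻¹)

/-- `ψ(s) = 1 - (ĉ/2) γ ∫₀^{s ∧ R₁} Φ / φ`. If `R₁ = 0` then `ψ = 1` on `[0, ∞)`. -/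
def psi {d : ℕ} (p : Params) (K : Pos d →L[ℝ] Pos d) (s : ℝ) : ℝ :=
  1 - cHat p K / 2 * p.γ *
    ∫ x in (0 : ℝ)..(min s (R1 p K)), capPhi p K x * (phi p K x)⁻¹

/-- The concave function `f(r) = ∫₀ʳ φ ψ`. -/
def f {d : ℕ} (p : Params) (K : Pos d →L[ℝ] Pos d) (r : ℝ) : ℝ :=
  ∫ s in (0 : ℝ)..r, phi p K s * psi p K s

/-- The distance `ρ = f(Δ ∧ D_𝒦 + ε r_l)`. -/
def rho {d : ℕ} (p : Params) (K : Pos d →L[ℝ] Pos d) (a b : Phase d) : ℝ :=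
  f p K (min (Delta p K a b) (DK p K) + eps p * rl p K a b)

/-- The contraction rate `c`. If `R₁ = 0`, then `ĉ = +∞` and the two terms that contain `ĉ` do not
contribute to the minimum. -/
def rate {d : ℕ} (p : Params) (K : Pos d →L[ℝ] Pos d) : ℝ :=
  let f' := deriv (f p K) (R1 p K)
  let m := min (min (f' * (eps p * p.κ * p.γ⁻¹ / 8) * calE p) (f' * (eps p * p.γ / 16) * calE p))
    (min (f' * (p.γ / 8)) (f' * (p.γ * alpha p / 2)))
  if R1 p K = 0 then m
  else min m (min (9 * cHat p K / 640) (cHat p K / (32 * (4 * alpha p + 1))))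

/-- The prefactor `𝐌 = f'(R₁)⁻¹ · 2 max(γ(1+α), 1) / (ε min(√(2κ), 1))`. -/
def constM {d : ℕ} (p : Params) (K : Pos d →L[ℝ] Pos d) : ℝ :=
  (deriv (f p K) (R1 p K))⁻¹ *
    (2 * max (p.γ * (1 + alpha p)) 1 / (eps p * min (√(2 * p.κ)) 1))

/-- The step size condition `L γ⁻¹ h ≤ min(1/(8LR₁²), 1/(256·75(2Lγ⁻²+1)), Lγ⁻²/8, L/(32 LK))`.
The first bound is multiplied out, so that it is void when `R₁ = 0`. -/
def StepSizeCondition {d : ℕ} (p : Params) (K : Pos d →L[ℝ] Pos d) (h : ℝ) : Prop :=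
  p.L * p.γ⁻¹ * h * (8 * p.L * R1 p K ^ 2) ≤ 1 ∧
  p.L * p.γ⁻¹ * h ≤ min (1 / (256 * 75 * (2 * p.L * p.γ⁻¹ ^ 2 + 1)))
    (min (p.L * p.γ⁻¹ ^ 2 / 8) (p.L / (32 * p.LK)))

end KineticLangevin

end

namespace KineticLangevin

/-! ### Integrals of bounded continuous functions on an interval -/

/-! Put η = hγ, q = z + γ⁻¹w and s = γ⁻¹√(2γh). One step of two chains gives z' = (1 - η)z + ηq and
q' = q - γ⁻¹h(∇U(x) - ∇U(x')) + s(ξ - ξ'): the noise enters only q, and z shrinks by itself once q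
is small against z. The core of the proof is a coupling of the two noises that multiplies the
expectation of ρ by at most 1 - ch, whatever the current pair of states.

If Δ > D_𝒦, the difference lies outside 𝒦 and both chains get the same noise. There r_l² is a
Lyapunov function: the possible nonconvexity of G costs at most τℛ, which is less than the quadratic
form gains (`quadratic_form_contraction`, `rl_eulerStep_le`). If Δ ≤ D_𝒦, then ρ = f(r_s). For |q| ≤
|z|/4 the same noise still works, as the drift alone lowers r_s (`drift_contraction`). For |q| >
|z|/4 the drift can raise r_s by an amount of order ηα|q|, and the concavity of f has to pay for it.

In this last region the components of the noises along the drifted q are coupled so that they cancel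
the difference with the largest possible probability; otherwise they are reflections of each other
(`lintegral_jump`). Writing c for α|z'| and Q for the length of the drifted q, the expected value of
f(c + |q'|) - f(c) equals the Gaussian expectation of the odd extension of y ↦ f(c + y) - f(c) at Q
+ 2sx (`integral_reflect`). Symmetric differences of this odd function decrease in the step, so a
tail bound for |x| turns the Jensen gap into a second difference at one fixed step
(`integral_oddShift_le`). That second difference is bounded below because f' = φψ decreases at a
known rate: φ supplies a Gaussian factor on [0, R₁], ψ an excess over f'(R₁). The exponent A = 64αγ²
of φ satisfies A s² = 128ηα, which makes the gain at least twice the drift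
(`small_distance_contraction`).

The regions fit together because ρ ≤ f(r_s) and ρ ≤ f(D_𝒦 + ε r_l) hold everywhere, with equality in
the region where each is used; it never matters where a step lands. Applying the coupled step to an
arbitrary coupling and iterating gives the contraction of W_ρ, and the comparison of ρ with the
Euclidean distance gives that of W₁.

The constants depend only on the scalar parameters, since D_𝒦 and R₁ can be computed on collinear z
and q along an extremal eigenvector of K (`DK_congr`, `R1_congr`). For existence of the invariant
measure, the laws of the chain started at 0 have summable W₁ increments, hence bounded first moments
and a weak limit point, which is invariant. For uniqueness, these laws converge weakly to every
invariant measure, whether or not it has moments (`tendsto_originLaw`). -/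

lemma integral_le_mul {G : ℝ → ℝ} (hG : Continuous G) {u v c : ℝ} (huv : u ≤ v)
    (h : ∀ t, u ≤ t → t ≤ v → G t ≤ c) : ∫ t in u..v, G t ≤ (v - u) * c := by
  have := intervalIntegral.integral_mono_on huv (hG.intervalIntegrable u v)
    (continuous_const.intervalIntegrable (μ := volume) u v) (g := fun _ => c)
    (fun t ht => h t ht.1 ht.2)
  simpa using this

lemma mul_le_integral {G : ℝ → ℝ} (hG : Continuous G) {u v c : ℝ} (huv : u ≤ v)
    (h : ∀ t, u ≤ t → t ≤ v → c ≤ G t) : (v - u) * c ≤ ∫ t in u..v, G t := by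
  have := intervalIntegral.integral_mono_on huv
    (continuous_const.intervalIntegrable (μ := volume) u v) (hG.intervalIntegrable u v)
    (f := fun _ => c) (fun t ht => h t ht.1 ht.2)
  simpa using this

lemma integral_add_adjacent {G : ℝ → ℝ} (hG : Continuous G) (a b c : ℝ) :
    (∫ t in a..b, G t) + ∫ t in b..c, G t = ∫ t in a..c, G t :=
  intervalIntegral.integral_add_adjacent_intervals (hG.intervalIntegrable _ _)
    (hG.intervalIntegrable _ _)

/-! ### The derivative of the concave function -/

/-- The properties of `g = φ ψ` that the contraction estimates use: `g` is positive, bounded by `1`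
and decreasing on `[0, ∞)`, constant beyond `R₁`, and decays at a quantified rate on `[0, R₁]`. -/
structure IsProfile (A R₁ : ℝ) (g : ℝ → ℝ) : Prop where
  continuous : Continuous g
  antitone : ∀ u v, 0 ≤ u → u ≤ v → g v ≤ g u
  floor : ∀ u, 0 ≤ u → g R₁ ≤ g u
  floor_pos : 0 < g R₁
  le_one : ∀ u, 0 ≤ u → g u ≤ 1
  decay : ∀ u v, 0 ≤ u → u ≤ v → v ≤ R₁ → g v * Real.exp (A * (v ^ 2 - u ^ 2)) ≤ g u
  excess : ∀ u, 0 ≤ u → u ≤ R₁ → 0 < R₁ → (1 - u / R₁) / 2 * g u ≤ g u - g R₁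

lemma IsProfile.pos {A R₁ : ℝ} {g : ℝ → ℝ} (hg : IsProfile A R₁ g) {u : ℝ} (hu : 0 ≤ u) :
    0 < g u := hg.floor_pos.trans_le (hg.floor u hu)

section Profile

variable {d : ℕ} (p : Params) (K : Pos d →L[ℝ] Pos d)

lemma phi_pos (s : ℝ) : 0 < phi p K s := Real.exp_pos _

lemma continuous_phi : Continuous (phi p K) := by unfold phi; fun_prop

lemma phi_antitone (hα : 0 ≤ alpha p) (hR₁ : 0 ≤ R1 p K) {u v : ℝ} (hu : 0 ≤ u) (huv : u ≤ v) :
    phi p K v ≤ phi p K u := by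
  unfold phi
  apply Real.exp_le_exp.mpr
  have h1 : min u (R1 p K) ≤ min v (R1 p K) := min_le_min_right _ huv
  have h0 : 0 ≤ min u (R1 p K) := le_min hu hR₁
  have h2 : min u (R1 p K) ^ 2 ≤ min v (R1 p K) ^ 2 := by gcongr
  have h3 : 0 ≤ alpha p * p.γ ^ 2 := by positivity
  nlinarith

lemma phi_le_one (hα : 0 ≤ alpha p) (s : ℝ) : phi p K s ≤ 1 := by
  unfold phi
  apply Real.exp_le_one_iff.mpr
  have h3 : 0 ≤ alpha p * p.γ ^ 2 := by positivity
  have : 0 ≤ alpha p * p.γ ^ 2 * (min s (R1 p K) ^ 2 / 2) := by positivity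
  linarith

lemma phi_decay {u v : ℝ} (huv : u ≤ v) (hv : v ≤ R1 p K) :
    phi p K v * Real.exp (64 * alpha p * p.γ ^ 2 * (v ^ 2 - u ^ 2)) = phi p K u := by
  unfold phi
  rw [min_eq_left hv, min_eq_left (huv.trans hv), ← Real.exp_add]
  congr 1; ring

/-- The integrand `Φ / φ`. -/
noncomputable def ratio (x : ℝ) : ℝ := capPhi p K x * (phi p K x)⁻¹

lemma continuous_capPhi : Continuous (capPhi p K) := by
  unfold capPhi
  exact intervalIntegral.continuous_primitive
    (fun a b => (continuous_phi p K).intervalIntegrable a b) 0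

lemma continuous_ratio : Continuous (ratio p K) :=
  (continuous_capPhi p K).mul ((continuous_phi p K).inv₀ fun s => (phi_pos p K s).ne')

lemma capPhi_mono {u v : ℝ} (huv : u ≤ v) : capPhi p K u ≤ capPhi p K v := by
  unfold capPhi
  rw [← integral_add_adjacent (continuous_phi p K) 0 u v]
  have := mul_le_integral (continuous_phi p K) huv (c := 0) fun t _ _ => (phi_pos p K t).le
  linarith

lemma capPhi_zero : capPhi p K 0 = 0 := by simp [capPhi]

lemma capPhi_pos {u : ℝ} (hu : 0 < u) : 0 < capPhi p K u :=
  intervalIntegral.intervalIntegral_pos_of_pos ((continuous_phi p K).intervalIntegrable _ _)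
    (phi_pos p K) hu

lemma ratio_nonneg {u : ℝ} (hu : 0 ≤ u) : 0 ≤ ratio p K u := by
  have := capPhi_mono p K hu
  rw [capPhi_zero] at this
  exact mul_nonneg this (inv_nonneg.mpr (phi_pos p K u).le)

lemma ratio_mono (hα : 0 ≤ alpha p) (hR₁ : 0 ≤ R1 p K) {u v : ℝ} (hu : 0 ≤ u) (huv : u ≤ v) :
    ratio p K u ≤ ratio p K v := by
  have h0 := capPhi_mono p K (hu.trans huv)
  rw [capPhi_zero] at h0
  exact mul_le_mul (capPhi_mono p K huv)
    (inv_anti₀ (phi_pos p K v) (phi_antitone p K hα hR₁ hu huv))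
    (inv_nonneg.mpr (phi_pos p K u).le) h0

/-- The primitive of `Φ / φ`. -/
noncomputable def ratioInt (t : ℝ) : ℝ := ∫ x in (0 : ℝ)..t, ratio p K x

lemma ratioInt_zero : ratioInt p K 0 = 0 := by simp [ratioInt]

lemma ratioInt_mono {u v : ℝ} (hu : 0 ≤ u) (huv : u ≤ v) :
    ratioInt p K u ≤ ratioInt p K v := by
  unfold ratioInt
  rw [← integral_add_adjacent (continuous_ratio p K) 0 u v]
  have := mul_le_integral (continuous_ratio p K) huv (c := 0)
    fun t ht _ => ratio_nonneg p K (hu.trans ht)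
  linarith

lemma ratioInt_pos {u : ℝ} (hu : 0 < u) : 0 < ratioInt p K u := by
  refine intervalIntegral.intervalIntegral_pos_of_pos_on
    ((continuous_ratio p K).intervalIntegrable _ _) (fun x hx => ?_) hu
  exact mul_pos (capPhi_pos p K hx.1) (inv_pos.mpr (phi_pos p K x))

/-- Convexity: the primitive of a nondecreasing function that vanishes at 0 lies below its chords
from the origin. This makes `psi` lie above the straight line from 1 at 0 to 1/2 at `R₁`. -/
lemma mul_ratioInt_le (hα : 0 ≤ alpha p) {u v : ℝ} (hu : 0 ≤ u) (huv : u ≤ v)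
    (hR₁ : 0 ≤ R1 p K) : v * ratioInt p K u ≤ u * ratioInt p K v := by
  have h1 : ratioInt p K u ≤ (u - 0) * ratio p K u :=
    integral_le_mul (continuous_ratio p K) hu fun t ht ht' => ratio_mono p K hα hR₁ ht ht'
  have h2 : (v - u) * ratio p K u ≤ ∫ x in u..v, ratio p K x :=
    mul_le_integral (continuous_ratio p K) huv fun t ht _ => ratio_mono p K hα hR₁ hu ht
  have h3 : ratioInt p K u + ∫ x in u..v, ratio p K x = ratioInt p K v :=
    integral_add_adjacent (continuous_ratio p K) 0 u v
  nlinarith [mul_le_mul_of_nonneg_left h2 hu, mul_le_mul_of_nonneg_left h1 (sub_nonneg.mpr huv)]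

lemma cHat_eq : cHat p K = 1 / (p.γ * ratioInt p K (R1 p K)) := rfl

lemma cHat_pos (hγ : 0 < p.γ) (hR₁ : 0 < R1 p K) : 0 < cHat p K := by
  rw [cHat_eq]
  have := ratioInt_pos p K hR₁
  positivity

lemma psi_eq (s : ℝ) :
    psi p K s = 1 - cHat p K / 2 * p.γ * ratioInt p K (min s (R1 p K)) := rfl

lemma psi_eq_of_pos (hγ : 0 < p.γ) (hR₁ : 0 < R1 p K) (s : ℝ) :
    psi p K s = 1 - ratioInt p K (min s (R1 p K)) / ratioInt p K (R1 p K) / 2 := by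
  rw [psi_eq, cHat_eq]
  have := ratioInt_pos p K hR₁
  field_simp

/-- The integral in `psi` is over an interval of length zero, so the value that the division by zero
assigns to `cHat` has no effect. -/
lemma psi_eq_of_zero (hR₁ : R1 p K = 0) {s : ℝ} (hs : 0 ≤ s) : psi p K s = 1 := by
  rw [psi_eq, hR₁, min_eq_right hs, ratioInt_zero]; ring

lemma continuous_psi : Continuous (psi p K) := by
  have h : Continuous (ratioInt p K) := intervalIntegral.continuous_primitive
    (fun a b => (continuous_ratio p K).intervalIntegrable a b) 0
  have : psi p K = fun s => 1 - cHat p K / 2 * p.γ * ratioInt p K (min s (R1 p K)) := rfl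
  rw [this]
  exact continuous_const.sub (continuous_const.mul
    (h.comp (continuous_id.min continuous_const)))

lemma psi_bounds (hγ : 0 < p.γ) (hR₁ : 0 ≤ R1 p K) {s : ℝ} (hs : 0 ≤ s) :
    1 / 2 ≤ psi p K s ∧ psi p K s ≤ 1 := by
  rcases hR₁.eq_or_lt with h | h
  · rw [psi_eq_of_zero p K h.symm hs]; norm_num
  · rw [psi_eq_of_pos p K hγ h]
    have hpos := ratioInt_pos p K h
    have h0 : 0 ≤ min s (R1 p K) := le_min hs hR₁
    have h1 := ratioInt_mono p K h0 (min_le_right s (R1 p K))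
    have h2 := ratioInt_mono p K le_rfl h0
    rw [ratioInt_zero] at h2
    have h3 : ratioInt p K (min s (R1 p K)) / ratioInt p K (R1 p K) ≤ 1 := by
      rwa [div_le_one hpos]
    have h4 : 0 ≤ ratioInt p K (min s (R1 p K)) / ratioInt p K (R1 p K) := by positivity
    constructor <;> linarith

lemma psi_antitone (hγ : 0 < p.γ) (hR₁ : 0 ≤ R1 p K) {u v : ℝ} (hu : 0 ≤ u) (huv : u ≤ v) :
    psi p K v ≤ psi p K u := by
  rcases hR₁.eq_or_lt with h | h
  · rw [psi_eq_of_zero p K h.symm hu, psi_eq_of_zero p K h.symm (hu.trans huv)]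
  · rw [psi_eq_of_pos p K hγ h, psi_eq_of_pos p K hγ h]
    have hpos := ratioInt_pos p K h
    have := ratioInt_mono p K (le_min hu hR₁) (min_le_min_right (R1 p K) huv)
    gcongr

/-- The two factors do different work: `decay` comes from the Gaussian shape of `phi`, with `psi`
merely monotone, while `excess` comes from `psi`, with `phi` merely monotone. -/
lemma isProfile_phi_mul_psi (hγ : 0 < p.γ) (hα : 0 ≤ alpha p) (hR₁ : 0 ≤ R1 p K) :
    IsProfile (64 * alpha p * p.γ ^ 2) (R1 p K) (fun s => phi p K s * psi p K s) where
  continuous := (continuous_phi p K).mul (continuous_psi p K)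
  antitone u v hu huv := mul_le_mul (phi_antitone p K hα hR₁ hu huv)
    (psi_antitone p K hγ hR₁ hu huv)
    (by linarith [(psi_bounds p K hγ hR₁ (hu.trans huv)).1]) (phi_pos p K u).le
  floor u hu := by
    rcases le_total u (R1 p K) with h | h
    · exact mul_le_mul (phi_antitone p K hα hR₁ hu h) (psi_antitone p K hγ hR₁ hu h)
        (by linarith [(psi_bounds p K hγ hR₁ hR₁).1]) (phi_pos p K u).le
    · apply le_of_eq
      simp [phi, psi, min_eq_right h]
  floor_pos := mul_pos (phi_pos p K _) (by linarith [(psi_bounds p K hγ hR₁ hR₁).1])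
  le_one u hu := by
    have := psi_bounds p K hγ hR₁ hu
    exact mul_le_one₀ (phi_le_one p K hα u) (by linarith) this.2
  decay u v hu huv hv := by
    have := psi_antitone p K hγ hR₁ hu huv
    have h2 := phi_decay p K huv hv
    calc _ = (phi p K v * Real.exp (64 * alpha p * p.γ ^ 2 * (v ^ 2 - u ^ 2))) * psi p K v := by
          ring
      _ ≤ _ := by rw [h2]; exact mul_le_mul_of_nonneg_left this (phi_pos p K u).le
  excess u hu huR hR := by
    have hI := ratioInt_pos p K hR
    have h1 : phi p K (R1 p K) ≤ phi p K u := phi_antitone p K hα hR₁ hu huR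
    have h2 : psi p K (R1 p K) = 1 / 2 := by
      rw [psi_eq_of_pos p K hγ hR, min_self, div_self hI.ne']; norm_num
    have h3 : (1 - u / R1 p K) / 2 ≤ psi p K u - 1 / 2 := by
      rw [psi_eq_of_pos p K hγ hR, min_eq_left huR]
      have : ratioInt p K u / ratioInt p K (R1 p K) ≤ u / R1 p K := by
        rw [div_le_div_iff₀ hI hR]
        linarith [mul_ratioInt_le p K hα hu huR hR₁]
      linarith
    have h4 := psi_bounds p K hγ hR₁ hu
    have h5 := phi_pos p K u
    have h6 : 0 ≤ (1 - u / R1 p K) / 2 := by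
      have : u / R1 p K ≤ 1 := by rwa [div_le_one hR]
      linarith
    rw [h2]
    calc (1 - u / R1 p K) / 2 * (phi p K u * psi p K u)
        ≤ (1 - u / R1 p K) / 2 * (phi p K u * 1) := by gcongr; exact h4.2
      _ ≤ (psi p K u - 1 / 2) * phi p K u := by rw [mul_one]; gcongr
      _ ≤ phi p K u * psi p K u - phi p K (R1 p K) * (1 / 2) := by linarith

lemma deriv_f (r : ℝ) : deriv (f p K) r = phi p K r * psi p K r := by
  have h := ((continuous_phi p K).mul (continuous_psi p K))
  exact (h.integral_hasStrictDerivAt 0 r).hasDerivAt.deriv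

end Profile

/-! ### Concave functions with a given profile as derivative -/

section Concave

variable {A R₁ : ℝ} {g : ℝ → ℝ} (hg : IsProfile A R₁ g)
include hg

lemma IsProfile.sub_le {u v : ℝ} (hu : 0 ≤ u) (huv : u ≤ v) :
    (∫ t in (0 : ℝ)..v, g t) - (∫ t in (0 : ℝ)..u, g t) ≤ (v - u) * g u := by
  rw [← integral_add_adjacent hg.continuous 0 u v, add_sub_cancel_left]
  exact integral_le_mul hg.continuous huv fun t ht _ => hg.antitone u t hu ht

lemma IsProfile.le_sub {u v : ℝ} (hu : 0 ≤ u) (huv : u ≤ v) :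
    (v - u) * g v ≤ (∫ t in (0 : ℝ)..v, g t) - (∫ t in (0 : ℝ)..u, g t) := by
  rw [← integral_add_adjacent hg.continuous 0 u v, add_sub_cancel_left]
  exact mul_le_integral hg.continuous huv fun t ht ht' => hg.antitone t v (hu.trans ht) ht'

lemma IsProfile.floor_mul_le_sub {u v : ℝ} (hu : 0 ≤ u) (huv : u ≤ v) :
    (v - u) * g R₁ ≤ (∫ t in (0 : ℝ)..v, g t) - (∫ t in (0 : ℝ)..u, g t) :=
  (mul_le_mul_of_nonneg_left (hg.floor v (hu.trans huv)) (sub_nonneg.mpr huv)).trans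
    (hg.le_sub hu huv)

lemma IsProfile.integral_mono {u v : ℝ} (hu : 0 ≤ u) (huv : u ≤ v) :
    (∫ t in (0 : ℝ)..u, g t) ≤ ∫ t in (0 : ℝ)..v, g t := by
  have := hg.floor_mul_le_sub hu huv
  have := mul_nonneg (sub_nonneg.mpr huv) hg.floor_pos.le
  linarith

lemma IsProfile.integral_nonneg {u : ℝ} (hu : 0 ≤ u) : 0 ≤ ∫ t in (0 : ℝ)..u, g t := by
  simpa using hg.integral_mono le_rfl hu

lemma IsProfile.integral_le_self {u : ℝ} (hu : 0 ≤ u) : (∫ t in (0 : ℝ)..u, g t) ≤ u := by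
  have := hg.sub_le le_rfl hu
  have h1 := mul_le_mul_of_nonneg_left (hg.le_one 0 le_rfl) hu
  simp at this
  linarith

lemma IsProfile.mul_le_integral_self {u : ℝ} (hu : 0 ≤ u) :
    g R₁ * u ≤ ∫ t in (0 : ℝ)..u, g t := by
  have := hg.floor_mul_le_sub le_rfl hu
  simp at this
  linarith

end Concave

/-! ### The odd extension of a shifted concave function -/

/-- The odd function whose restriction to `[0, ∞)` is `y ↦ f (c + y) - f c`, where `f' = g`. -/
noncomputable def oddShift (g : ℝ → ℝ) (c y : ℝ) : ℝ := ∫ u in (0 : ℝ)..y, g (c + |u|)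

section OddShift

variable {A R₁ : ℝ} {g : ℝ → ℝ} (hg : IsProfile A R₁ g) {c : ℝ}

lemma oddShift_neg (g : ℝ → ℝ) (c y : ℝ) : oddShift g c (-y) = -oddShift g c y := by
  unfold oddShift
  have h := intervalIntegral.integral_comp_neg (a := 0) (b := y) (fun u => g (c + |u|))
  simp only [abs_neg, neg_zero] at h
  rw [h, intervalIntegral.integral_symm]

include hg

lemma continuous_shift : Continuous fun u => g (c + |u|) :=
  hg.continuous.comp (continuous_const.add continuous_abs)

lemma continuous_oddShift : Continuous (oddShift g c) :=
  intervalIntegral.continuous_primitive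
    (fun a b => (continuous_shift hg).intervalIntegrable a b) 0

lemma oddShift_of_nonneg {y : ℝ} (hy : 0 ≤ y) :
    oddShift g c y = (∫ t in (0 : ℝ)..(c + y), g t) - ∫ t in (0 : ℝ)..c, g t := by
  rw [← integral_add_adjacent hg.continuous 0 c (c + y), add_sub_cancel_left]
  have h := intervalIntegral.integral_comp_add_left (a := 0) (b := y) g c
  rw [add_zero] at h
  rw [← h]
  apply intervalIntegral.integral_congr
  intro u hu
  rw [Set.uIcc_of_le hy] at hu
  simp only [abs_of_nonneg hu.1]

lemma abs_oddShift_le (hc : 0 ≤ c) (y : ℝ) : |oddShift g c y| ≤ |y| := by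
  have key : ∀ y, 0 ≤ y → |oddShift g c y| ≤ |y| := by
    intro y hy
    rw [abs_of_nonneg hy, abs_le]
    have h1 := integral_le_mul (continuous_shift hg (c := c)) hy (c := 1)
      fun t _ _ => hg.le_one _ (by positivity)
    have h2 := mul_le_integral (continuous_shift hg (c := c)) hy (c := 0)
      fun t _ _ => (hg.pos (by positivity)).le
    unfold oddShift
    constructor <;> linarith
  rcases le_total 0 y with hy | hy
  · exact key y hy
  · have := key (-y) (by linarith)
    rwa [oddShift_neg, abs_neg, abs_neg] at this

/-- Symmetric second differences of the odd function are decreasing in the step. -/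
lemma oddShift_symm_antitone (hc : 0 ≤ c) {Q δ t : ℝ} (hQ : 0 ≤ Q) (hδ : 0 ≤ δ) (hδt : δ ≤ t) :
    oddShift g c (Q + t) + oddShift g c (Q - t)
      ≤ oddShift g c (Q + δ) + oddShift g c (Q - δ) := by
  have hG := continuous_shift hg (c := c)
  have e1 : oddShift g c (Q + δ) + ∫ u in (Q + δ)..(Q + t), g (c + |u|)
      = oddShift g c (Q + t) := integral_add_adjacent hG _ _ _
  have e2 : oddShift g c (Q - t) + ∫ u in (Q - t)..(Q - δ), g (c + |u|)
      = oddShift g c (Q - δ) := integral_add_adjacent hG _ _ _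
  have e3 : ∫ u in δ..t, g (c + |Q + u|) = ∫ u in (Q + δ)..(Q + t), g (c + |u|) :=
    intervalIntegral.integral_comp_add_left (fun u => g (c + |u|)) Q
  have e4 : ∫ u in δ..t, g (c + |Q - u|) = ∫ u in (Q - t)..(Q - δ), g (c + |u|) :=
    intervalIntegral.integral_comp_sub_left (fun u => g (c + |u|)) Q
  -- The derivative in the step `u` is `g (c + |Q + u|) - g (c + |Q - u|)`, which is nonpositive
  -- because `|Q - u| ≤ Q + u`.
  have h : ∫ u in δ..t, g (c + |Q + u|) ≤ ∫ u in δ..t, g (c + |Q - u|) := by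
    refine intervalIntegral.integral_mono_on hδt
      ((hG.comp (continuous_const.add continuous_id)).intervalIntegrable _ _)
      ((hG.comp (continuous_const.sub continuous_id)).intervalIntegrable _ _) fun u hu => ?_
    refine hg.antitone _ _ (by positivity) ?_
    have hu0 : 0 ≤ u := hδ.trans hu.1
    rw [abs_of_nonneg (add_nonneg hQ hu0)]
    have : |Q - u| ≤ Q + u := abs_le.mpr ⟨by linarith, by linarith⟩
    linarith
  linarith

end OddShift

/-! ### Drift against noise at small distances -/

section SmallDistance

variable {A R₁ : ℝ} {g : ℝ → ℝ} (hg : IsProfile A R₁ g)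
include hg

/-- The gain from a symmetric step of size at most the distance to the absorbing point. -/
lemma second_difference_ge {c Q δ y m : ℝ} (hc : 0 ≤ c) (hδ : δ ≤ Q) (hy : 0 ≤ y) (hyδ : y ≤ δ)
    (hm : c + Q - y ≤ m) (hm' : m ≤ c + Q) (hmR : m ≤ R₁) :
    (δ - y) * (A * (m ^ 2 - (c + Q - y) ^ 2) * g m)
      ≤ 2 * oddShift g c Q - oddShift g c (Q + δ) - oddShift g c (Q - δ) := by
  have hQ : 0 ≤ Q := by linarith
  rw [oddShift_of_nonneg hg hQ, oddShift_of_nonneg hg (by linarith : 0 ≤ Q + δ),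
    oddShift_of_nonneg hg (by linarith : 0 ≤ Q - δ)]
  -- The inner increments on both sides of `c + Q` are compared with the same `y * g (c + Q)` and
  -- cancel. The outer ones, of length `δ - y`, leave `g (c + Q - y) - g (c + Q + y)`, and `m` lies
  -- between these two points.
  have h1 := hg.le_sub (u := c + (Q - δ)) (v := c + Q - y) (by linarith) (by linarith)
  have h2 := hg.le_sub (u := c + Q - y) (v := c + Q) (by linarith) (by linarith)
  have h3 := hg.sub_le (u := c + Q) (v := c + Q + y) (by linarith) (by linarith)
  have h4 := hg.sub_le (u := c + Q + y) (v := c + (Q + δ)) (by linarith) (by linarith)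
  have h5 := hg.antitone m (c + Q + y) (by linarith) (by linarith)
  have h6 := hg.decay (c + Q - y) m (by linarith) hm hmR
  have h7 := Real.add_one_le_exp (A * (m ^ 2 - (c + Q - y) ^ 2))
  have h8 := mul_le_mul_of_nonneg_left h7 (hg.pos (by linarith : 0 ≤ m)).le
  have h9 : A * (m ^ 2 - (c + Q - y) ^ 2) * g m ≤ g (c + Q - y) - g (c + Q + y) := by linarith
  have h10 := mul_le_mul_of_nonneg_left h9 (by linarith : 0 ≤ δ - y)
  linarith

/-- The gain from a symmetric step that passes the absorbing point. -/
lemma second_difference_ge_of_lt {c Q s : ℝ} (hc : 0 ≤ c) (hQ : 0 ≤ Q) (hQs : Q ≤ s / 2) :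
    Q * (g (c + Q / 2) - g (c + Q + s))
      ≤ 2 * oddShift g c Q - oddShift g c (Q + 2 * s) - oddShift g c (Q - 2 * s) := by
  have e : oddShift g c (Q - 2 * s) = -oddShift g c (2 * s - Q) := by
    rw [← oddShift_neg, neg_sub]
  rw [e, oddShift_of_nonneg hg hQ, oddShift_of_nonneg hg (by linarith : 0 ≤ Q + 2 * s),
    oddShift_of_nonneg hg (by linarith : 0 ≤ 2 * s - Q)]
  have h1 := hg.le_sub (u := c) (v := c + Q / 2) hc (by linarith)
  have h2 := hg.le_sub (u := c + Q / 2) (v := c + Q) (by linarith) (by linarith)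
  have h3 := hg.sub_le (u := c + (2 * s - Q)) (v := c + (Q + 2 * s)) (by linarith) (by linarith)
  have h4 := hg.antitone (c + Q + s) (c + (2 * s - Q)) (by linarith) (by linarith)
  have h5 := hg.antitone (c + Q) (c + Q + s) (by linarith) (by linarith)
  nlinarith [mul_le_mul_of_nonneg_left h4 hQ, mul_le_mul_of_nonneg_left h5 hQ]

/-- The gain from the noise dominates the drift if the distance is at least half the noise scale. -/
lemma drift_le_gain_of_le {β s b c Q r : ℝ} (hβ : 0 < β) (hs : 0 < s)
    (hA : A * s ^ 2 = 128 * β) (hb : 0 < b) (hbr : b ≤ r) (hr : r ≤ R₁) (hc : 0 ≤ c)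
    (hQ1 : 99 / 100 * b ≤ Q) (hβb : β * b ≤ 1 / 9600 * b)
    (hβs : β * b ≤ s / 2) (hrhat : c + Q ≤ r + β * b) (hsQ : s / 2 ≤ Q) :
    2 * (β * b * g r)
      ≤ 3 / 10 * (2 * oddShift g c Q - oddShift g c (Q + s) - oddShift g c (Q - s)) := by
  have hgr := hg.pos (hb.le.trans hbr)
  have hβb0 : 0 < β * b := by positivity
  have hA0 : 0 < A := by
    by_contra hneg
    have := mul_nonpos_of_nonpos_of_nonneg (not_lt.mp hneg) (sq_nonneg s)
    linarith
  -- The factor `192/10` is half of `3/10 * 128`, where `128` comes from `A * s ^ 2 = 128 * β` and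
  -- the half from the drift being counted twice. What remains is to choose `δ`, `y` and `m`.
  have gain : ∀ δ y m : ℝ, δ ≤ Q → δ ≤ s → 0 ≤ y → y ≤ δ → c + Q - y ≤ m → m ≤ c + Q → m ≤ r →
      b * s ^ 2 ≤ 192 / 10 * ((δ - y) * ((m - (c + Q - y)) * (m + (c + Q - y)))) →
      2 * (β * b * g r)
        ≤ 3 / 10 * (2 * oddShift g c Q - oddShift g c (Q + s) - oddShift g c (Q - s)) := by
    intro δ y m h1 h2 h3 h4 h5 h6 h7 h8
    have k1 := second_difference_ge hg hc h1 h3 h4 h5 h6 (h7.trans hr)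
    have k2 := oddShift_symm_antitone hg hc (by linarith : 0 ≤ Q) (h3.trans h4) h2
    have k3 := hg.antitone m r (by linarith) h7
    have k4 : 0 ≤ (δ - y) * ((m - (c + Q - y)) * (m + (c + Q - y))) :=
      mul_nonneg (by linarith) (mul_nonneg (by linarith) (by linarith))
    have k5 := mul_le_mul_of_nonneg_left k3 (mul_nonneg hA0.le k4)
    have k6 : 2 * (β * b) * s ^ 2 ≤ (3 / 10 * ((δ - y) * (A * (m ^ 2 - (c + Q - y) ^ 2))))
        * s ^ 2 := by
      have e1 : (3 / 10 * ((δ - y) * (A * (m ^ 2 - (c + Q - y) ^ 2)))) * s ^ 2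
          = 3 / 10 * ((δ - y) * ((m - (c + Q - y)) * (m + (c + Q - y)))) * (A * s ^ 2) := by ring
      rw [e1, hA]
      linarith only [mul_le_mul_of_nonneg_left h8 hβ.le]
    have k7 := le_of_mul_le_mul_right k6 (by positivity)
    have k8 := mul_le_mul_of_nonneg_right k7 hgr.le
    linarith only [k1, k2, k5, k8]
  -- The drift may carry `c + Q` beyond `r`, by at most `β * b`, whereas `decay` is available only
  -- up to `R₁`; therefore `m` is capped at `r`.
  have hm0 : 99 / 100 * b ≤ min r (c + Q) := le_min (by linarith) (by linarith)
  have hm1 : c + Q - β * b ≤ min r (c + Q) := le_min (by linarith) (by linarith)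
  rcases le_or_gt s Q with hsQ' | hsQ'
  · refine gain s (3 / 4 * s) (min r (c + Q)) hsQ' le_rfl (by linarith) (by linarith)
      (by linarith) (min_le_right _ _) (min_le_left _ _) ?_
    have k1 : s / 4 ≤ min r (c + Q) - (c + Q - 3 / 4 * s) := by linarith
    have k2 : 118 / 100 * b ≤ min r (c + Q) + (c + Q - 3 / 4 * s) := by linarith
    have k3 := mul_le_mul k1 k2 (by positivity) (by linarith)
    have k4 := mul_le_mul_of_nonneg_left k3 (by linarith : 0 ≤ s / 4)
    have k5 : 0 ≤ b * s ^ 2 := by positivity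
    rw [show s - 3 / 4 * s = s / 4 by ring]
    linarith only [k4, k5]
  · refine gain Q (1 / 2 * Q) (min r (c + Q)) le_rfl hsQ'.le (by linarith) (by linarith)
      (by linarith) (min_le_right _ _) (min_le_left _ _) ?_
    have k1 : 48 / 100 * Q ≤ min r (c + Q) - (c + Q - 1 / 2 * Q) := by linarith
    have k2 : 14 / 10 * b ≤ min r (c + Q) + (c + Q - 1 / 2 * Q) := by linarith
    have k3 := mul_le_mul k1 k2 (by positivity) (by linarith)
    have k4 := mul_le_mul_of_nonneg_left k3 (by linarith : 0 ≤ Q / 2)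
    have k5 : s ^ 2 ≤ 4 * Q ^ 2 := by nlinarith only [hsQ, hs]
    have k6 := mul_le_mul_of_nonneg_left k5 hb.le
    have k7 : 0 ≤ b * Q ^ 2 := by positivity
    rw [show Q - 1 / 2 * Q = Q / 2 by ring]
    linarith only [k4, k6, k7]

/-- The gain from the noise dominates the drift if the distance is less than half the noise
scale. -/
lemma drift_le_gain_of_lt {α β s b c Q r : ℝ} (hα : 0 < α) (hβ : 0 < β) (hs : 0 < s)
    (hβα : β * (α + 1) ≤ 1 / 9600)
    (hA : A * s ^ 2 = 128 * β) (hb : 0 < b) (hbr : b ≤ r) (hr : r ≤ R₁) (hc : 0 ≤ c)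
    (hrb : r ≤ (4 * α + 1) * b) (hQ0 : 0 ≤ Q) (hQ1 : b ≤ 101 / 100 * Q)
    (hu : c + Q / 2 ≤ r - 48 / 100 * b) (hsQ : Q < s / 2) :
    2 * (β * b * g r)
      ≤ 1 / 10 * (2 * oddShift g c Q - oddShift g c (Q + 2 * s) - oddShift g c (Q - 2 * s)) := by
  have hβ1 : β ≤ 1 / 9600 := by nlinarith only [hβα, mul_pos hβ hα]
  have hR0 : 0 < R₁ := by linarith
  have k1 := second_difference_ge_of_lt hg hc hQ0 hsQ.le
  have hu0 : 0 ≤ c + Q / 2 := by linarith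
  have hgu := hg.pos hu0
  have hgr := hg.pos (hb.le.trans hbr)
  have k2 := hg.antitone (c + Q / 2) r hu0 (by linarith)
  -- `2020/100` is `10 * 2 * 101/100`: the weight `1/10` of the gain, the drift counted twice, and
  -- `b ≤ 101/100 * Q`.
  suffices k3 : 2020 / 100 * β * g (c + Q / 2) ≤ g (c + Q / 2) - g (c + Q + s) by
    have k4 := mul_le_mul_of_nonneg_left k3 hQ0
    have k5 : β * b * g r ≤ β * (101 / 100 * Q) * g (c + Q / 2) := by gcongr
    linarith only [k1, k4, k5]
  -- Below `R₁` the Gaussian factor gives a relative drop of order `A * s ^ 2 = 128 * β`. Beyond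
  -- `R₁` the profile is constant, and the drop comes from `excess` instead.
  rcases le_or_gt (c + Q + s) R₁ with h | h
  · have k4 := hg.decay (c + Q / 2) (c + Q + s) hu0 (by linarith) h
    have hA0 : 0 < A := by
      by_contra hneg
      have := mul_nonpos_of_nonpos_of_nonneg (not_lt.mp hneg) (sq_nonneg s)
      linarith
    have k5 : A * s ^ 2 ≤ A * ((c + Q + s) ^ 2 - (c + Q / 2) ^ 2) := by
      apply mul_le_mul_of_nonneg_left _ hA0.le
      have h1 : 0 ≤ s * (c + Q) := mul_nonneg hs.le (by linarith)
      have h2 : (c + Q / 2) ^ 2 ≤ (c + Q) ^ 2 := by gcongr; linarith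
      linarith only [h1, h2]
    have k6 := Real.add_one_le_exp (A * ((c + Q + s) ^ 2 - (c + Q / 2) ^ 2))
    have hgv := hg.pos (by linarith : 0 ≤ c + Q + s)
    have k7 : g (c + Q + s) * (1 + 128 * β) ≤ g (c + Q / 2) := by
      refine le_trans (mul_le_mul_of_nonneg_left ?_ hgv.le) k4
      linarith
    have k8 : g (c + Q / 2) * (1 + 128 * β) * (1 - 2020 / 100 * β)
        ≥ g (c + Q / 2) := by
      rw [mul_assoc]
      apply le_mul_of_one_le_right hgu.le
      nlinarith only [hβ, hβ1]
    have k9 : g (c + Q + s) * (1 + 128 * β)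
        ≤ g (c + Q / 2) * (1 - 2020 / 100 * β) * (1 + 128 * β) := by linarith only [k7, k8]
    have k10 := le_of_mul_le_mul_right k9 (by linarith)
    linarith only [k10]
  · have k4 := hg.excess (c + Q / 2) hu0 (by linarith) hR0
    have k5 := hg.antitone R₁ (c + Q + s) hR0.le h.le
    suffices k6 : 2020 / 100 * β ≤ (1 - (c + Q / 2) / R₁) / 2 by
      have := mul_le_mul_of_nonneg_right k6 hgu.le
      linarith only [this, k4, k5]
    have k7 : 4040 / 100 * β * R₁ ≤ R₁ - (c + Q / 2) := by
      -- If `R₁` is comparable to `r`, then `β * R₁` is a small multiple of `b`, which the gap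
      -- `48/100 * b` covers; otherwise `c + Q / 2` is at most `R₁ / 2`.
      rcases le_total R₁ (2 * r) with h2 | h2
      · have k9 : β * R₁ ≤ β * (2 * ((4 * α + 1) * b)) :=
          mul_le_mul_of_nonneg_left (by linarith) hβ.le
        have k10 : β * (4 * α + 1) ≤ 4 / 9600 := by linarith only [hβα, hβ, mul_pos hβ hα]
        have k11 := mul_le_mul_of_nonneg_right k10 hb.le
        linarith only [k9, k11, hu, hr, hb]
      · have := mul_le_mul_of_nonneg_right hβ1 hR0.le
        linarith
    have k8 : (c + Q / 2) / R₁ ≤ 1 - 4040 / 100 * β := by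
      rw [div_le_iff₀ hR0]; linarith
    linarith

/-- Contraction of the concave distance in the region where the coalescing coupling is used. The
hypotheses `hE₁` and `hE₂` express the gain from the noise. -/
lemma small_distance_contraction {α η s a b c Q E : ℝ} (hα : 0 < α) (hη : 0 < η)
    (hηα : η * α * (α + 1) ≤ 1 / 9600) (hs : 0 < s) (hA : A * s ^ 2 = 128 * (η * α))
    (hR : η * α * R₁ ≤ s / 2) (ha : 0 ≤ a) (hab : a / 4 < b) (hr : α * a + b ≤ R₁) (hc : 0 ≤ c)
    (hc' : c ≤ α * ((1 - η) * a + η * b)) (hQ : |Q - b| ≤ η * α / 2 * a)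
    (hE₁ : E ≤ oddShift g c Q
      - 3 / 10 * (2 * oddShift g c Q - oddShift g c (Q + s) - oddShift g c (Q - s)))
    (hE₂ : E ≤ oddShift g c Q
      - 1 / 10 * (2 * oddShift g c Q - oddShift g c (Q + 2 * s) - oddShift g c (Q - 2 * s))) :
    (∫ t in (0 : ℝ)..c, g t) + E
      ≤ (∫ t in (0 : ℝ)..(α * a + b), g t) - η * α * b * g (α * a + b) := by
  have hb : 0 < b := by linarith
  have hη0 : 0 < η * α := by positivity
  have hηα1 : η * α ≤ 1 / 9600 := by nlinarith only [hηα, mul_pos hη0 hα]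
  obtain ⟨hQ1, hQ2⟩ := abs_le.mp hQ
  have hηab : η * α / 2 * a ≤ 1 / 4800 * b := by
    have := mul_le_mul_of_nonneg_right hηα1 ha
    linarith
  have hηb := mul_le_mul_of_nonneg_right hηα1 hb.le
  have hηa0 : 0 ≤ η * α * a := by positivity
  have hαa : 0 ≤ α * a := by positivity
  have hαab : α * a ≤ 4 * α * b := by
    have := mul_le_mul_of_nonneg_left hab.le hα.le
    linarith
  have hc'' : c ≤ α * a - η * α * a + η * α * b := by linarith only [hc']
  set r := α * a + b with hrdef
  have hbr : b ≤ r := by linarith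
  have hgr := hg.pos (hb.le.trans hbr)
  have hrhat : c + Q ≤ r + η * α * b := by linarith
  have hbs : η * α * b ≤ s / 2 := by
    have : η * α * b ≤ η * α * R₁ := mul_le_mul_of_nonneg_left (by linarith) hη0.le
    linarith
  -- The drift raises the distance by at most `η * α * b`. As the gain is at least twice that cost,
  -- one unit is left over.
  have hdrift : (∫ t in (0 : ℝ)..c, g t) + oddShift g c Q
      ≤ (∫ t in (0 : ℝ)..r, g t) + η * α * b * g r := by
    rw [oddShift_of_nonneg hg (by linarith : 0 ≤ Q), add_sub_cancel]
    rcases le_total (c + Q) r with h | h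
    · have := hg.integral_mono (by linarith : 0 ≤ c + Q) h
      have : 0 ≤ η * α * b * g r := by positivity
      linarith
    · have h1 := hg.sub_le (hb.le.trans hbr) h
      have h2 : (c + Q - r) * g r ≤ η * α * b * g r :=
        mul_le_mul_of_nonneg_right (by linarith) hgr.le
      linarith
  rcases le_or_gt (s / 2) Q with hsQ | hsQ
  · have := drift_le_gain_of_le hg hη0 hs hA hb hbr hr hc (by linarith) hηb hbs
      hrhat hsQ
    linarith
  · have := drift_le_gain_of_lt hg hα hη0 hs hηα hA hb hbr hr hc (by linarith) (by linarith)
      (by linarith) (by linarith) hsQ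
    linarith

/-- Contraction of the concave distance in the region where the drift alone contracts. -/
lemma drift_contraction {α η a b c Q : ℝ} (hα : 0 < α) (hη : 0 < η)
    (ha : 0 ≤ a) (hab : b ≤ a / 4) (hc : 0 ≤ c) (hQ0 : 0 ≤ Q)
    (hc' : c ≤ α * ((1 - η) * a + η * b)) (hQ : Q ≤ b + η * α / 2 * a) :
    (∫ t in (0 : ℝ)..(c + Q), g t)
      ≤ (∫ t in (0 : ℝ)..(α * a + b), g t) - η * α * a / 4 * g R₁ := by
  -- The contributions are `-η α a` from the contraction of the position, at most `η α a / 4` from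
  -- `b ≤ a / 4`, and at most `η α a / 2` from the gradient.
  have h1 : c + Q ≤ α * a + b - η * α * a / 4 := by nlinarith [mul_pos hη hα]
  have h2 := hg.integral_mono (by linarith : 0 ≤ c + Q) h1
  have h3 : 0 ≤ η * α * a := by positivity
  have h4 := hg.floor_mul_le_sub (u := α * a + b - η * α * a / 4) (v := α * a + b)
    (by linarith) (by linarith)
  linarith

end SmallDistance

/-! ### A coalescing coupling of one-dimensional standard Gaussians -/

/-- The one-dimensional standard Gaussian measure. -/
noncomputable abbrev stdNormal : Measure ℝ := gaussianReal 0 1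

/-- The uniform distribution on `[0, 1]`. -/
noncomputable abbrev uniform : Measure ℝ := volume.restrict (Set.Icc (0 : ℝ) 1)

instance : IsProbabilityMeasure uniform := ⟨by simp⟩

/-- The density of the standard Gaussian. -/
noncomputable abbrev normalPDF (x : ℝ) : ℝ := gaussianPDFReal 0 1 x

lemma normalPDF_neg (x : ℝ) : normalPDF (-x) = normalPDF x := by
  simp [normalPDF, gaussianPDFReal]

lemma normalPDF_add (b x : ℝ) :
    normalPDF (x + b) = normalPDF x * Real.exp (-(b * x) - b ^ 2 / 2) := by
  simp only [normalPDF, gaussianPDFReal, mul_assoc, ← Real.exp_add]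
  congr 3
  simp; ring

lemma normalPDF_nonneg (x : ℝ) : 0 ≤ normalPDF x := gaussianPDFReal_nonneg _ _ _

lemma normalPDF_le (x : ℝ) : normalPDF x ≤ 2 / 5 := by
  have h1 : Real.exp (-(x - 0) ^ 2 / (2 * (1 : NNReal))) ≤ 1 := by
    apply Real.exp_le_one_iff.mpr
    simp only [NNReal.coe_one, mul_one, sub_zero]
    have := sq_nonneg x
    linarith
  have h2 : (√(2 * Real.pi * (1 : NNReal)))⁻¹ ≤ 2 / 5 := by
    rw [inv_le_comm₀ (by positivity) (by norm_num)]
    apply Real.le_sqrt_of_sq_le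
    have := Real.pi_gt_d2
    norm_num; linarith
  calc normalPDF x ≤ 2 / 5 * 1 := mul_le_mul h2 h1 (Real.exp_pos _).le (by norm_num)
    _ = 2 / 5 := mul_one _

lemma lintegral_stdNormal {G : ℝ → ℝ≥0∞} (hG : Measurable G) :
    ∫⁻ x, G x ∂stdNormal = ∫⁻ x, ENNReal.ofReal (normalPDF x) * G x := by
  rw [stdNormal, gaussianReal_of_var_ne_zero _ one_ne_zero,
    lintegral_withDensity_eq_lintegral_mul _ (measurable_gaussianPDF _ _) hG]
  rfl

/-- The acceptance probability of the shift by `b` at the point `x`. -/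
noncomputable def acceptProb (b x : ℝ) : ℝ := min 1 (Real.exp (-(b * x) - b ^ 2 / 2))

lemma acceptProb_nonneg (b x : ℝ) : 0 ≤ acceptProb b x :=
  le_min zero_le_one (Real.exp_pos _).le

lemma acceptProb_le_one (b x : ℝ) : acceptProb b x ≤ 1 := min_le_left _ _

lemma continuous_acceptProb (b : ℝ) : Continuous (acceptProb b) := by
  unfold acceptProb; fun_prop

/-- The accepted mass is the overlap of the density with its translate, the most that any coupling
can move by `b`. -/
lemma normalPDF_mul_acceptProb (b x : ℝ) :
    normalPDF x * acceptProb b x = min (normalPDF x) (normalPDF (x + b)) := by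
  rw [acceptProb, mul_min_of_nonneg _ _ (normalPDF_nonneg x), mul_one, normalPDF_add]

/-- The second component of the coupling: the shift by `b` is accepted if the uniform variable `u`
is small enough, and otherwise `x` is reflected. -/
noncomputable def jump (b x u : ℝ) : ℝ :=
  if u ≤ Real.exp (-(b * x) - b ^ 2 / 2) then x + b else -x

lemma measurable_jump : Measurable fun t : ℝ × ℝ × ℝ => jump t.1 t.2.1 t.2.2 := by
  unfold jump
  refine Measurable.ite (measurableSet_le (by fun_prop) (by fun_prop)) (by fun_prop)
    (by fun_prop)

lemma lintegral_uniform_ite {e : ℝ} (he : 0 < e) (a b : ℝ≥0∞) :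
    ∫⁻ u, (if u ≤ e then a else b) ∂uniform
      = ENNReal.ofReal (min 1 e) * a + ENNReal.ofReal (1 - min 1 e) * b := by
  have h0 : (fun u : ℝ => if u ≤ e then a else b)
      = fun u => (Set.Iic e).indicator (fun _ => a) u + (Set.Ioi e).indicator (fun _ => b) u := by
    funext u
    by_cases h : u ≤ e
    · simp [h]
    · simp [h, not_le.mp h]
  rw [h0, lintegral_add_left (measurable_const.indicator measurableSet_Iic),
    lintegral_indicator measurableSet_Iic, lintegral_indicator measurableSet_Ioi,
    setLIntegral_const, setLIntegral_const, Measure.restrict_apply measurableSet_Iic,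
    Measure.restrict_apply measurableSet_Ioi]
  have h1 : Set.Iic e ∩ Set.Icc (0 : ℝ) 1 = Set.Icc 0 (min 1 e) := by
    ext x; simp; tauto
  have h2 : Set.Ioi e ∩ Set.Icc (0 : ℝ) 1 = Set.Ioc (min 1 e) 1 := by
    ext x
    simp only [Set.mem_inter_iff, Set.mem_Ioi, Set.mem_Icc, Set.mem_Ioc, min_lt_iff]
    constructor
    · rintro ⟨h, -, h'⟩; exact ⟨Or.inr h, h'⟩
    · rintro ⟨h | h, h'⟩
      · exact absurd h (not_lt.mpr h')
      · exact ⟨h, he.le.trans h.le, h'⟩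
  rw [h1, h2, Real.volume_Icc, Real.volume_Ioc, sub_zero, mul_comm a, mul_comm b]

lemma lintegral_jump_uniform (G : ℝ → ℝ≥0∞) (b x : ℝ) :
    ∫⁻ u, G (jump b x u) ∂uniform = ENNReal.ofReal (acceptProb b x) * G (x + b)
      + ENNReal.ofReal (1 - acceptProb b x) * G (-x) := by
  unfold jump acceptProb
  rw [← lintegral_uniform_ite (Real.exp_pos _)]
  congr 1
  funext u
  split_ifs <;> rfl

/-- The coupled variable is again standard Gaussian. -/
lemma lintegral_jump {G : ℝ → ℝ≥0∞} (hG : Measurable G) (b : ℝ) :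
    ∫⁻ x, ∫⁻ u, G (jump b x u) ∂uniform ∂stdNormal = ∫⁻ x, G x ∂stdNormal := by
  have hp := (continuous_acceptProb b).measurable
  have hn : Measurable normalPDF := measurable_gaussianPDFReal 0 1
  simp_rw [lintegral_jump_uniform]
  rw [lintegral_stdNormal (by fun_prop), lintegral_stdNormal hG]
  -- `m y` is the density of the accepted points that land at `y`. The rejected mass, after
  -- reflection, has density `normalPDF y - m y` by the symmetry of the Gaussian, so the two parts
  -- add up to `normalPDF y`.
  set m : ℝ → ℝ := fun x => min (normalPDF x) (normalPDF (x - b)) with hm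
  have hmm : Measurable m := by fun_prop
  have key : ∀ x, ENNReal.ofReal (normalPDF x) * (ENNReal.ofReal (acceptProb b x) * G (x + b)
        + ENNReal.ofReal (1 - acceptProb b x) * G (-x))
      = (fun y => ENNReal.ofReal (m y) * G y) (x + b)
        + (fun y => ENNReal.ofReal (normalPDF y - m y) * G y) (-x) := by
    intro x
    have e1 : m (x + b) = normalPDF x * acceptProb b x := by
      rw [normalPDF_mul_acceptProb, hm]; simp [min_comm]
    have e2 : normalPDF (-x) - m (-x) = normalPDF x * (1 - acceptProb b x) := by
      rw [mul_sub, normalPDF_mul_acceptProb, hm]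
      simp only [mul_one]
      rw [normalPDF_neg, show -x - b = -(x + b) by ring, normalPDF_neg]
    simp only [e1, e2, ENNReal.ofReal_mul (normalPDF_nonneg x)]
    ring
  simp_rw [key]
  rw [lintegral_add_left (by fun_prop), lintegral_add_right_eq_self
      (fun y => ENNReal.ofReal (m y) * G y) b,
    lintegral_neg_eq_self (fun y => ENNReal.ofReal (normalPDF y - m y) * G y),
    ← lintegral_add_left (by fun_prop)]
  congr 1
  funext x
  have h1 : 0 ≤ m x := le_min (normalPDF_nonneg _) (normalPDF_nonneg _)
  have h2 : 0 ≤ normalPDF x - m x := sub_nonneg.mpr (min_le_left _ _)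
  rw [← add_mul, ← ENNReal.ofReal_add h1 h2, add_sub_cancel]

lemma integral_stdNormal (k : ℝ → ℝ) :
    ∫ x, k x ∂stdNormal = ∫ x, normalPDF x * k x := by
  simpa using integral_gaussianReal_eq_integral_smul (μ := 0) (v := 1) (f := k) one_ne_zero

lemma integrable_abs_affine (a b : ℝ) : Integrable (fun x => |a + b * x|) stdNormal := by
  have h : Integrable (fun x : ℝ => x) stdNormal :=
    (memLp_id_gaussianReal (μ := 0) (v := 1) 1).integrable (by simp)
  exact ((integrable_const a).add (h.const_mul b)).abs

/-- The density is at most `2/5` on an interval of length `2 * x₀`. The bound is applied at `x₀ =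
1/2` and `x₀ = 1`. -/
lemma stdNormal_tail {x₀ : ℝ} (hx₀ : 0 ≤ x₀) :
    1 - 4 / 5 * x₀ ≤ stdNormal.real {x | x₀ ≤ |x|} := by
  have h1 : stdNormal.real (Set.Ioo (-x₀) x₀) ≤ 4 / 5 * x₀ := by
    apply ENNReal.toReal_le_of_le_ofReal (by positivity)
    rw [gaussianReal_apply _ one_ne_zero]
    calc ∫⁻ x in Set.Ioo (-x₀) x₀, gaussianPDF 0 1 x
        ≤ ∫⁻ _ in Set.Ioo (-x₀) x₀, ENNReal.ofReal (2 / 5) := by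
          gcongr with x
          exact ENNReal.ofReal_le_ofReal (normalPDF_le x)
      _ = ENNReal.ofReal (4 / 5 * x₀) := by
          rw [setLIntegral_const, Real.volume_Ioo, ← ENNReal.ofReal_mul (by norm_num)]
          congr 1; ring
  have h2 : {x : ℝ | x₀ ≤ |x|} = (Set.Ioo (-x₀) x₀)ᶜ := by
    ext x
    simp only [Set.mem_ofPred_eq, Set.mem_compl_iff, Set.mem_Ioo, ← abs_lt, not_lt]
  rw [h2, probReal_compl_eq_one_sub measurableSet_Ioo]
  linarith

/-! ### The expected distance after a coalescing step -/

section

variable {A R₁ : ℝ} {g : ℝ → ℝ} (hg : IsProfile A R₁ g) {c : ℝ}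
include hg

lemma integrable_oddShift (hc : 0 ≤ c) (a b : ℝ) :
    Integrable (fun x => oddShift g c (a + b * x)) stdNormal := by
  refine (integrable_abs_affine a b).mono'
    ((continuous_oddShift hg).comp (by fun_prop)).aestronglyMeasurable ?_
  exact Filter.Eventually.of_forall fun x => abs_oddShift_le hg hc _

/-- Jensen's inequality for the odd extension, with a quantified gain. -/
lemma integral_oddShift_le (hc : 0 ≤ c) {Q s x₀ : ℝ} (hQ : 0 ≤ Q) (hs : 0 ≤ s) (hx₀ : 0 ≤ x₀) :
    ∫ x, oddShift g c (Q + 2 * s * x) ∂stdNormal ≤ oddShift g c Q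
      - (1 - 4 / 5 * x₀) / 2 * (2 * oddShift g c Q - oddShift g c (Q + 2 * s * x₀)
        - oddShift g c (Q - 2 * s * x₀)) := by
  set D := 2 * oddShift g c Q - oddShift g c (Q + 2 * s * x₀) - oddShift g c (Q - 2 * s * x₀)
    with hD
  have hD0 : 0 ≤ D := by
    have := oddShift_symm_antitone hg hc hQ le_rfl (by positivity : 0 ≤ 2 * s * x₀)
    simp at this
    linarith
  have i1 := integrable_oddShift hg hc Q (2 * s)
  have i2 := integrable_oddShift hg hc Q (-(2 * s))
  -- Averaging over `x` and `-x` turns the integrand into a symmetric sum at step `2 * s * |x|`.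
  -- This sum is at most its value at step zero, and lower by `D` once `|x| ≥ x₀`.
  have hsymm : ∫ x, oddShift g c (Q + 2 * s * x) ∂stdNormal
      = ∫ x, oddShift g c (Q + -(2 * s) * x) ∂stdNormal := by
    have h : Measure.map (fun x => -x) stdNormal = stdNormal := by
      have := gaussianReal_map_neg (μ := 0) (v := 1)
      rwa [neg_zero] at this
    conv_lhs => rw [← h]
    rw [integral_map (φ := fun x => -x) (f := fun x => oddShift g c (Q + 2 * s * x))
      (by fun_prop) ((continuous_oddShift hg).comp (by fun_prop)).aestronglyMeasurable]
    congr 1; funext x; congr 1; ring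
  have hS : MeasurableSet {x : ℝ | x₀ ≤ |x|} :=
    (isClosed_le continuous_const continuous_abs).measurableSet
  have hpt : ∀ x, oddShift g c (Q + 2 * s * x) + oddShift g c (Q + -(2 * s) * x)
      ≤ 2 * oddShift g c Q - ({x : ℝ | x₀ ≤ |x|}).indicator (fun _ => D) x := by
    intro x
    have e : oddShift g c (Q + 2 * s * x) + oddShift g c (Q + -(2 * s) * x)
        = oddShift g c (Q + 2 * s * |x|) + oddShift g c (Q - 2 * s * |x|) := by
      rcases le_total 0 x with h | h
      · rw [abs_of_nonneg h, neg_mul, ← sub_eq_add_neg]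
      · rw [abs_of_nonpos h, add_comm]; congr 2 <;> ring
    rw [e]
    by_cases h : x₀ ≤ |x|
    · have := oddShift_symm_antitone hg hc hQ (by positivity : 0 ≤ 2 * s * x₀)
        (by gcongr : 2 * s * x₀ ≤ 2 * s * |x|)
      rw [Set.indicator_of_mem (by exact h)]
      linarith
    · have := oddShift_symm_antitone hg hc hQ le_rfl (by positivity : 0 ≤ 2 * s * |x|)
      rw [Set.indicator_of_notMem (by exact h)]
      simp at this
      linarith
  have hint := integral_mono (i1.add i2)
    ((integrable_const _).sub ((integrable_const D).indicator hS)) hpt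
  have e1 : ∫ x, ((fun x => oddShift g c (Q + 2 * s * x))
      + fun x => oddShift g c (Q + -(2 * s) * x)) x ∂stdNormal
      = 2 * ∫ x, oddShift g c (Q + 2 * s * x) ∂stdNormal := by
    rw [integral_add' i1 i2, ← hsymm]; ring
  have e2 : ∫ x, (2 * oddShift g c Q - ({x : ℝ | x₀ ≤ |x|}).indicator (fun _ => D) x) ∂stdNormal
      = 2 * oddShift g c Q - stdNormal.real {x | x₀ ≤ |x|} * D := by
    rw [integral_sub (integrable_const _) ((integrable_const D).indicator hS),
      integral_indicator_const _ hS]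
    simp
  have hint' : 2 * ∫ x, oddShift g c (Q + 2 * s * x) ∂stdNormal
      ≤ 2 * oddShift g c Q - stdNormal.real {x | x₀ ≤ |x|} * D := by
    rw [← e1, ← e2]; exact hint
  have := mul_le_mul_of_nonneg_right (stdNormal_tail hx₀) hD0
  linarith

/-- The reflected part of the coupling produces the odd extension. -/
lemma integral_reflect (hc : 0 ≤ c) {s b : ℝ} (hs : 0 < s) (hb : 0 ≤ b) :
    ∫ x, (1 - acceptProb b x) * oddShift g c |s * b + 2 * s * x| ∂stdNormal
      = ∫ x, oddShift g c (s * b + 2 * s * x) ∂stdNormal := by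
  -- Wherever reflection would push the difference past zero, the proposal is accepted with
  -- certainty, so the absolute value can be dropped.
  have hfac : ∀ x, s * b + 2 * s * x ≤ 0 → acceptProb b x = 1 := by
    intro x hx
    have h1 : b + 2 * x ≤ 0 := by
      by_contra h
      have := mul_pos hs (not_le.mp h)
      linarith
    rw [acceptProb, min_eq_left]
    apply Real.one_le_exp
    nlinarith
  have hpt : ∀ x, (1 - acceptProb b x) * oddShift g c |s * b + 2 * s * x|
      = oddShift g c (s * b + 2 * s * x)
        - acceptProb b x * oddShift g c (s * b + 2 * s * x) := by
    intro x
    rcases le_total 0 (s * b + 2 * s * x) with h | h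
    · rw [abs_of_nonneg h]; ring
    · rw [hfac x h]; ring
  have i1 := integrable_oddShift hg hc (s * b) (2 * s)
  have i2 : Integrable (fun x => acceptProb b x * oddShift g c (s * b + 2 * s * x)) stdNormal := by
    refine i1.bdd_mul (c := 1) (continuous_acceptProb b).aestronglyMeasurable ?_
    refine Filter.Eventually.of_forall fun x => ?_
    rw [Real.norm_of_nonneg (acceptProb_nonneg b x)]
    exact acceptProb_le_one b x
  simp_rw [hpt]
  rw [integral_sub i1 i2]
  suffices h : ∫ x, acceptProb b x * oddShift g c (s * b + 2 * s * x) ∂stdNormal = 0 by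
    rw [h, sub_zero]
  rw [integral_stdNormal]
  simp_rw [← mul_assoc, normalPDF_mul_acceptProb]
  set k : ℝ → ℝ := fun x => min (normalPDF x) (normalPDF (x + b))
    * oddShift g c (s * b + 2 * s * x) with hk
  -- The overlap of the densities is symmetric about `-b / 2`, the zero of `s * b + 2 * s * x`, and
  -- `oddShift` is odd there.
  have hodd : ∀ x, k (-b - x) = -k x := by
    intro x
    simp only [hk]
    rw [show s * b + 2 * s * (-b - x) = -(s * b + 2 * s * x) by ring, oddShift_neg,
      show -b - x + b = -x by ring, show -b - x = -(x + b) by ring, normalPDF_neg, normalPDF_neg,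
      min_comm]
    ring
  have h := integral_sub_left_eq_self k volume (-b)
  simp_rw [hodd, integral_neg] at h
  linarith

/-- The expected concave distance after a coalescing step. -/
lemma lintegral_coalesce_le (hc : 0 ≤ c) {s Q : ℝ} (hs : 0 < s) (hQ : 0 ≤ Q) :
    ∫⁻ x, ∫⁻ u, ENNReal.ofReal (∫ t in (0 : ℝ)..(c + |Q + s * (x - jump (Q / s) x u)|), g t)
        ∂uniform ∂stdNormal
      ≤ ENNReal.ofReal ((∫ t in (0 : ℝ)..c, g t)
        + ∫ x, oddShift g c (Q + 2 * s * x) ∂stdNormal) := by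
  set F : ℝ → ℝ := fun r => ∫ t in (0 : ℝ)..r, g t with hF
  have hb : s * (Q / s) = Q := by field_simp
  have hin : ∀ x, ∫⁻ u, ENNReal.ofReal (F (c + |Q + s * (x - jump (Q / s) x u)|)) ∂uniform
      = ENNReal.ofReal (F c + (1 - acceptProb (Q / s) x) * oddShift g c |Q + 2 * s * x|) := by
    intro x
    rw [lintegral_jump_uniform (fun y => ENNReal.ofReal (F (c + |Q + s * (x - y)|)))]
    have e1 : Q + s * (x - (x + Q / s)) = 0 := by linear_combination -hb
    have e2 : Q + s * (x - -x) = Q + 2 * s * x := by ring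
    have hp0 := acceptProb_nonneg (Q / s) x
    have hp1 := sub_nonneg.mpr (acceptProb_le_one (Q / s) x)
    rw [e1, e2, abs_zero, add_zero, ← ENNReal.ofReal_mul hp0, ← ENNReal.ofReal_mul hp1,
      ← ENNReal.ofReal_add (mul_nonneg hp0 (hg.integral_nonneg hc))
        (mul_nonneg hp1 (hg.integral_nonneg (by positivity))),
      oddShift_of_nonneg hg (abs_nonneg _)]
    congr 1; simp only [hF]; ring
  refine (le_of_eq (lintegral_congr hin)).trans ?_
  have i1 : Integrable (fun x => (1 - acceptProb (Q / s) x) * oddShift g c |Q + 2 * s * x|)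
      stdNormal := by
    have i0 : Integrable (fun x => oddShift g c |Q + 2 * s * x|) stdNormal := by
      refine (integrable_abs_affine Q (2 * s)).mono'
        ((continuous_oddShift hg).comp (by fun_prop)).aestronglyMeasurable ?_
      refine Filter.Eventually.of_forall fun x => ?_
      simpa using abs_oddShift_le hg hc |Q + 2 * s * x|
    refine i0.bdd_mul (c := 1)
      (continuous_const.sub (continuous_acceptProb _)).aestronglyMeasurable ?_
    refine Filter.Eventually.of_forall fun x => ?_
    rw [Real.norm_of_nonneg (sub_nonneg.mpr (acceptProb_le_one _ x))]
    linarith [acceptProb_nonneg (Q / s) x]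
  rw [← ofReal_integral_eq_lintegral_ofReal
    (f := fun x => F c + (1 - acceptProb (Q / s) x) * oddShift g c |Q + 2 * s * x|)
    ((integrable_const _).add i1)]
  · apply ENNReal.ofReal_le_ofReal
    have h := integral_reflect hg hc hs (b := Q / s) (by positivity)
    rw [hb] at h
    rw [integral_add (integrable_const _) i1, h]
    simp [hF]
  · refine Filter.Eventually.of_forall fun x => ?_
    have h1 := hg.integral_nonneg hc
    have h2 := hg.integral_mono hc (le_add_of_nonneg_right (abs_nonneg (Q + 2 * s * x)))
    have h3 : 0 ≤ oddShift g c |Q + 2 * s * x| := by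
      rw [oddShift_of_nonneg hg (abs_nonneg _)]; linarith
    exact add_nonneg h1 (mul_nonneg (sub_nonneg.mpr (acceptProb_le_one _ x)) h3)

end

/-! ### The splitting of the potential -/

section Splitting

variable {d : ℕ} {p : Params} {U G : Pos d → ℝ} {K : Pos d →L[ℝ] Pos d}

lemma exists_eigenbasis (hK : IsSplitting p U K G) :
    ∃ (b : OrthonormalBasis (Fin d) ℝ (Pos d)) (lam : Fin d → ℝ),
      (∀ i, K (b i) = lam i • b i) ∧ (∀ i, p.κ ≤ lam i) ∧ (∀ i, lam i ≤ p.LK) := by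
  have hT : (K : Pos d →ₗ[ℝ] Pos d).IsSymmetric := hK.symmetric
  have hn : Module.finrank ℝ (Pos d) = d := by simp
  refine ⟨hT.eigenvectorBasis hn, hT.eigenvalues hn, fun i => hT.apply_eigenvectorBasis hn i,
    fun i => hK.smallest_eigenvalue.2 (hT.hasEigenvalue_eigenvalues hn i), fun i => ?_⟩
  have h := K.le_opNorm (hT.eigenvectorBasis hn i)
  rw [show K (hT.eigenvectorBasis hn i) = _ from hT.apply_eigenvectorBasis hn i, norm_smul] at h
  simp only [OrthonormalBasis.norm_eq_one, mul_one] at h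
  rw [hK.norm_eq] at h
  exact (le_abs_self _).trans h

lemma inner_eigenbasis {b : OrthonormalBasis (Fin d) ℝ (Pos d)} {lam : Fin d → ℝ}
    (hK : IsSplitting p U K G) (hb : ∀ i, K (b i) = lam i • b i) (z : Pos d) (i : Fin d) :
    ⟪b i, K z⟫ = lam i * ⟪b i, z⟫ := by
  rw [← hK.symmetric, hb, real_inner_smul_left]

lemma quadForm_eq_sum {b : OrthonormalBasis (Fin d) ℝ (Pos d)} {lam : Fin d → ℝ}
    (hK : IsSplitting p U K G) (hb : ∀ i, K (b i) = lam i • b i) (z : Pos d) :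
    ⟪z, K z⟫ = ∑ i, lam i * ⟪b i, z⟫ ^ 2 := by
  rw [← b.sum_inner_mul_inner z (K z)]
  refine Finset.sum_congr rfl fun i _ => ?_
  rw [inner_eigenbasis hK hb, real_inner_comm]; ring

lemma norm_sq_eq_sum (b : OrthonormalBasis (Fin d) ℝ (Pos d)) (z : Pos d) :
    ‖z‖ ^ 2 = ∑ i, ⟪b i, z⟫ ^ 2 := by
  rw [← b.sum_sq_norm_inner_right z]
  simp

lemma mul_norm_sq_le_quadForm (hK : IsSplitting p U K G) (z : Pos d) :
    p.κ * ‖z‖ ^ 2 ≤ ⟪z, K z⟫ := by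
  obtain ⟨b, lam, hb, h1, -⟩ := exists_eigenbasis hK
  rw [quadForm_eq_sum hK hb, norm_sq_eq_sum b, Finset.mul_sum]
  exact Finset.sum_le_sum fun i _ => mul_le_mul_of_nonneg_right (h1 i) (sq_nonneg _)

lemma quadForm_le (hK : IsSplitting p U K G) (z : Pos d) :
    ⟪z, K z⟫ ≤ p.LK * ‖z‖ ^ 2 := by
  obtain ⟨b, lam, hb, -, h1⟩ := exists_eigenbasis hK
  rw [quadForm_eq_sum hK hb, norm_sq_eq_sum b, Finset.mul_sum]
  exact Finset.sum_le_sum fun i _ => mul_le_mul_of_nonneg_right (h1 i) (sq_nonneg _)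

/-- On each eigenvector `λ² ≤ LK * λ`. The bound is linear in `LK`, so the step size condition can
absorb the second-order terms of the Euler step into the quadratic form. -/
lemma norm_apply_sq_le (hκ : 0 < p.κ) (hK : IsSplitting p U K G) (z : Pos d) :
    ‖K z‖ ^ 2 ≤ p.LK * ⟪z, K z⟫ := by
  obtain ⟨b, lam, hb, h0, h1⟩ := exists_eigenbasis hK
  rw [quadForm_eq_sum hK hb, norm_sq_eq_sum b, Finset.mul_sum]
  refine Finset.sum_le_sum fun i _ => ?_
  rw [inner_eigenbasis hK hb]
  have h2 : 0 ≤ lam i * ⟪b i, z⟫ ^ 2 := mul_nonneg (hκ.le.trans (h0 i)) (sq_nonneg _)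
  calc (lam i * ⟪b i, z⟫) ^ 2 = lam i * (lam i * ⟪b i, z⟫ ^ 2) := by ring
    _ ≤ p.LK * (lam i * ⟪b i, z⟫ ^ 2) := mul_le_mul_of_nonneg_right (h1 i) h2

lemma exists_min_eigenvector (hK : IsSplitting p U K G) :
    ∃ e : Pos d, ‖e‖ = 1 ∧ K e = p.κ • e := by
  obtain ⟨v, hv⟩ := hK.smallest_eigenvalue.1.exists_hasEigenvector
  have hv0 : ‖v‖ ≠ 0 := norm_ne_zero_iff.mpr hv.2
  refine ⟨‖v‖⁻¹ • v, by rw [norm_smul, norm_inv, norm_norm, inv_mul_cancel₀ hv0], ?_⟩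
  have h : K v = p.κ • v := Module.End.mem_eigenspace_iff.mp hv.1
  rw [map_smul, h, smul_comm]

lemma exists_max_eigenvector (hd : 0 < d) (hκ : 0 < p.κ) (hK : IsSplitting p U K G) :
    ∃ e : Pos d, ‖e‖ = 1 ∧ K e = p.LK • e := by
  obtain ⟨b, lam, hb, h0, h1⟩ := exists_eigenbasis hK
  have : Nonempty (Fin d) := ⟨⟨0, hd⟩⟩
  obtain ⟨j, -, hj⟩ := Finset.exists_max_image Finset.univ lam Finset.univ_nonempty
  have hj0 : 0 ≤ lam j := hκ.le.trans (h0 j)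
  have h2 : ‖K‖ ≤ lam j := by
    refine K.opNorm_le_bound hj0 fun z => ?_
    apply le_of_sq_le_sq _ (by positivity)
    rw [mul_pow, norm_sq_eq_sum b (K z), norm_sq_eq_sum b z, Finset.mul_sum]
    refine Finset.sum_le_sum fun i _ => ?_
    rw [inner_eigenbasis hK hb, mul_pow]
    have := hj i (Finset.mem_univ i)
    have := hκ.le.trans (h0 i)
    gcongr
  refine ⟨b j, b.norm_eq_one j, ?_⟩
  rw [hb, le_antisymm (h1 j) (hK.norm_eq ▸ h2)]

lemma kappa_le_LK (hK : IsSplitting p U K G) : p.κ ≤ p.LK := by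
  obtain ⟨e, he, hKe⟩ := exists_min_eigenvector hK
  have := quadForm_le hK e
  rw [hKe, real_inner_smul_right, real_inner_self_eq_norm_sq, he] at this
  linarith

lemma gradient_eq (hU : PotentialAssumption p U) (hK : IsSplitting p U K G) (x : Pos d) :
    ∇ U x = K x + ∇ G x := by
  have hquad : ∀ x, HasGradientAt (fun x => 1 / 2 * ⟪x, K x⟫) (K x) x := by
    intro x
    rw [hasGradientAt_iff_hasFDerivAt]
    have h := ((hasFDerivAt_id x).inner ℝ (K.hasFDerivAt (x := x))).const_mul (1 / 2)
    refine h.congr_fderiv ?_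
    ext y
    simp
    rw [← hK.symmetric, real_inner_comm y (K x)]
    ring
  -- Differentiability of `G` is not part of `IsSplitting`; it is inherited from `U` and the
  -- quadratic part.
  have hG : G = fun x => U x - 1 / 2 * ⟪x, K x⟫ := by
    funext x; rw [hK.split x]; ring
  have h1 := (hU.differentiable x).hasGradientAt
  have h2 : HasGradientAt G (∇ U x - K x) x := by
    rw [hG, hasGradientAt_iff_hasFDerivAt, map_sub]
    exact (hasGradientAt_iff_hasFDerivAt.mp h1).sub (hasGradientAt_iff_hasFDerivAt.mp (hquad x))
  rw [h2.gradient]; abel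

lemma exists_norm_eq (hd : 0 < d) {r : ℝ} (hr : 0 ≤ r) : ∃ x : Pos d, ‖x‖ = r := by
  refine ⟨EuclideanSpace.single ⟨0, hd⟩ r, ?_⟩
  simp [abs_of_nonneg hr]

/-- Testing convexity on a vector of length `R + 1`, which exists as `d` is positive, bounds `κ` by
`L`. -/
lemma L_pos (hd : 0 < d) (hκ : 0 < p.κ) (hR : 0 ≤ p.R) (hU : PotentialAssumption p U) :
    0 < p.L := by
  obtain ⟨x, hx⟩ := exists_norm_eq hd (by linarith : 0 ≤ p.R + 1)
  have h1 := hU.strongly_convex x 0 (by rw [sub_zero, hx]; linarith)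
  have h2 := hU.lipschitz x 0
  have h3 := real_inner_le_norm (∇ U x - ∇ U 0) (x - 0)
  rw [sub_zero, hx] at h1 h2 h3
  have h4 : 0 < p.R + 1 := by linarith
  have h5 : 0 < p.κ * (p.R + 1) ^ 2 := by positivity
  have h6 := mul_le_mul_of_nonneg_right h2 h4.le
  by_contra hneg
  have h7 := mul_nonneg (mul_nonneg (neg_nonneg.mpr (not_lt.mp hneg)) h4.le) h4.le
  linarith

lemma LG_nonneg (hd : 0 < d) (hK : IsSplitting p U K G) : 0 ≤ p.LG := by
  obtain ⟨x, hx⟩ := exists_norm_eq hd zero_le_one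
  have h := hK.lipschitz x 0
  rw [sub_zero, hx, mul_one] at h
  exact (norm_nonneg _).trans h

end Splitting

/-! ### The metrics `r_l` and `r_s` -/

/-- The standing assumptions on the parameters, the potential and its splitting. -/
structure Admissible {d : ℕ} (p : Params) (U G : Pos d → ℝ) (K : Pos d →L[ℝ] Pos d) : Prop where
  dim_pos : 0 < d
  κ_pos : 0 < p.κ
  R_nonneg : 0 ≤ p.R
  γ_pos : 0 < p.γ
  γ_large : 4 * p.LG / √p.κ ≤ p.γ
  potential : PotentialAssumption p U
  splitting : IsSplitting p U K G

/-- The difference of positions. -/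
def posDiff {d : ℕ} (a b : Phase d) : Pos d := a.1 - b.1

/-- The difference of the sheared coordinates `x + γ⁻¹ v`. -/
noncomputable def shearDiff {d : ℕ} (p : Params) (a b : Phase d) : Pos d :=
  (a.1 - b.1) + p.γ⁻¹ • (a.2 - b.2)

section Constants

variable {d : ℕ} {p : Params} {U G : Pos d → ℝ} {K : Pos d →L[ℝ] Pos d}

namespace Admissible

variable (S : Admissible p U G K)
include S

lemma L_pos : 0 < p.L := KineticLangevin.L_pos S.dim_pos S.κ_pos S.R_nonneg S.potential

lemma LG_nonneg : 0 ≤ p.LG := KineticLangevin.LG_nonneg S.dim_pos S.splitting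

lemma LK_pos : 0 < p.LK := S.κ_pos.trans_le (kappa_le_LK S.splitting)

lemma alpha_pos : 0 < alpha p := by
  have := S.L_pos
  have := S.γ_pos
  unfold alpha; positivity

lemma eps_pos : 0 < eps p := by
  have h1 := S.alpha_pos
  have h2 := S.γ_pos
  have h3 := S.LK_pos
  unfold eps
  have : 0 < min (min 1 (2 * alpha p / (3 * √p.LK * p.γ⁻¹))) (alpha p) :=
    lt_min (lt_min one_pos (by positivity)) h1
  positivity

lemma tau_pos : 0 < tau p := by
  have h1 := S.κ_pos
  have h2 := S.γ_pos
  unfold tau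
  exact lt_min (by norm_num) (by positivity)

omit S in
lemma _root_.KineticLangevin.tau_le : tau p ≤ 1 / 8 := min_le_left _ _

omit S in
lemma _root_.KineticLangevin.tau_le' : tau p ≤ p.γ⁻¹ ^ 2 * p.κ / 4 := min_le_right _ _

lemma calE_pos : 0 < calE p := by
  have h1 := S.alpha_pos
  have h2 := S.γ_pos
  have h3 := S.κ_pos
  unfold calE
  exact lt_min (by positivity) (by norm_num)

lemma calR_nonneg : 0 ≤ calR p := by
  have h1 := S.tau_pos
  have h2 := S.LG_nonneg
  unfold calR; positivity

end Admissible

lemma rs_eq (a b : Phase d) : rs p a b = alpha p * ‖posDiff a b‖ + ‖shearDiff p a b‖ := rfl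

lemma rl_sq (S : Admissible p U G K) (a b : Phase d) :
    rl p K a b ^ 2 = p.γ⁻¹ ^ 2 * ⟪posDiff a b, K (posDiff a b)⟫
      + 1 / 2 * ‖shearDiff p a b - (2 * tau p) • posDiff a b‖ ^ 2
      + 1 / 2 * ‖shearDiff p a b - posDiff a b‖ ^ 2 := by
  have h0 : 0 ≤ ⟪posDiff a b, K (posDiff a b)⟫ :=
    (mul_nonneg S.κ_pos.le (sq_nonneg _)).trans (mul_norm_sq_le_quadForm S.splitting _)
  have e1 : shearDiff p a b - (2 * tau p) • posDiff a b
      = (1 - 2 * tau p) • (a.1 - b.1) + p.γ⁻¹ • (a.2 - b.2) := by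
    rw [shearDiff, posDiff, sub_smul, one_smul]; abel
  have e2 : shearDiff p a b - posDiff a b = p.γ⁻¹ • (a.2 - b.2) := by
    rw [shearDiff, posDiff, add_sub_cancel_left]
  have e3 : 1 / 2 * ‖p.γ⁻¹ • (a.2 - b.2)‖ ^ 2 = 1 / 2 * p.γ⁻¹ ^ 2 * ‖a.2 - b.2‖ ^ 2 := by
    rw [norm_smul, Real.norm_of_nonneg (inv_nonneg.mpr S.γ_pos.le)]; ring
  rw [e1, e2, e3, rl, Real.sq_sqrt]
  · rfl
  · have : 0 ≤ ⟪a.1 - b.1, K (a.1 - b.1)⟫ := h0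
    positivity

lemma rl_nonneg (a b : Phase d) : 0 ≤ rl p K a b := Real.sqrt_nonneg _

/-- Equality holds for antiparallel differences along a top eigenvector of `K`; `R1_le` relies on
this sharpness. Likewise `le_rl_sq` is sharp for parallel differences along a lowest eigenvector,
which `DK_le` uses. -/
lemma rl_sq_le (S : Admissible p U G K) (a b : Phase d) :
    rl p K a b ^ 2 ≤ p.γ⁻¹ ^ 2 * p.LK * ‖posDiff a b‖ ^ 2
      + 1 / 2 * (‖shearDiff p a b‖ + 2 * tau p * ‖posDiff a b‖) ^ 2
      + 1 / 2 * (‖shearDiff p a b‖ + ‖posDiff a b‖) ^ 2 := by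
  rw [rl_sq S]
  have h1 := quadForm_le S.splitting (posDiff a b)
  have h2 : ‖shearDiff p a b - (2 * tau p) • posDiff a b‖
      ≤ ‖shearDiff p a b‖ + 2 * tau p * ‖posDiff a b‖ := by
    refine (norm_sub_le _ _).trans_eq ?_
    rw [norm_smul, Real.norm_of_nonneg (by linarith [S.tau_pos])]
  have h3 := norm_sub_le (shearDiff p a b) (posDiff a b)
  rw [mul_assoc]
  gcongr

lemma le_rl_sq (S : Admissible p U G K) (a b : Phase d) :
    p.γ⁻¹ ^ 2 * p.κ * ‖posDiff a b‖ ^ 2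
      + 1 / 2 * (‖shearDiff p a b‖ - 2 * tau p * ‖posDiff a b‖) ^ 2
      + 1 / 2 * (‖shearDiff p a b‖ - ‖posDiff a b‖) ^ 2 ≤ rl p K a b ^ 2 := by
  rw [rl_sq S]
  have h1 := mul_norm_sq_le_quadForm S.splitting (posDiff a b)
  have h2 : (‖shearDiff p a b‖ - 2 * tau p * ‖posDiff a b‖) ^ 2
      ≤ ‖shearDiff p a b - (2 * tau p) • posDiff a b‖ ^ 2 := by
    have h := abs_norm_sub_norm_le (shearDiff p a b) ((2 * tau p) • posDiff a b)
    rw [norm_smul, Real.norm_of_nonneg (by linarith [S.tau_pos] : 0 ≤ 2 * tau p)] at h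
    rw [← sq_abs]
    gcongr
  have h3 : (‖shearDiff p a b‖ - ‖posDiff a b‖) ^ 2 ≤ ‖shearDiff p a b - posDiff a b‖ ^ 2 := by
    have h := abs_norm_sub_norm_le (shearDiff p a b) (posDiff a b)
    rw [← sq_abs]
    gcongr
  rw [mul_assoc]
  gcongr

lemma rs_nonneg (S : Admissible p U G K) (a b : Phase d) : 0 ≤ rs p a b := by
  have := S.alpha_pos
  rw [rs_eq]; positivity

/-- Each entry of the minimum in `eps` has its task: `1` bounds the sheared part, the entry with
`√LK` bounds the quadratic form of `K`, and `α` bounds the position in the other two squares. The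
coefficients of `(α |z|)²` sum to `4/9 + 1/32 + 1/2 < 1`. -/
lemma two_eps_rl_le_rs (S : Admissible p U G K) (a b : Phase d) :
    2 * eps p * rl p K a b ≤ rs p a b := by
  have hα := S.alpha_pos
  have hγ := S.γ_pos
  have hLK := S.LK_pos
  have hε := S.eps_pos
  set m := 2 * eps p with hm
  have hm' : m = min (min 1 (2 * alpha p / (3 * √p.LK * p.γ⁻¹))) (alpha p) := by
    rw [hm, eps]; ring
  have m1 : m ≤ 1 := hm'.trans_le ((min_le_left _ _).trans (min_le_left _ _))
  have m2 : m * (√p.LK * p.γ⁻¹) ≤ 2 * alpha p / 3 := by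
    have h := hm'.trans_le ((min_le_left _ _).trans (min_le_right _ _))
    rw [le_div_iff₀ (by positivity)] at h
    linarith
  have m3 : m ≤ alpha p := hm'.trans_le (min_le_right _ _)
  have m0 : 0 < m := by positivity
  clear_value m
  apply le_of_sq_le_sq _ (rs_nonneg S a b)
  have h := rl_sq_le S a b
  rw [rs_eq]
  set A := ‖posDiff a b‖
  set C := ‖shearDiff p a b‖
  have hA : 0 ≤ A := norm_nonneg _
  have hC : 0 ≤ C := norm_nonneg _
  have k1 : m ^ 2 * (p.γ⁻¹ ^ 2 * p.LK * A ^ 2) ≤ (2 * alpha p / 3 * A) ^ 2 := by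
    calc m ^ 2 * (p.γ⁻¹ ^ 2 * p.LK * A ^ 2)
        = (m * (√p.LK * p.γ⁻¹) * A) ^ 2 := by
          rw [mul_pow, mul_pow, mul_pow, Real.sq_sqrt hLK.le]; ring
      _ ≤ _ := by gcongr
  have k2 : m ^ 2 * (C + 2 * tau p * A) ^ 2 ≤ (C + alpha p * A / 4) ^ 2 := by
    rw [← mul_pow]
    have hτ := S.tau_pos
    have hτ' := tau_le (p := p)
    have : m * (C + 2 * tau p * A) ≤ C + alpha p * A / 4 := by
      have e1 : m * C ≤ 1 * C := by gcongr
      have e2 : m * A ≤ alpha p * A := by gcongr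
      have e3 : m * A * (2 * tau p) ≤ m * A * (1 / 4) := by gcongr; linarith
      linarith
    gcongr
  have k3 : m ^ 2 * (C + A) ^ 2 ≤ (C + alpha p * A) ^ 2 := by
    rw [← mul_pow]
    have : m * (C + A) ≤ C + alpha p * A := by
      have e1 : m * C ≤ 1 * C := by gcongr
      have e2 : m * A ≤ alpha p * A := by gcongr
      linarith
    gcongr
  have k4 := mul_le_mul_of_nonneg_left h (sq_nonneg m)
  have k5 : 0 ≤ alpha p * A * C := by positivity
  rw [mul_pow]
  have k6 : 0 ≤ (alpha p * A) ^ 2 := sq_nonneg _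
  linarith

/-- The first entry of `calE` weighs the position against `κ`, the second weighs the sheared part.
After completing a square, the remainder is absorbed by `τ ≤ γ⁻² κ / 4`. -/
lemma calE_mul_rs_le_rl (S : Admissible p U G K) (a b : Phase d) :
    calE p * rs p a b ≤ rl p K a b := by
  have hα := S.alpha_pos
  have hγ := S.γ_pos
  have hκ := S.κ_pos
  have hE := S.calE_pos
  have hτ := S.tau_pos
  have hτ' := tau_le' (p := p)
  apply le_of_sq_le_sq _ (rl_nonneg a b)
  have h := le_rl_sq S a b
  rw [rs_eq]
  set A := ‖posDiff a b‖
  set C := ‖shearDiff p a b‖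
  have e1 : (calE p * alpha p) ^ 2 ≤ p.γ⁻¹ ^ 2 * p.κ / 8 := by
    have h1 : calE p ≤ √p.κ * p.γ⁻¹ / (√8 * alpha p) := min_le_left _ _
    rw [le_div_iff₀ (by positivity)] at h1
    have h2 : (calE p * (√8 * alpha p)) ^ 2 ≤ (√p.κ * p.γ⁻¹) ^ 2 := by gcongr
    rw [mul_pow, mul_pow, mul_pow, Real.sq_sqrt hκ.le, Real.sq_sqrt (by norm_num)] at h2
    linarith
  have e2 : calE p ^ 2 ≤ 1 / 4 := by
    have h1 : calE p ≤ 1 / 2 := min_le_right _ _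
    nlinarith
  set k := p.γ⁻¹ ^ 2 * p.κ
  have h1 : (calE p * (alpha p * A + C)) ^ 2
      ≤ 2 * (calE p * alpha p) ^ 2 * A ^ 2 + 2 * calE p ^ 2 * C ^ 2 := by
    nlinarith [sq_nonneg (calE p * (alpha p * A - C))]
  have h2 : (calE p * alpha p) ^ 2 * A ^ 2 ≤ k / 8 * A ^ 2 := by gcongr
  have h3 : calE p ^ 2 * C ^ 2 ≤ 1 / 4 * C ^ 2 := by gcongr
  have h4 : 4 * tau p * A ^ 2 ≤ k * A ^ 2 := by
    apply mul_le_mul_of_nonneg_right _ (sq_nonneg _); linarith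
  have h5 : 0 ≤ k * A ^ 2 := by positivity
  nlinarith [sq_nonneg (C - (1 + 2 * tau p) * A)]

lemma rs_le_two_mul_Delta (S : Admissible p U G K) (a b : Phase d) :
    rs p a b ≤ 2 * Delta p K a b := by
  have := two_eps_rl_le_rs S a b
  unfold Delta; linarith

lemma Delta_le_rs (S : Admissible p U G K) (a b : Phase d) : Delta p K a b ≤ rs p a b := by
  have := mul_nonneg S.eps_pos.le (rl_nonneg (p := p) (K := K) a b)
  unfold Delta; linarith

lemma Delta_nonneg (S : Admissible p U G K) (a b : Phase d) : 0 ≤ Delta p K a b := by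
  linarith [rs_le_two_mul_Delta S a b, rs_nonneg S a b]

/-! ### The constants `D_𝒦` and `R₁` -/

lemma mem_compactSet (a b : Phase d) : a - b ∈ compactSet d p ↔
    p.κ * p.γ⁻¹ ^ 2 * ‖posDiff a b‖ ^ 2 + 1 / 2 * ‖shearDiff p a b‖ ^ 2
      + 1 / 2 * ‖shearDiff p a b - posDiff a b‖ ^ 2 ≤ calR p := by
  have e2 : shearDiff p a b - posDiff a b = p.γ⁻¹ • (a.2 - b.2) := by
    rw [shearDiff, posDiff, add_sub_cancel_left]
  rw [e2]; rfl

lemma bddAbove_Delta (S : Admissible p U G K) :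
    BddAbove {t | ∃ a b : Phase d, a - b ∈ compactSet d p ∧ t = Delta p K a b} := by
  have hα := S.alpha_pos
  have hγ := S.γ_pos
  have hκ := S.κ_pos
  refine ⟨alpha p * √(calR p / (p.κ * p.γ⁻¹ ^ 2)) + √(2 * calR p), ?_⟩
  rintro t ⟨a, b, hab, rfl⟩
  refine (Delta_le_rs S a b).trans ?_
  rw [mem_compactSet] at hab
  rw [rs_eq]
  have h1 : 0 ≤ p.κ * p.γ⁻¹ ^ 2 * ‖posDiff a b‖ ^ 2 := by positivity
  gcongr
  · apply Real.le_sqrt_of_sq_le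
    rw [le_div_iff₀ (by positivity)]
    nlinarith [sq_nonneg ‖shearDiff p a b‖, sq_nonneg ‖shearDiff p a b - posDiff a b‖]
  · apply Real.le_sqrt_of_sq_le
    nlinarith [sq_nonneg ‖shearDiff p a b - posDiff a b‖]

lemma Delta_le_DK (S : Admissible p U G K) {a b : Phase d} (h : a - b ∈ compactSet d p) :
    Delta p K a b ≤ DK p K := le_csSup (bddAbove_Delta S) ⟨a, b, h, rfl⟩

lemma zero_mem_compactSet (S : Admissible p U G K) : (0 : Phase d) - 0 ∈ compactSet d p := by
  rw [mem_compactSet]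
  simpa [posDiff, shearDiff] using S.calR_nonneg

lemma DK_nonneg (S : Admissible p U G K) : 0 ≤ DK p K :=
  (Delta_nonneg S 0 0).trans (Delta_le_DK S (zero_mem_compactSet S))

lemma bddAbove_rs (S : Admissible p U G K) :
    BddAbove {t | ∃ a b : Phase d, Delta p K a b ≤ DK p K ∧ t = rs p a b} := by
  refine ⟨2 * DK p K, ?_⟩
  rintro t ⟨a, b, hab, rfl⟩
  linarith [rs_le_two_mul_Delta S a b]

lemma rs_le_R1 (S : Admissible p U G K) {a b : Phase d} (h : Delta p K a b ≤ DK p K) :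
    rs p a b ≤ R1 p K := le_csSup (bddAbove_rs S) ⟨a, b, h, rfl⟩

lemma R1_nonneg (S : Admissible p U G K) : 0 ≤ R1 p K :=
  (rs_nonneg S 0 0).trans (rs_le_R1 S (Delta_le_DK S (zero_mem_compactSet S)))

/-- The phase point with prescribed position and sheared coordinate. -/
noncomputable def ofShear (p : Params) (z q : Pos d) : Phase d := (z, p.γ • (q - z))

lemma posDiff_ofShear (z q : Pos d) : posDiff (ofShear p z q) 0 = z := by
  simp [posDiff, ofShear]

lemma shearDiff_ofShear (S : Admissible p U G K) (z q : Pos d) :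
    shearDiff p (ofShear p z q) 0 = q := by
  simp [shearDiff, ofShear, smul_smul, inv_mul_cancel₀ S.γ_pos.ne']

end Constants

/-! ### Independence of the constants from the dimension and the splitting -/

section Independence

variable {d d' : ℕ} {p : Params} {U G : Pos d → ℝ} {K : Pos d →L[ℝ] Pos d}
  {U' G' : Pos d' → ℝ} {K' : Pos d' →L[ℝ] Pos d'}

/-- The supremum `D_𝒦` is attained at collinear differences in the lowest eigenspace of `K`. -/
lemma DK_le (S : Admissible p U G K) (S' : Admissible p U' G' K') : DK p K ≤ DK p K' := by
  refine csSup_le ⟨_, 0, 0, zero_mem_compactSet S, rfl⟩ ?_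
  rintro t ⟨a, b, hab, rfl⟩
  obtain ⟨e, he, hKe⟩ := exists_min_eigenvector S'.splitting
  set A := ‖posDiff a b‖ with hA
  set C := ‖shearDiff p a b‖ with hC
  set a' := ofShear p (A • e) (C • e) with ha'
  have hz : posDiff a' 0 = A • e := posDiff_ofShear _ _
  have hq : shearDiff p a' 0 = C • e := shearDiff_ofShear S' _ _
  have nz : ‖A • e‖ = A := by rw [norm_smul, he, mul_one, Real.norm_of_nonneg (norm_nonneg _)]
  have nq : ‖C • e‖ = C := by rw [norm_smul, he, mul_one, Real.norm_of_nonneg (norm_nonneg _)]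
  have n1 : ‖C • e - (2 * tau p) • A • e‖ ^ 2 = (C - 2 * tau p * A) ^ 2 := by
    rw [smul_smul, ← sub_smul, norm_smul, he, mul_one, Real.norm_eq_abs, sq_abs]
  have n2 : ‖C • e - A • e‖ ^ 2 = (C - A) ^ 2 := by
    rw [← sub_smul, norm_smul, he, mul_one, Real.norm_eq_abs, sq_abs]
  have n3 : ⟪A • e, K' (A • e)⟫ = p.κ * A ^ 2 := by
    rw [map_smul, hKe, real_inner_smul_left, real_inner_smul_right, real_inner_smul_right,
      real_inner_self_eq_norm_sq, he]; ring
  have hmem : a' - 0 ∈ compactSet d' p := by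
    rw [mem_compactSet] at hab ⊢
    rw [hz, hq, nz, nq, n2]
    have h3 : (C - A) ^ 2 ≤ ‖shearDiff p a b - posDiff a b‖ ^ 2 := by
      have h := abs_norm_sub_norm_le (shearDiff p a b) (posDiff a b)
      rw [← sq_abs]
      gcongr
    linarith
  refine le_trans ?_ (Delta_le_DK S' hmem)
  have hrl : rl p K' a' 0 ≤ rl p K a b := by
    apply le_of_sq_le_sq _ (rl_nonneg a b)
    refine le_trans (le_of_eq ?_) (le_rl_sq S a b)
    rw [rl_sq S', hz, hq, n1, n2, n3]; ring
  have hrs : rs p a' 0 = rs p a b := by rw [rs_eq, rs_eq, hz, hq, nz, nq]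
  unfold Delta
  rw [hrs]
  have := mul_le_mul_of_nonneg_left hrl S.eps_pos.le
  linarith

lemma DK_congr (S : Admissible p U G K) (S' : Admissible p U' G' K') : DK p K = DK p K' :=
  le_antisymm (DK_le S S') (DK_le S' S)

/-- The supremum `R₁` is attained at antiparallel differences in the top eigenspace of `K`. -/
lemma R1_le (S : Admissible p U G K) (S' : Admissible p U' G' K') : R1 p K ≤ R1 p K' := by
  refine csSup_le ⟨_, 0, 0, Delta_le_DK S (zero_mem_compactSet S), rfl⟩ ?_
  rintro t ⟨a, b, hab, rfl⟩
  obtain ⟨e, he, hKe⟩ := exists_max_eigenvector S'.dim_pos S'.κ_pos S'.splitting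
  set A := ‖posDiff a b‖ with hA
  set C := ‖shearDiff p a b‖ with hC
  set a' := ofShear p (A • e) (-C • e) with ha'
  have hz : posDiff a' 0 = A • e := posDiff_ofShear _ _
  have hq : shearDiff p a' 0 = -C • e := shearDiff_ofShear S' _ _
  have nz : ‖A • e‖ = A := by rw [norm_smul, he, mul_one, Real.norm_of_nonneg (norm_nonneg _)]
  have nq : ‖-C • e‖ = C := by
    rw [norm_smul, he, mul_one, norm_neg, Real.norm_of_nonneg (norm_nonneg _)]
  have n1 : ‖-C • e - (2 * tau p) • A • e‖ ^ 2 = (C + 2 * tau p * A) ^ 2 := by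
    rw [smul_smul, ← sub_smul, norm_smul, he, mul_one, Real.norm_eq_abs, sq_abs]; ring
  have n2 : ‖-C • e - A • e‖ ^ 2 = (C + A) ^ 2 := by
    rw [← sub_smul, norm_smul, he, mul_one, Real.norm_eq_abs, sq_abs]; ring
  have n3 : ⟪A • e, K' (A • e)⟫ = p.LK * A ^ 2 := by
    rw [map_smul, hKe, real_inner_smul_left, real_inner_smul_right, real_inner_smul_right,
      real_inner_self_eq_norm_sq, he]; ring
  have hrl : rl p K a b ≤ rl p K' a' 0 := by
    apply le_of_sq_le_sq _ (rl_nonneg a' 0)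
    refine (rl_sq_le S a b).trans (le_of_eq ?_)
    rw [rl_sq S', hz, hq, n1, n2, n3]; ring
  have hrs : rs p a' 0 = rs p a b := by rw [rs_eq, rs_eq, hz, hq, nz, nq]
  rw [← hrs]
  apply rs_le_R1 S'
  -- The constraint in `R1` contains `DK`, so the comparison works only once both problems are known
  -- to have the same level.
  rw [← DK_congr S S']
  refine le_trans ?_ hab
  unfold Delta
  rw [hrs]
  have := mul_le_mul_of_nonneg_left hrl S.eps_pos.le
  linarith

lemma R1_congr (S : Admissible p U G K) (S' : Admissible p U' G' K') : R1 p K = R1 p K' :=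
  le_antisymm (R1_le S S') (R1_le S' S)

/-- Beyond the scalar parameters, all remaining constants see `K` and the dimension only through
`R1`. -/
lemma phi_congr (h : R1 p K = R1 p K') : phi p K = phi p K' := by
  funext s; simp only [phi, h]

lemma psi_congr (h : R1 p K = R1 p K') : psi p K = psi p K' := by
  funext s; simp only [psi, cHat, capPhi, phi_congr h, h]

lemma f_congr (h : R1 p K = R1 p K') : f p K = f p K' := by
  funext r; simp only [f, phi_congr h, psi_congr h]

lemma rate_congr (h : R1 p K = R1 p K') : rate p K = rate p K' := by
  simp only [rate, cHat, capPhi, f_congr h, phi_congr h, h]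

lemma constM_congr (h : R1 p K = R1 p K') : constM p K = constM p K' := by
  simp only [constM, f_congr h, h]

end Independence

/-! ### Positivity and upper bounds of the rate -/

section Rate

variable {d : ℕ} {p : Params} {U G : Pos d → ℝ} {K : Pos d →L[ℝ] Pos d}

/-- The derivative `f' = φ ψ`. -/
noncomputable def slope (p : Params) (K : Pos d →L[ℝ] Pos d) (s : ℝ) : ℝ := phi p K s * psi p K s

lemma f_eq (r : ℝ) : f p K r = ∫ s in (0 : ℝ)..r, slope p K s := rfl

lemma isProfile_slope (S : Admissible p U G K) :
    IsProfile (64 * alpha p * p.γ ^ 2) (R1 p K) (slope p K) :=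
  isProfile_phi_mul_psi p K S.γ_pos S.alpha_pos.le (R1_nonneg S)

lemma slope_R1_pos (S : Admissible p U G K) : 0 < slope p K (R1 p K) :=
  (isProfile_slope S).floor_pos

lemma rate_pos (S : Admissible p U G K) : 0 < rate p K := by
  have h1 := S.alpha_pos
  have h2 := S.γ_pos
  have h3 := S.κ_pos
  have h4 := S.eps_pos
  have h5 := S.calE_pos
  have h6 := slope_R1_pos S
  have hm : 0 < min (min (slope p K (R1 p K) * (eps p * p.κ * p.γ⁻¹ / 8) * calE p)
        (slope p K (R1 p K) * (eps p * p.γ / 16) * calE p))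
      (min (slope p K (R1 p K) * (p.γ / 8)) (slope p K (R1 p K) * (p.γ * alpha p / 2))) :=
    lt_min (lt_min (by positivity) (by positivity)) (lt_min (by positivity) (by positivity))
  simp only [rate, deriv_f]
  split_ifs with h
  · exact hm
  · have hR : 0 < R1 p K := lt_of_le_of_ne (R1_nonneg S) (Ne.symm h)
    have := cHat_pos p K h2 hR
    exact lt_min hm (lt_min (by positivity) (by positivity))

/-- The contraction estimates compare the rate with these four entries only; the entries with `cHat`
can only lower it. -/
lemma rate_le_min : rate p K
    ≤ min (min (slope p K (R1 p K) * (eps p * p.κ * p.γ⁻¹ / 8) * calE p)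
        (slope p K (R1 p K) * (eps p * p.γ / 16) * calE p))
      (min (slope p K (R1 p K) * (p.γ / 8)) (slope p K (R1 p K) * (p.γ * alpha p / 2))) := by
  simp only [rate, deriv_f]
  split_ifs with h
  · exact le_rfl
  · exact min_le_left _ _

/-- The first two entries of the rate correspond to the two possible values of the minimum `tau`. -/
lemma rate_le_large (S : Admissible p U G K) :
    rate p K ≤ slope p K (R1 p K) * (eps p * (tau p * p.γ / 2)) * calE p := by
  have h := (rate_le_min (p := p) (K := K)).trans (min_le_left _ _)
  have h2 := S.γ_pos
  have hs := mul_pos (slope_R1_pos S) (mul_pos S.eps_pos S.calE_pos)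
  have hτ : tau p * p.γ / 2 = min (p.γ / 16) (p.κ * p.γ⁻¹ / 8) := by
    rw [tau, min_mul_of_nonneg _ _ h2.le, ← min_div_div_right (by norm_num)]
    congr 1
    · ring
    · field_simp; ring
  rw [hτ]
  rcases min_choice (p.γ / 16) (p.κ * p.γ⁻¹ / 8) with h' | h' <;> rw [h']
  · refine (h.trans (min_le_right _ _)).trans_eq ?_; ring
  · refine (h.trans (min_le_left _ _)).trans_eq ?_; ring

/-- In the small distance region the rate times `4 α + 1` is at most `f'(R₁) γ α`. -/
lemma rate_le_small (S : Admissible p U G K) :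
    rate p K * (4 * alpha p + 1) ≤ slope p K (R1 p K) * (p.γ * alpha p) := by
  have h := (rate_le_min (p := p) (K := K)).trans (min_le_right _ _)
  have h1 := h.trans (min_le_left _ _)
  have h2 := h.trans (min_le_right _ _)
  nlinarith [mul_le_mul_of_nonneg_right h1 S.alpha_pos.le]

lemma constM_pos (S : Admissible p U G K) : 0 < constM p K := by
  have h1 := S.alpha_pos
  have h2 := S.γ_pos
  have h3 := S.κ_pos
  have h4 := S.eps_pos
  have h6 := slope_R1_pos S
  have : 0 < min √(2 * p.κ) 1 := lt_min (by positivity) one_pos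
  have : 0 < max (p.γ * (1 + alpha p)) 1 := lt_max_of_lt_right one_pos
  rw [constM, deriv_f]
  have h6' : 0 < phi p K (R1 p K) * psi p K (R1 p K) := h6
  positivity

end Rate

/-! ### Contraction of the quadratic form under a noiseless step -/

section QuadraticForm

lemma norm_add_three_sq_le {E : Type*} [NormedAddCommGroup E] (x y z : E) :
    ‖x + y + z‖ ^ 2 ≤ 3 * (‖x‖ ^ 2 + ‖y‖ ^ 2 + ‖z‖ ^ 2) := by
  have h := norm_add₃_le (a := x) (b := y) (c := z)
  have h0 : ‖x + y + z‖ ^ 2 ≤ (‖x‖ + ‖y‖ + ‖z‖) ^ 2 := by gcongr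
  nlinarith [sq_nonneg (‖x‖ - ‖y‖), sq_nonneg (‖x‖ - ‖z‖), sq_nonneg (‖y‖ - ‖z‖)]

/-- Beyond the factor `1 - τ η`, the change is `η (I + η J)`, with `I` of first and `J` of second
order. The friction and the form `k` make `I` negative, and the smallness of `η` keeps `η J` below
this reserve. In the application `W = γ⁻¹ w`, while `y` and `g` are `γ⁻²` times the differences of
`K x` and `∇ G`. -/
lemma quadratic_form_contraction {E : Type*} [NormedAddCommGroup E] [InnerProductSpace ℝ E]
    {z W y g : E} {η τ κ k kW : ℝ}
    (hη : 0 < η) (hη8 : η ≤ 1 / 8) (hτ : 0 < τ) (hτ8 : τ ≤ 1 / 8) (hτκ : τ ≤ κ / 4)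
    (hk : ⟪z, y⟫ = k) (hκk : κ * ‖z‖ ^ 2 ≤ k) (hy : η * ‖y‖ ^ 2 ≤ k / 32)
    (hkW : η * kW ≤ ‖W‖ ^ 2 / 32) (hg : ‖g‖ ^ 2 ≤ κ / 16 * ‖z‖ ^ 2)
    (hzg : -⟪z, g⟫ ≤ τ * (κ * ‖z‖ ^ 2 + 1 / 2 * ‖z + W‖ ^ 2 + 1 / 2 * ‖W‖ ^ 2)) :
    k + 2 * η * ⟪W, y⟫ + η ^ 2 * kW
      + 1 / 2 * ‖(1 - 2 * τ) • (z + η • W) + (W - η • W - η • y - η • g)‖ ^ 2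
      + 1 / 2 * ‖W - η • W - η • y - η • g‖ ^ 2
    ≤ (1 - τ * η) * (k + 1 / 2 * ‖(1 - 2 * τ) • z + W‖ ^ 2 + 1 / 2 * ‖W‖ ^ 2) := by
  have hκ : 0 < κ := by linarith
  have hZ := sq_nonneg ‖z‖
  have hW := sq_nonneg ‖W‖
  have e1 : ‖(1 - 2 * τ) • (z + η • W) + (W - η • W - η • y - η • g)‖ ^ 2
      = ‖(1 - 2 * τ) • z + W‖ ^ 2
        - 2 * η * ⟪(1 - 2 * τ) • z + W, (2 * τ) • W + y + g⟫
        + η ^ 2 * ‖(2 * τ) • W + y + g‖ ^ 2 := by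
    have : (1 - 2 * τ) • (z + η • W) + (W - η • W - η • y - η • g)
        = ((1 - 2 * τ) • z + W) - η • ((2 * τ) • W + y + g) := by module
    rw [this, norm_sub_sq_real, norm_smul, real_inner_smul_right, mul_pow, Real.norm_eq_abs,
      sq_abs]
    ring
  have e2 : ‖W - η • W - η • y - η • g‖ ^ 2
      = ‖W‖ ^ 2 - 2 * η * ⟪W, W + y + g⟫ + η ^ 2 * ‖W + y + g‖ ^ 2 := by
    have : W - η • W - η • y - η • g = W - η • (W + y + g) := by module
    rw [this, norm_sub_sq_real, norm_smul, real_inner_smul_right, mul_pow, Real.norm_eq_abs,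
      sq_abs]
    ring
  have e3 : ‖(1 - 2 * τ) • z + W‖ ^ 2
      = (1 - 2 * τ) ^ 2 * ‖z‖ ^ 2 + 2 * (1 - 2 * τ) * ⟪z, W⟫ + ‖W‖ ^ 2 := by
    rw [norm_add_sq_real, norm_smul, real_inner_smul_left, mul_pow, Real.norm_eq_abs, sq_abs]
    ring
  have e4 : ⟪(1 - 2 * τ) • z + W, (2 * τ) • W + y + g⟫
      = (1 - 2 * τ) * (2 * τ * ⟪z, W⟫ + k + ⟪z, g⟫)
        + (2 * τ * ‖W‖ ^ 2 + ⟪W, y⟫ + ⟪W, g⟫) := by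
    simp only [inner_add_left, inner_add_right, real_inner_smul_left, real_inner_smul_right,
      real_inner_self_eq_norm_sq, hk]
    ring
  have e5 : ⟪W, W + y + g⟫ = ‖W‖ ^ 2 + ⟪W, y⟫ + ⟪W, g⟫ := by
    simp only [inner_add_right, real_inner_self_eq_norm_sq]
  have e6 : ‖z + W‖ ^ 2 = ‖z‖ ^ 2 + 2 * ⟪z, W⟫ + ‖W‖ ^ 2 := norm_add_sq_real z W
  have b1 : ‖(2 * τ) • W + y + g‖ ^ 2 ≤ 3 * (‖W‖ ^ 2 / 16 + ‖y‖ ^ 2 + ‖g‖ ^ 2) := by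
    refine (norm_add_three_sq_le _ _ _).trans ?_
    rw [norm_smul, mul_pow, Real.norm_eq_abs, sq_abs]
    have : (2 * τ) ^ 2 ≤ 1 / 16 := by nlinarith only [hτ, hτ8]
    have := mul_le_mul_of_nonneg_right this hW
    linarith
  have b2 := norm_add_three_sq_le W y g
  -- The weight `5/8` leaves `3/8` of the friction for the second-order terms, and the other half
  -- costs `8/5 * 1/16 = 1/10` of `κ ‖z‖²`.
  have b3 : -2 * ⟪W, g⟫ ≤ 5 / 8 * ‖W‖ ^ 2 + 8 / 5 * ‖g‖ ^ 2 := by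
    have h := norm_add_sq_real ((5 : ℝ) • W) ((8 : ℝ) • g)
    rw [norm_smul, norm_smul, real_inner_smul_left, real_inner_smul_right] at h
    norm_num at h
    have := sq_nonneg ‖(5 : ℝ) • W + (8 : ℝ) • g‖
    linarith
  have b4 : τ * ‖z‖ ^ 2 ≤ κ / 4 * ‖z‖ ^ 2 := mul_le_mul_of_nonneg_right hτκ hZ
  have b5 : (1 - 2 * τ) * (1 - τ) * (τ * ‖z‖ ^ 2) ≤ 1 * (τ * ‖z‖ ^ 2) := by
    apply mul_le_mul_of_nonneg_right _ (by positivity)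
    nlinarith only [hτ, hτ8]
  have hκZ : 0 ≤ κ * ‖z‖ ^ 2 := by positivity
  have b6 : τ * (1 - 2 * τ) * (κ * ‖z‖ ^ 2) ≤ 1 / 8 * (κ * ‖z‖ ^ 2) := by
    apply mul_le_mul_of_nonneg_right _ hκZ
    nlinarith only [hτ, hτ8]
  have b7 : τ * k ≤ 1 / 8 * k := mul_le_mul_of_nonneg_right hτ8 (hκZ.trans hκk)
  have b8 := mul_le_mul_of_nonneg_left hzg (by linarith : 0 ≤ 1 - 2 * τ)
  have b9 : 0 ≤ τ ^ 2 * ‖W‖ ^ 2 := by positivity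
  -- This is `I`. The terms with `⟪W, y⟫` have cancelled, and `b8` removes `⟪z, W⟫` exactly.
  have hI : -(1 - 3 * τ) * k + 1 / 2 * τ * (1 - 2 * τ) ^ 2 * ‖z‖ ^ 2
        - τ * (1 - 2 * τ) * ⟪z, W⟫ - (1 + τ) * ‖W‖ ^ 2 - (1 - 2 * τ) * ⟪z, g⟫ - 2 * ⟪W, g⟫
      ≤ -(3 / 20) * k - 3 / 8 * ‖W‖ ^ 2 := by
    rw [e6] at b8
    linarith only [b3, b4, b5, b6, b7, b8, b9, hg, hκk]
  have hJ : η * (kW + 1 / 2 * ‖(2 * τ) • W + y + g‖ ^ 2 + 1 / 2 * ‖W + y + g‖ ^ 2)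
      ≤ 3 / 20 * k + 3 / 8 * ‖W‖ ^ 2 := by
    have c1 := mul_le_mul_of_nonneg_left b1 hη.le
    have c2 := mul_le_mul_of_nonneg_left b2 hη.le
    have c3 : η * ‖g‖ ^ 2 ≤ 1 / 8 * (κ / 16 * ‖z‖ ^ 2) := by gcongr
    have c4 : η * ‖W‖ ^ 2 ≤ 1 / 8 * ‖W‖ ^ 2 := by gcongr
    linarith only [c1, c2, c3, c4, hy, hkW, hκk, hκZ, hW]
  have hIJ := mul_le_mul_of_nonneg_left (add_le_add hI hJ) hη.le
  rw [e1, e2, e4, e5, e3]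
  linarith only [hIJ]

end QuadraticForm

/-! ### One step of the Euler chain -/

section Step

variable {d : ℕ} {p : Params} {U G : Pos d → ℝ} {K : Pos d →L[ℝ] Pos d}

/-- The sheared difference after the noiseless part of an Euler step. -/
noncomputable def shearDrift (p : Params) (U : Pos d → ℝ) (h : ℝ) (a b : Phase d) : Pos d :=
  shearDiff p a b - (p.γ⁻¹ * h) • (∇ U a.1 - ∇ U b.1)

/-- The noise scale in the sheared coordinate. -/
noncomputable def noiseScale (p : Params) (h : ℝ) : ℝ := p.γ⁻¹ * √(2 * p.γ * h)

/-- No noise appears: the new position difference is fixed by the old state, so a coupling only has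
to handle the sheared coordinate. -/
lemma posDiff_eulerStep (hγ : p.γ ≠ 0) (h : ℝ) (a b : Phase d) (ξ ξ' : Pos d) :
    posDiff (eulerStep U p.γ h a ξ) (eulerStep U p.γ h b ξ')
      = (1 - h * p.γ) • posDiff a b + (h * p.γ) • shearDiff p a b := by
  have e : (h * p.γ) • p.γ⁻¹ • (a.2 - b.2) = h • (a.2 - b.2) := by
    rw [smul_smul, mul_assoc, mul_inv_cancel₀ hγ, mul_one]
  simp only [posDiff, shearDiff, eulerStep, smul_add, e]
  module

lemma shearDiff_eulerStep (hγ : p.γ ≠ 0) (h : ℝ) (a b : Phase d) (ξ ξ' : Pos d) :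
    shearDiff p (eulerStep U p.γ h a ξ) (eulerStep U p.γ h b ξ')
      = shearDrift p U h a b + noiseScale p h • (ξ - ξ') := by
  have e : p.γ⁻¹ • (h * p.γ) • (a.2 - b.2) = h • (a.2 - b.2) := by
    rw [smul_smul, mul_comm h, ← mul_assoc, inv_mul_cancel₀ hγ, one_mul]
  have e2 : a.2 - h • ∇ U a.1 - (h * p.γ) • a.2 + √(2 * p.γ * h) • ξ
        - (b.2 - h • ∇ U b.1 - (h * p.γ) • b.2 + √(2 * p.γ * h) • ξ')
      = (a.2 - b.2) - h • (∇ U a.1 - ∇ U b.1) - (h * p.γ) • (a.2 - b.2)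
        + √(2 * p.γ * h) • (ξ - ξ') := by module
  simp only [shearDrift, shearDiff, eulerStep, noiseScale, e2, smul_add, smul_sub p.γ⁻¹, e,
    smul_smul]
  simp only [smul_sub, mul_smul]
  abel

/-- Consequences of the step size condition. -/
structure StepBounds (p : Params) (R₁ h : ℝ) : Prop where
  h_pos : 0 < h
  eta_le : h * p.γ ≤ 1 / 8
  alpha_le : h * p.γ * alpha p * (alpha p + 1) ≤ 1 / 9600
  R₁_le : h * p.γ * alpha p * R₁ ≤ noiseScale p h / 2
  LK_le : h * p.γ⁻¹ * p.LK ≤ 1 / 32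

lemma noiseScale_pos (S : Admissible p U G K) {h : ℝ} (hh : 0 < h) : 0 < noiseScale p h := by
  have := S.γ_pos
  unfold noiseScale; positivity

lemma noiseScale_sq (S : Admissible p U G K) {h : ℝ} (hh : 0 < h) :
    noiseScale p h ^ 2 = 2 * h * p.γ⁻¹ := by
  have := S.γ_pos
  rw [noiseScale, mul_pow, Real.sq_sqrt (by positivity)]
  field_simp

/-- This ties the decay exponent of `phi` to the drift: over one noise scale the profile loses a
multiple of `h γ α`, the relative drift per step. -/
lemma profile_mul_noiseScale_sq (S : Admissible p U G K) {h : ℝ} (hh : 0 < h) :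
    64 * alpha p * p.γ ^ 2 * noiseScale p h ^ 2 = 128 * (h * p.γ * alpha p) := by
  have := S.γ_pos
  rw [noiseScale_sq S hh]
  field_simp; ring

lemma two_mul_L_inv (S : Admissible p U G K) (h : ℝ) :
    2 * (p.L * p.γ⁻¹ * h) = h * p.γ * alpha p := by
  have := S.γ_pos
  rw [alpha]; field_simp

lemma stepBounds (S : Admissible p U G K) {h : ℝ} (hh : 0 < h) (hS : StepSizeCondition p K h) :
    StepBounds p (R1 p K) h := by
  have hγ := S.γ_pos
  have hL := S.L_pos
  have hα := S.alpha_pos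
  have hLK := S.LK_pos
  obtain ⟨h1, h2⟩ := hS
  have h3 := h2.trans (min_le_left _ _)
  have h4 := (h2.trans (min_le_right _ _)).trans (min_le_left _ _)
  have h5 := (h2.trans (min_le_right _ _)).trans (min_le_right _ _)
  have e := two_mul_L_inv S h
  refine ⟨hh, ?_, ?_, ?_, ?_⟩
  · have h6 : (p.L * p.γ⁻¹ ^ 2) * (h * p.γ) ≤ (p.L * p.γ⁻¹ ^ 2) * (1 / 8) := by
      calc (p.L * p.γ⁻¹ ^ 2) * (h * p.γ) = p.L * p.γ⁻¹ * h := by field_simp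
        _ ≤ _ := h4
        _ = _ := by ring
    exact le_of_mul_le_mul_left h6 (by positivity)
  · rw [le_div_iff₀ (by positivity)] at h3
    rw [← e]
    have : alpha p = 2 * p.L * p.γ⁻¹ ^ 2 := rfl
    rw [← this] at h3
    linarith
  · have hs := noiseScale_pos S hh
    apply le_of_sq_le_sq _ (by positivity)
    rw [div_pow, noiseScale_sq S hh]
    have hη : 0 < h * p.γ := by positivity
    have e2 : (h * p.γ * alpha p * R1 p K) ^ 2
        = p.L * p.γ⁻¹ * h * (8 * p.L * R1 p K ^ 2) * (h * p.γ⁻¹ / 2) := by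
      rw [alpha]; field_simp; ring
    rw [e2]
    have := mul_le_mul_of_nonneg_right h1 (by positivity : 0 ≤ h * p.γ⁻¹ / 2)
    linarith
  · rw [le_div_iff₀ (by positivity)] at h5
    have h6 : p.L * (h * p.γ⁻¹ * p.LK) ≤ p.L * (1 / 32) := by linarith
    exact le_of_mul_le_mul_left h6 hL

lemma norm_posDiff_eulerStep_le (S : Admissible p U G K) {h : ℝ} (B : StepBounds p (R1 p K) h)
    (a b : Phase d) (ξ ξ' : Pos d) :
    ‖posDiff (eulerStep U p.γ h a ξ) (eulerStep U p.γ h b ξ')‖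
      ≤ (1 - h * p.γ) * ‖posDiff a b‖ + h * p.γ * ‖shearDiff p a b‖ := by
  rw [posDiff_eulerStep S.γ_pos.ne']
  refine (norm_add_le _ _).trans_eq ?_
  have h1 := mul_pos B.h_pos S.γ_pos
  rw [norm_smul, norm_smul, Real.norm_of_nonneg h1.le,
    Real.norm_of_nonneg (by linarith [B.eta_le])]

lemma abs_norm_shearDrift_sub_le (S : Admissible p U G K) {h : ℝ} (hh : 0 < h) (a b : Phase d) :
    |‖shearDrift p U h a b‖ - ‖shearDiff p a b‖| ≤ h * p.γ * alpha p / 2 * ‖posDiff a b‖ := by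
  refine (abs_norm_sub_norm_le _ _).trans ?_
  have e : shearDrift p U h a b - shearDiff p a b = -((p.γ⁻¹ * h) • (∇ U a.1 - ∇ U b.1)) := by
    rw [shearDrift]; abel
  have h1 : 0 ≤ p.γ⁻¹ * h := mul_nonneg (inv_nonneg.mpr S.γ_pos.le) hh.le
  rw [e, norm_neg, norm_smul, Real.norm_of_nonneg h1, ← two_mul_L_inv S h]
  have := mul_le_mul_of_nonneg_left (S.potential.lipschitz a.1 b.1) h1
  refine this.trans_eq ?_
  rw [posDiff]; ring

/-- Outside the compact set, the noiseless step contracts `r_l`. -/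
lemma rl_eulerStep_le (S : Admissible p U G K) {h : ℝ} (B : StepBounds p (R1 p K) h)
    {a b : Phase d} (hab : a - b ∉ compactSet d p) (ξ : Pos d) :
    rl p K (eulerStep U p.γ h a ξ) (eulerStep U p.γ h b ξ)
      ≤ (1 - tau p * (h * p.γ) / 2) * rl p K a b := by
  have hγ := S.γ_pos
  have hκ := S.κ_pos
  have hh := B.h_pos
  have hη : 0 < h * p.γ := by positivity
  have hη8 := B.eta_le
  have hτ := S.tau_pos
  have hτ8 := tau_le (p := p)
  have hτη : tau p * (h * p.γ) ≤ 1 / 64 := by nlinarith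
  apply le_of_sq_le_sq _ (mul_nonneg (by linarith) (rl_nonneg _ _))
  have hz' := posDiff_eulerStep (U := U) hγ.ne' h a b ξ ξ
  have hq' := shearDiff_eulerStep (U := U) hγ.ne' h a b ξ ξ
  rw [sub_self, smul_zero, add_zero] at hq'
  set z := posDiff a b with hz
  set q := shearDiff p a b with hq
  set W := q - z with hW
  set y := (p.γ⁻¹ ^ 2) • K z with hy
  set g := (p.γ⁻¹ ^ 2) • (∇ G a.1 - ∇ G b.1) with hgdef
  have hz'' : posDiff (eulerStep U p.γ h a ξ) (eulerStep U p.γ h b ξ) = z + (h * p.γ) • W := by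
    rw [hz', hW]; module
  have hgrad : (p.γ⁻¹ * h) • (∇ U a.1 - ∇ U b.1) = (h * p.γ) • y + (h * p.γ) • g := by
    have e : p.γ⁻¹ * h = h * p.γ * p.γ⁻¹ ^ 2 := by field_simp
    rw [gradient_eq S.potential S.splitting, gradient_eq S.potential S.splitting, hy, hgdef, e,
      hz, posDiff, map_sub]
    simp only [smul_sub, smul_add, smul_smul]
    abel
  have hq'' : shearDiff p (eulerStep U p.γ h a ξ) (eulerStep U p.γ h b ξ)
      = z + W - (h * p.γ) • y - (h * p.γ) • g := by
    rw [hq', shearDrift, hgrad, hW]; abel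
  have ex : (z + W - (h * p.γ) • y - (h * p.γ) • g) - (2 * tau p) • (z + (h * p.γ) • W)
      = (1 - 2 * tau p) • (z + (h * p.γ) • W)
        + (W - (h * p.γ) • W - (h * p.γ) • y - (h * p.γ) • g) := by module
  have ey : (z + W - (h * p.γ) • y - (h * p.γ) • g) - (z + (h * p.γ) • W)
      = W - (h * p.γ) • W - (h * p.γ) • y - (h * p.γ) • g := by module
  have e3 : p.γ⁻¹ ^ 2 * ⟪z + (h * p.γ) • W, K (z + (h * p.γ) • W)⟫
      = ⟪z, y⟫ + 2 * (h * p.γ) * ⟪W, y⟫ + (h * p.γ) ^ 2 * (p.γ⁻¹ ^ 2 * ⟪W, K W⟫) := by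
    rw [map_add, map_smul]
    simp only [hy, inner_add_left, inner_add_right, real_inner_smul_left, real_inner_smul_right]
    rw [← S.splitting.symmetric z W, real_inner_comm W (K z)]
    ring
  have hrl' : rl p K (eulerStep U p.γ h a ξ) (eulerStep U p.γ h b ξ) ^ 2
      = ⟪z, y⟫ + 2 * (h * p.γ) * ⟪W, y⟫ + (h * p.γ) ^ 2 * (p.γ⁻¹ ^ 2 * ⟪W, K W⟫)
      + 1 / 2 * ‖(1 - 2 * tau p) • (z + (h * p.γ) • W)
        + (W - (h * p.γ) • W - (h * p.γ) • y - (h * p.γ) • g)‖ ^ 2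
      + 1 / 2 * ‖W - (h * p.γ) • W - (h * p.γ) • y - (h * p.γ) • g‖ ^ 2 := by
    rw [rl_sq S, hz'', hq'', e3, ex, ey]
  have hrl : rl p K a b ^ 2
      = ⟪z, y⟫ + 1 / 2 * ‖(1 - 2 * tau p) • z + W‖ ^ 2 + 1 / 2 * ‖W‖ ^ 2 := by
    have e : q - (2 * tau p) • z = (1 - 2 * tau p) • z + W := by rw [hW]; module
    rw [rl_sq S, ← hz, ← hq, ← hW, hy, real_inner_smul_right, e]
  have hquad : p.κ * ‖z‖ ^ 2 ≤ ⟪z, K z⟫ := mul_norm_sq_le_quadForm S.splitting z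
  have hg1 : ‖∇ G a.1 - ∇ G b.1‖ ≤ p.LG * ‖z‖ := S.splitting.lipschitz a.1 b.1
  have hLG : (p.γ⁻¹ ^ 2 * p.LG) ^ 2 ≤ p.γ⁻¹ ^ 2 * p.κ / 16 := by
    have h1 := S.γ_large
    rw [div_le_iff₀ (by positivity)] at h1
    have h2 : (4 * p.LG) ^ 2 ≤ (p.γ * √p.κ) ^ 2 := by
      have := S.LG_nonneg
      gcongr
    rw [mul_pow, mul_pow, Real.sq_sqrt hκ.le] at h2
    have h3 := mul_le_mul_of_nonneg_left h2 (by positivity : 0 ≤ p.γ⁻¹ ^ 4 / 16)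
    have h4 : p.γ⁻¹ ^ 4 / 16 * (p.γ ^ 2 * p.κ) = p.γ⁻¹ ^ 2 * p.κ / 16 := by field_simp
    linarith
  have key := quadratic_form_contraction (z := z) (W := W) (y := y) (g := g)
    (η := h * p.γ) (τ := tau p) (κ := p.γ⁻¹ ^ 2 * p.κ) (k := ⟪z, y⟫)
    (kW := p.γ⁻¹ ^ 2 * ⟪W, K W⟫) hη hη8 hτ hτ8 tau_le' rfl
    (by rw [hy, real_inner_smul_right, mul_assoc]; gcongr) ?_ ?_ ?_ ?_
  · rw [hrl', mul_pow (1 - tau p * (h * p.γ) / 2), hrl]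
    refine key.trans ?_
    apply mul_le_mul_of_nonneg_right _ (hrl ▸ sq_nonneg _)
    -- `1 - t ≤ (1 - t / 2) ^ 2`, which converts the factor for the square into one for `rl`.
    nlinarith [sq_nonneg (tau p * (h * p.γ))]
  · have h1 := norm_apply_sq_le hκ S.splitting z
    have h0 : 0 ≤ ⟪z, K z⟫ := le_trans (by positivity) hquad
    rw [hy, norm_smul, mul_pow, real_inner_smul_right, Real.norm_of_nonneg (by positivity)]
    calc h * p.γ * ((p.γ⁻¹ ^ 2) ^ 2 * ‖K z‖ ^ 2)
        ≤ h * p.γ * ((p.γ⁻¹ ^ 2) ^ 2 * (p.LK * ⟪z, K z⟫)) := by gcongr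
      _ = h * p.γ⁻¹ * p.LK * (p.γ⁻¹ ^ 2 * ⟪z, K z⟫) := by field_simp
      _ ≤ 1 / 32 * (p.γ⁻¹ ^ 2 * ⟪z, K z⟫) :=
          mul_le_mul_of_nonneg_right B.LK_le (by positivity)
      _ = _ := by ring
  · have h1 := quadForm_le S.splitting W
    calc h * p.γ * (p.γ⁻¹ ^ 2 * ⟪W, K W⟫)
        ≤ h * p.γ * (p.γ⁻¹ ^ 2 * (p.LK * ‖W‖ ^ 2)) := by gcongr
      _ = h * p.γ⁻¹ * p.LK * ‖W‖ ^ 2 := by field_simp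
      _ ≤ 1 / 32 * ‖W‖ ^ 2 := mul_le_mul_of_nonneg_right B.LK_le (by positivity)
      _ = _ := by ring
  · rw [hgdef, norm_smul, Real.norm_of_nonneg (by positivity)]
    calc (p.γ⁻¹ ^ 2 * ‖∇ G a.1 - ∇ G b.1‖) ^ 2 ≤ (p.γ⁻¹ ^ 2 * (p.LG * ‖z‖)) ^ 2 := by gcongr
      _ = (p.γ⁻¹ ^ 2 * p.LG) ^ 2 * ‖z‖ ^ 2 := by ring
      _ ≤ _ := by gcongr
  · have hnn : 0 ≤ p.γ⁻¹ ^ 2 * p.κ * ‖z‖ ^ 2 + 1 / 2 * ‖z + W‖ ^ 2 + 1 / 2 * ‖W‖ ^ 2 := by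
      positivity
    have hout : calR p < p.γ⁻¹ ^ 2 * p.κ * ‖z‖ ^ 2 + 1 / 2 * ‖z + W‖ ^ 2 + 1 / 2 * ‖W‖ ^ 2 := by
      rw [mem_compactSet, not_le] at hab
      rw [← hz, ← hq] at hab
      rw [hW, add_sub_cancel, mul_comm (p.γ⁻¹ ^ 2)]
      exact hab
    rw [hgdef, real_inner_smul_right]
    -- Beyond radius `R` the convexity of `G` gives the sign. Within it the defect is at most `γ⁻²
    -- LG R² = τ ℛ`, and the point is outside `𝒦`; this is why `calR` carries the factor `τ⁻¹`.
    rcases lt_or_ge p.R ‖z‖ with hR | hR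
    · have h1 : 0 ≤ ⟪∇ G a.1 - ∇ G b.1, z⟫ := S.splitting.convex_outside a.1 b.1 hR
      rw [real_inner_comm] at h1
      have h2 : 0 ≤ p.γ⁻¹ ^ 2 * ⟪z, ∇ G a.1 - ∇ G b.1⟫ := by positivity
      have h3 := mul_nonneg hτ.le hnn
      linarith
    · have h1 := abs_real_inner_le_norm z (∇ G a.1 - ∇ G b.1)
      have h2 := (neg_le_abs _).trans h1
      have hLG0 := S.LG_nonneg
      have h3 : ‖z‖ * ‖∇ G a.1 - ∇ G b.1‖ ≤ p.R * (p.LG * p.R) := by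
        have : ‖∇ G a.1 - ∇ G b.1‖ ≤ p.LG * p.R :=
          hg1.trans (mul_le_mul_of_nonneg_left hR hLG0)
        gcongr
        exact S.R_nonneg
      calc -(p.γ⁻¹ ^ 2 * ⟪z, ∇ G a.1 - ∇ G b.1⟫) = p.γ⁻¹ ^ 2 * -⟪z, ∇ G a.1 - ∇ G b.1⟫ := by ring
        _ ≤ p.γ⁻¹ ^ 2 * (p.R * (p.LG * p.R)) := by gcongr; exact h2.trans h3
        _ = tau p * calR p := by rw [calR]; field_simp
        _ ≤ _ := by gcongr

/-! ### The distance `ρ` -/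

lemma rho_le_f_rs (S : Admissible p U G K) (a b : Phase d) : rho p K a b ≤ f p K (rs p a b) := by
  have h1 : 0 ≤ min (Delta p K a b) (DK p K) + eps p * rl p K a b :=
    add_nonneg (le_min (Delta_nonneg S a b) (DK_nonneg S))
      (mul_nonneg S.eps_pos.le (rl_nonneg a b))
  refine (isProfile_slope S).integral_mono h1 ?_
  have := min_le_left (Delta p K a b) (DK p K)
  unfold Delta at *
  linarith

lemma rho_eq_of_le {a b : Phase d} (h : Delta p K a b ≤ DK p K) :
    rho p K a b = f p K (rs p a b) := by
  rw [rho, min_eq_left h, Delta, sub_add_cancel]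

lemma rho_le_f_rl (S : Admissible p U G K) (a b : Phase d) :
    rho p K a b ≤ f p K (DK p K + eps p * rl p K a b) := by
  have h1 : 0 ≤ min (Delta p K a b) (DK p K) + eps p * rl p K a b :=
    add_nonneg (le_min (Delta_nonneg S a b) (DK_nonneg S))
      (mul_nonneg S.eps_pos.le (rl_nonneg a b))
  exact (isProfile_slope S).integral_mono h1 (by linarith [min_le_right (Delta p K a b) (DK p K)])

lemma rho_nonneg (S : Admissible p U G K) (a b : Phase d) : 0 ≤ rho p K a b :=
  (isProfile_slope S).integral_nonneg
    (add_nonneg (le_min (Delta_nonneg S a b) (DK_nonneg S))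
      (mul_nonneg S.eps_pos.le (rl_nonneg a b)))

/-- The synchronous coupling contracts `ρ` at large distances. -/
lemma rho_sync_le_of_large (S : Admissible p U G K) {h : ℝ} (B : StepBounds p (R1 p K) h)
    {a b : Phase d} (hab : DK p K < Delta p K a b) (ξ : Pos d) :
    rho p K (eulerStep U p.γ h a ξ) (eulerStep U p.γ h b ξ)
      ≤ (1 - rate p K * h) * rho p K a b := by
  have hg := isProfile_slope S
  have hDK := DK_nonneg S
  have hε := S.eps_pos
  have hh := B.h_pos
  have hγ := S.γ_pos
  have hmem : a - b ∉ compactSet d p := fun hm => (Delta_le_DK S hm).not_gt hab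
  have h1 := rl_eulerStep_le S B hmem ξ
  have hrl := rl_nonneg (p := p) (K := K) a b
  have hrl' := rl_nonneg (p := p) (K := K) (eulerStep U p.γ h a ξ) (eulerStep U p.γ h b ξ)
  have hρ : rho p K a b = f p K (DK p K + eps p * rl p K a b) := by
    rw [rho, min_eq_right hab.le]
  set t := tau p * (h * p.γ) / 2 with ht
  have ht0 : 0 < t := by have := S.tau_pos; positivity
  have h2 : rl p K (eulerStep U p.γ h a ξ) (eulerStep U p.γ h b ξ)
      ≤ rl p K a b - t * rl p K a b := by linarith
  refine (rho_le_f_rl S _ _).trans ?_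
  have h3 : f p K (DK p K + eps p * rl p K (eulerStep U p.γ h a ξ) (eulerStep U p.γ h b ξ))
      ≤ f p K (DK p K + eps p * (rl p K a b - t * rl p K a b)) :=
    hg.integral_mono (by positivity) (by gcongr)
  have h4 := hg.floor_mul_le_sub (u := DK p K + eps p * (rl p K a b - t * rl p K a b))
    (v := DK p K + eps p * rl p K a b)
    (by have := hrl'.trans h2; positivity)
    (by have : 0 ≤ t * rl p K a b := by positivity
        gcongr; linarith)
  rw [← f_eq, ← f_eq] at h4
  -- As `DK < Delta` here, the argument of `f` is at most `rs`. This lets `calE` convert the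
  -- decrease of `rl` into a fraction of `rho`.
  have h5 : f p K (DK p K + eps p * rl p K a b) ≤ rs p a b := by
    refine (hg.integral_le_self (by positivity)).trans ?_
    unfold Delta at hab; linarith
  have h6 := calE_mul_rs_le_rl S a b
  have h7 := rate_le_large S
  have h8 := rs_nonneg S a b
  rw [hρ]
  have h9 : rate p K * h * f p K (DK p K + eps p * rl p K a b)
      ≤ slope p K (R1 p K) * (eps p * t) * rl p K a b := by
    have hc := rate_pos S
    have hs := slope_R1_pos S
    calc rate p K * h * f p K (DK p K + eps p * rl p K a b)
        ≤ rate p K * h * rs p a b := by gcongr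
      _ ≤ slope p K (R1 p K) * (eps p * (tau p * p.γ / 2)) * calE p * h * rs p a b := by gcongr
      _ = slope p K (R1 p K) * (eps p * t) * (calE p * rs p a b) := by rw [ht]; ring
      _ ≤ _ := by gcongr
  linarith only [h3, h4, h9]

/-- In the small distance region, the decay of `f` by the drift is enough for the rate. -/
lemma rate_mul_f_le (S : Admissible p U G K) {h : ℝ} (hh : 0 < h) {A C x : ℝ} (hA : 0 ≤ A)
    (hC : 0 ≤ C) (hAC : alpha p * A + C ≤ (4 * alpha p + 1) * x) (hx : 0 ≤ x) :
    rate p K * h * f p K (alpha p * A + C)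
      ≤ h * p.γ * alpha p * x * slope p K (R1 p K) := by
  have hα := S.alpha_pos
  have hc := rate_pos S
  have h1 := rate_le_small S
  calc rate p K * h * f p K (alpha p * A + C)
      ≤ rate p K * h * (alpha p * A + C) := by
        gcongr
        exact (isProfile_slope S).integral_le_self (by positivity)
    _ ≤ rate p K * h * ((4 * alpha p + 1) * x) := by gcongr
    _ = rate p K * (4 * alpha p + 1) * (h * x) := by ring
    _ ≤ slope p K (R1 p K) * (p.γ * alpha p) * (h * x) := by gcongr
    _ = _ := by ring

/-- The synchronous coupling contracts `ρ` at small distances if the sheared difference is small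
compared to the difference of positions. -/
lemma rho_sync_le_of_small (S : Admissible p U G K) {h : ℝ} (B : StepBounds p (R1 p K) h)
    {a b : Phase d} (hab : Delta p K a b ≤ DK p K)
    (hq : ‖shearDiff p a b‖ ≤ ‖posDiff a b‖ / 4) (ξ : Pos d) :
    rho p K (eulerStep U p.γ h a ξ) (eulerStep U p.γ h b ξ)
      ≤ (1 - rate p K * h) * rho p K a b := by
  have hg := isProfile_slope S
  have hα := S.alpha_pos
  have hη := mul_pos B.h_pos S.γ_pos
  refine (rho_le_f_rs S _ _).trans ?_
  rw [rho_eq_of_le hab, rs_eq, rs_eq]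
  have h1 := norm_posDiff_eulerStep_le S B a b ξ ξ
  have h2 := abs_norm_shearDrift_sub_le S B.h_pos a b
  have h3 := shearDiff_eulerStep (U := U) S.γ_pos.ne' h a b ξ ξ
  rw [sub_self, smul_zero, add_zero] at h3
  rw [h3]
  have h4 := drift_contraction hg hα hη (norm_nonneg (posDiff a b)) hq
    (c := alpha p * ‖posDiff (eulerStep U p.γ h a ξ) (eulerStep U p.γ h b ξ)‖)
    (Q := ‖shearDrift p U h a b‖) (by positivity) (norm_nonneg _)
    (mul_le_mul_of_nonneg_left h1 hα.le) (by linarith [(abs_le.mp h2).2])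
  have h5 := rate_mul_f_le S B.h_pos (norm_nonneg (posDiff a b))
    (norm_nonneg (shearDiff p a b)) (x := ‖posDiff a b‖ / 4) (by linarith) (by positivity)
  rw [← f_eq, ← f_eq] at h4
  linarith

end Step

/-! ### The coupling of two Euler steps -/

section Coupling

variable {d : ℕ} {p : Params} {U G : Pos d → ℝ} {K : Pos d →L[ℝ] Pos d}

/-- The noise whose component in direction `e` is replaced by `x`. -/
noncomputable def replaceNoise (e : Pos d) (x : ℝ) (ξ : Pos d) : Pos d :=
  x • e + (ξ - ⟪e, ξ⟫ • e)

lemma continuous_replaceNoise :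
    Continuous fun t : Pos d × ℝ × Pos d => replaceNoise t.1 t.2.1 t.2.2 := by
  unfold replaceNoise; fun_prop

lemma measurable_replaceNoise {β : Type*} [MeasurableSpace β] {e ξ : β → Pos d} {x : β → ℝ}
    (he : Measurable e) (hx : Measurable x) (hξ : Measurable ξ) :
    Measurable fun t => replaceNoise (e t) (x t) (ξ t) :=
  continuous_replaceNoise.measurable.comp (he.prodMk (hx.prodMk hξ))

lemma lintegral_prod_eq {β β' : Type*} [MeasurableSpace β] [MeasurableSpace β'] (μ : Measure β)
    (ν : Measure β') [SFinite ν] (F : β → β' → ℝ≥0∞)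
    (hF : Measurable fun t : β × β' => F t.1 t.2) :
    ∫⁻ t, F t.1 t.2 ∂μ.prod ν = ∫⁻ x, ∫⁻ y, F x y ∂ν ∂μ :=
  lintegral_prod _ hF.aemeasurable

/-- The characteristic function at `t` factors into that of `x` at `⟪e, t⟫` and that of `ξ` at the
part of `t` orthogonal to `e`; Pythagoras recombines the exponents. -/
lemma map_replaceNoise {e : Pos d} (he : ‖e‖ = 1) :
    (stdNormal.prod (stdGaussian (Pos d))).map (fun t => replaceNoise e t.1 t.2)
      = stdGaussian (Pos d) := by
  have hm : Measurable fun t : ℝ × Pos d => replaceNoise e t.1 t.2 :=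
    measurable_replaceNoise measurable_const measurable_fst measurable_snd
  have : IsProbabilityMeasure ((stdNormal.prod (stdGaussian (Pos d))).map
      (fun t => replaceNoise e t.1 t.2)) := Measure.isProbabilityMeasure_map hm.aemeasurable
  apply Measure.ext_of_charFun
  funext t
  rw [charFun_stdGaussian, charFun_apply, integral_map hm.aemeasurable (by fun_prop)]
  have h1 : ∀ q : ℝ × Pos d, Complex.exp (⟪replaceNoise e q.1 q.2, t⟫ * Complex.I)
      = Complex.exp ((⟪e, t⟫ : ℝ) * (q.1 : ℝ) * Complex.I)
        * Complex.exp (⟪q.2, t - ⟪e, t⟫ • e⟫ * Complex.I) := by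
    intro q
    rw [← Complex.exp_add, ← add_mul]
    congr 2
    rw [← Complex.ofReal_mul, ← Complex.ofReal_add]
    congr 1
    simp only [replaceNoise, inner_add_left, inner_sub_left, inner_sub_right,
      real_inner_smul_left, real_inner_smul_right]
    rw [real_inner_comm e q.2]; ring
  simp_rw [h1]
  rw [integral_prod_mul (fun x : ℝ => Complex.exp ((⟪e, t⟫ : ℝ) * (x : ℝ) * Complex.I))
    (fun ξ : Pos d => Complex.exp (⟪ξ, t - ⟪e, t⟫ • e⟫ * Complex.I)),
    ← charFun_apply, charFun_stdGaussian, ← charFun_apply_real, charFun_gaussianReal,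
    ← Complex.exp_add]
  congr 1
  have h2 : ‖t - ⟪e, t⟫ • e‖ ^ 2 = ‖t‖ ^ 2 - ⟪e, t⟫ ^ 2 := by
    rw [norm_sub_sq_real, norm_smul, he, real_inner_smul_right, real_inner_comm, mul_one,
      Real.norm_eq_abs, sq_abs]
    ring
  rw [← Complex.ofReal_pow ‖t - ⟪e, t⟫ • e‖, h2]
  push_cast
  ring

lemma lintegral_replaceNoise {e : Pos d} (he : ‖e‖ = 1 ∨ e = 0) {F : Pos d → ℝ≥0∞}
    (hF : Measurable F) :
    ∫⁻ x, ∫⁻ ξ, F (replaceNoise e x ξ) ∂stdGaussian (Pos d) ∂stdNormal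
      = ∫⁻ ξ, F ξ ∂stdGaussian (Pos d) := by
  rcases he with he | rfl
  · have hm : Measurable fun t : ℝ × Pos d => replaceNoise e t.1 t.2 :=
      measurable_replaceNoise measurable_const measurable_fst measurable_snd
    conv_rhs => rw [← map_replaceNoise he]
    rw [lintegral_map hF hm]
    exact (lintegral_prod_eq _ _ (fun x ξ => F (replaceNoise e x ξ)) (hF.comp hm)).symm
  · simp [replaceNoise]

/-- The region where the coalescing coupling is used. -/
def coalescing (p : Params) (K : Pos d →L[ℝ] Pos d) : Set (Phase d × Phase d) :=
  {c | Delta p K c.1 c.2 ≤ DK p K ∧ ‖posDiff c.1 c.2‖ / 4 < ‖shearDiff p c.1 c.2‖}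

/-- The direction of the sheared difference after the noiseless part of the step. -/
noncomputable def direction (p : Params) (U : Pos d → ℝ) (h : ℝ) (c : Phase d × Phase d) : Pos d :=
  ‖shearDrift p U h c.1 c.2‖⁻¹ • shearDrift p U h c.1 c.2

lemma direction_norm (h : ℝ) (c : Phase d × Phase d) :
    ‖direction p U h c‖ = 1 ∨ direction p U h c = 0 := by
  unfold direction
  by_cases hc : shearDrift p U h c.1 c.2 = 0
  · right; simp [hc]
  · left
    rw [norm_smul, norm_inv, norm_norm, inv_mul_cancel₀ (norm_ne_zero_iff.mpr hc)]

lemma norm_smul_direction (h : ℝ) (c : Phase d × Phase d) :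
    ‖shearDrift p U h c.1 c.2‖ • direction p U h c = shearDrift p U h c.1 c.2 := by
  unfold direction
  by_cases hc : shearDrift p U h c.1 c.2 = 0
  · simp [hc]
  · rw [smul_smul, mul_inv_cancel₀ (norm_ne_zero_iff.mpr hc), one_smul]

open Classical in
/-- The noise of the second chain in the direction of the difference. -/
noncomputable def partner (p : Params) (U : Pos d → ℝ) (K : Pos d →L[ℝ] Pos d) (h : ℝ)
    (c : Phase d × Phase d) (x u : ℝ) : ℝ :=
  if c ∈ coalescing p K then jump (‖shearDrift p U h c.1 c.2‖ / noiseScale p h) x u else x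

/-- The random seed of the coupling. -/
noncomputable abbrev seed (d : ℕ) : Measure (ℝ × ℝ × Pos d) :=
  stdNormal.prod (uniform.prod (stdGaussian (Pos d)))

/-- The coupled Euler step. -/
noncomputable def coupledStep (p : Params) (U : Pos d → ℝ) (K : Pos d →L[ℝ] Pos d) (h : ℝ)
    (t : (Phase d × Phase d) × (ℝ × ℝ × Pos d)) : Phase d × Phase d :=
  (eulerStep U p.γ h t.1.1 (replaceNoise (direction p U h t.1) t.2.1 t.2.2.2),
    eulerStep U p.γ h t.1.2
      (replaceNoise (direction p U h t.1) (partner p U K h t.1 t.2.1 t.2.2.1) t.2.2.2))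

/-! ### Measurability -/

lemma continuous_gradient (hU : PotentialAssumption p U) : Continuous (∇ U) := by
  have : LipschitzWith p.L.toNNReal (∇ U) := by
    apply LipschitzWith.of_dist_le_mul
    intro x y
    rw [dist_eq_norm, dist_eq_norm]
    refine (hU.lipschitz x y).trans ?_
    gcongr
    exact Real.le_coe_toNNReal _
  exact this.continuous

lemma continuous_eulerStep (hU : PotentialAssumption p U) (γ h : ℝ) :
    Continuous fun t : Phase d × Pos d => eulerStep U γ h t.1 t.2 := by
  have := continuous_gradient hU
  unfold eulerStep; fun_prop

lemma measurable_eulerStep (hU : PotentialAssumption p U) (γ h : ℝ) {β : Type*}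
    [MeasurableSpace β] {a : β → Phase d} {ξ : β → Pos d} (ha : Measurable a)
    (hξ : Measurable ξ) : Measurable fun t => eulerStep U γ h (a t) (ξ t) :=
  (continuous_eulerStep hU γ h).measurable.comp (ha.prodMk hξ)

lemma continuous_posDiff : Continuous fun c : Phase d × Phase d => posDiff c.1 c.2 := by
  unfold posDiff; fun_prop

lemma continuous_shearDiff : Continuous fun c : Phase d × Phase d => shearDiff p c.1 c.2 := by
  unfold shearDiff; fun_prop

lemma continuous_shearDrift (hU : PotentialAssumption p U) (h : ℝ) :
    Continuous fun c : Phase d × Phase d => shearDrift p U h c.1 c.2 := by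
  have h1 := continuous_gradient hU
  have h2 := continuous_shearDiff (p := p) (d := d)
  unfold shearDrift; fun_prop

lemma continuous_rl : Continuous fun c : Phase d × Phase d => rl p K c.1 c.2 := by
  unfold rl
  have h : Continuous fun c : Phase d × Phase d => ⟪c.1.1 - c.2.1, K (c.1.1 - c.2.1)⟫ :=
    (by fun_prop : Continuous fun c : Phase d × Phase d => c.1.1 - c.2.1).inner (by fun_prop)
  fun_prop

lemma continuous_rs : Continuous fun c : Phase d × Phase d => rs p c.1 c.2 := by
  unfold rs; fun_prop

lemma continuous_Delta : Continuous fun c : Phase d × Phase d => Delta p K c.1 c.2 :=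
  continuous_rs.sub (continuous_const.mul continuous_rl)

lemma continuous_f : Continuous (f p K) :=
  intervalIntegral.continuous_primitive (fun a b =>
    ((continuous_phi p K).mul (continuous_psi p K)).intervalIntegrable a b) 0

lemma continuous_rho : Continuous fun c : Phase d × Phase d => rho p K c.1 c.2 :=
  continuous_f.comp ((continuous_Delta.min continuous_const).add
    (continuous_const.mul continuous_rl))

lemma measurableSet_coalescing : MeasurableSet (coalescing p K) :=
  (measurableSet_le continuous_Delta.measurable measurable_const).inter
    (measurableSet_lt (continuous_posDiff.norm.div_const 4).measurable
      continuous_shearDiff.norm.measurable)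

lemma measurable_direction (hU : PotentialAssumption p U) (h : ℝ) :
    Measurable (direction p U h) := by
  have h1 := (continuous_shearDrift hU h).measurable
  exact (h1.norm.inv).smul h1

lemma measurable_partner (hU : PotentialAssumption p U) (h : ℝ) {β : Type*} [MeasurableSpace β]
    {c : β → Phase d × Phase d} {x u : β → ℝ} (hc : Measurable c) (hx : Measurable x)
    (hu : Measurable u) : Measurable fun t => partner p U K h (c t) (x t) (u t) := by
  unfold partner
  refine Measurable.ite (hc measurableSet_coalescing) ?_ hx
  have h1 : Measurable fun t => ‖shearDrift p U h (c t).1 (c t).2‖ / noiseScale p h :=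
    ((continuous_shearDrift hU h).measurable.comp hc).norm.div_const _
  exact measurable_jump.comp (h1.prodMk (hx.prodMk hu))

lemma measurable_coupledStep (hU : PotentialAssumption p U) (h : ℝ) :
    Measurable (coupledStep p U K h) := by
  have m1 : Measurable fun t : (Phase d × Phase d) × (ℝ × ℝ × Pos d) => t.1 := measurable_fst
  have m2 : Measurable fun t : (Phase d × Phase d) × (ℝ × ℝ × Pos d) => t.2 := measurable_snd
  have mx := m2.fst
  have mu := m2.snd.fst
  have mξ := m2.snd.snd
  have me := (measurable_direction hU h).comp m1
  exact (measurable_eulerStep hU _ _ m1.fst (measurable_replaceNoise me mx mξ)).prodMk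
    (measurable_eulerStep hU _ _ m1.snd
      (measurable_replaceNoise me (measurable_partner hU h m1 mx mu) mξ))

/-! ### Marginals -/

lemma lintegral_seed (F : ℝ → ℝ → Pos d → ℝ≥0∞)
    (hF : Measurable fun t : ℝ × ℝ × Pos d => F t.1 t.2.1 t.2.2) :
    ∫⁻ t, F t.1 t.2.1 t.2.2 ∂seed d
      = ∫⁻ x, ∫⁻ u, ∫⁻ ξ, F x u ξ ∂stdGaussian (Pos d) ∂uniform ∂stdNormal := by
  refine (lintegral_prod_eq _ _ (fun x (y : ℝ × Pos d) => F x y.1 y.2) hF).trans ?_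
  refine lintegral_congr fun x => ?_
  exact lintegral_prod_eq _ _ (fun u ξ => F x u ξ) (hF.comp measurable_prodMk_left)

lemma lintegral_seed_fst (h : ℝ) (c : Phase d × Phase d) {F : Pos d → ℝ≥0∞} (hF : Measurable F) :
    ∫⁻ t, F (replaceNoise (direction p U h c) t.1 t.2.2) ∂seed d
      = ∫⁻ ξ, F ξ ∂stdGaussian (Pos d) := by
  rw [← lintegral_replaceNoise (direction_norm (p := p) (U := U) h c) hF]
  refine (lintegral_seed (fun x _ ξ => F (replaceNoise (direction p U h c) x ξ))
    (hF.comp (measurable_replaceNoise measurable_const measurable_fst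
      measurable_snd.snd))).trans ?_
  simp

/-- Integrating out `ξ` leaves a function of the scalar component alone, whose law `lintegral_jump`
shows to be unchanged. -/
lemma lintegral_seed_snd (hU : PotentialAssumption p U) (h : ℝ) (c : Phase d × Phase d)
    {F : Pos d → ℝ≥0∞} (hF : Measurable F) :
    ∫⁻ t, F (replaceNoise (direction p U h c) (partner p U K h c t.1 t.2.1) t.2.2) ∂seed d
      = ∫⁻ ξ, F ξ ∂stdGaussian (Pos d) := by
  have h5 : Measurable fun y : ℝ => ∫⁻ ξ, F (replaceNoise (direction p U h c) y ξ)
      ∂stdGaussian (Pos d) := by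
    have : Measurable fun t : ℝ × Pos d => F (replaceNoise (direction p U h c) t.1 t.2) :=
      hF.comp (measurable_replaceNoise measurable_const measurable_fst measurable_snd)
    exact this.lintegral_prod_right'
  rw [← lintegral_replaceNoise (direction_norm (p := p) (U := U) h c) hF]
  refine (lintegral_seed
    (fun x u ξ => F (replaceNoise (direction p U h c) (partner p U K h c x u) ξ))
    (hF.comp (measurable_replaceNoise measurable_const
      (measurable_partner hU h measurable_const measurable_fst measurable_snd.fst)
      measurable_snd.snd))).trans ?_
  by_cases hc : c ∈ coalescing p K
  · simp only [partner, if_pos hc]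
    exact lintegral_jump h5 _
  · simp only [partner, if_neg hc]
    simp

/-! ### Contraction in expectation -/

lemma one_sub_mul_rho_le (S : Admissible p U G K) (t : ℝ) (a b : Phase d) :
    ENNReal.ofReal ((1 - t) * rho p K a b)
      ≤ ENNReal.ofReal (Real.exp (-t)) * ENNReal.ofReal (rho p K a b) := by
  rw [← ENNReal.ofReal_mul (Real.exp_pos _).le]
  apply ENNReal.ofReal_le_ofReal
  have := Real.add_one_le_exp (-t)
  exact mul_le_mul_of_nonneg_right (by linarith) (rho_nonneg S a b)

lemma replaceNoise_sub (e : Pos d) (x y : ℝ) (ξ : Pos d) :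
    replaceNoise e x ξ - replaceNoise e y ξ = (x - y) • e := by
  unfold replaceNoise; module

lemma lintegral_coupledStep_of_notMem (S : Admissible p U G K) {h : ℝ}
    (B : StepBounds p (R1 p K) h) {c : Phase d × Phase d} (hc : c ∉ coalescing p K) :
    ∫⁻ t, ENNReal.ofReal (rho p K (coupledStep p U K h (c, t)).1 (coupledStep p U K h (c, t)).2)
        ∂seed d ≤ ENNReal.ofReal ((1 - rate p K * h) * rho p K c.1 c.2) := by
  have hpt : ∀ t, ENNReal.ofReal
      (rho p K (coupledStep p U K h (c, t)).1 (coupledStep p U K h (c, t)).2)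
      ≤ ENNReal.ofReal ((1 - rate p K * h) * rho p K c.1 c.2) := by
    intro t
    apply ENNReal.ofReal_le_ofReal
    simp only [coupledStep, partner, if_neg hc]
    rcases lt_or_ge (DK p K) (Delta p K c.1 c.2) with h1 | h1
    · exact rho_sync_le_of_large S B h1 _
    · refine rho_sync_le_of_small S B h1 ?_ _
      by_contra h2
      exact hc ⟨h1, not_le.mp h2⟩
  refine (lintegral_mono hpt).trans_eq ?_
  simp

lemma lintegral_coupledStep_of_mem (S : Admissible p U G K) {h : ℝ}
    (B : StepBounds p (R1 p K) h) {c : Phase d × Phase d} (hc : c ∈ coalescing p K) :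
    ∫⁻ t, ENNReal.ofReal (rho p K (coupledStep p U K h (c, t)).1 (coupledStep p U K h (c, t)).2)
        ∂seed d ≤ ENNReal.ofReal ((1 - rate p K * h) * rho p K c.1 c.2) := by
  have hα := S.alpha_pos
  have hg := isProfile_slope S
  have hη := mul_pos B.h_pos S.γ_pos
  have hs := noiseScale_pos S B.h_pos
  set s := noiseScale p h with hsdef
  set Q := ‖shearDrift p U h c.1 c.2‖ with hQ
  set c₀ := alpha p * ‖(1 - h * p.γ) • posDiff c.1 c.2 + (h * p.γ) • shearDiff p c.1 c.2‖ with hc₀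
  have hQ0 : 0 ≤ Q := norm_nonneg _
  have hc₀0 : 0 ≤ c₀ := by positivity
  have hpt : ∀ t : ℝ × ℝ × Pos d, ENNReal.ofReal
      (rho p K (coupledStep p U K h (c, t)).1 (coupledStep p U K h (c, t)).2)
      ≤ ENNReal.ofReal (f p K (c₀ + |Q + s * (t.1 - jump (Q / s) t.1 t.2.1)|)) := by
    intro t
    apply ENNReal.ofReal_le_ofReal
    refine (rho_le_f_rs S _ _).trans (le_of_eq ?_)
    have e1 : ‖shearDrift p U h c.1 c.2
        + s • ((t.1 - jump (Q / s) t.1 t.2.1) • direction p U h c)‖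
        = |Q + s * (t.1 - jump (Q / s) t.1 t.2.1)| := by
      conv_lhs => rw [← norm_smul_direction h c, ← hQ, smul_smul, ← add_smul, norm_smul]
      rcases direction_norm (p := p) (U := U) h c with h1 | h1
      · rw [h1, mul_one, Real.norm_eq_abs]
      -- The direction vanishes only if `Q = 0`. But `Q` differs from the length of the sheared
      -- difference by a tiny multiple of `‖posDiff‖`, which is less than four times that length in
      -- this region.
      · exfalso
        have h2 := norm_smul_direction (p := p) (U := U) h c
        rw [h1, smul_zero] at h2
        have h3 := (abs_le.mp (abs_norm_shearDrift_sub_le S B.h_pos c.1 c.2)).1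
        rw [← h2, norm_zero] at h3
        have h4 := hc.2
        have h5 := B.alpha_le
        have h6 : h * p.γ * alpha p ≤ 1 / 9600 := by
          have : 0 < h * p.γ * alpha p * alpha p := by positivity
          linarith
        have := mul_le_mul_of_nonneg_right h6 (norm_nonneg (posDiff c.1 c.2))
        have := norm_nonneg (posDiff c.1 c.2)
        linarith
    rw [rs_eq]
    simp only [coupledStep, partner, if_pos hc]
    rw [posDiff_eulerStep S.γ_pos.ne', shearDiff_eulerStep S.γ_pos.ne', replaceNoise_sub, ← hsdef,
      ← hQ, e1]
  refine (lintegral_mono hpt).trans ?_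
  have hm : Measurable fun t : ℝ × ℝ × Pos d =>
      ENNReal.ofReal (f p K (c₀ + |Q + s * (t.1 - jump (Q / s) t.1 t.2.1)|)) := by
    have h1 : Measurable fun t : ℝ × ℝ × Pos d => jump (Q / s) t.1 t.2.1 :=
      measurable_jump.comp (measurable_const.prodMk (measurable_fst.prodMk measurable_snd.fst))
    have h3 : Measurable fun t : ℝ × ℝ × Pos d => |Q + s * (t.1 - jump (Q / s) t.1 t.2.1)| :=
      continuous_abs.measurable.comp
        (measurable_const.add (measurable_const.mul (measurable_fst.sub h1)))
    exact (continuous_f.measurable.comp (measurable_const.add h3)).ennreal_ofReal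
  have e1 : ∫⁻ t, ENNReal.ofReal (f p K (c₀ + |Q + s * (t.1 - jump (Q / s) t.1 t.2.1)|)) ∂seed d
      = ∫⁻ x, ∫⁻ u, ENNReal.ofReal (f p K (c₀ + |Q + s * (x - jump (Q / s) x u)|))
        ∂uniform ∂stdNormal := by
    refine (lintegral_seed (fun x u _ => ENNReal.ofReal
      (f p K (c₀ + |Q + s * (x - jump (Q / s) x u)|))) hm).trans ?_
    simp
  rw [e1]
  refine (lintegral_coalesce_le hg hc₀0 hs hQ0).trans (ENNReal.ofReal_le_ofReal ?_)
  -- The choices `x₀ = 1/2` and `x₀ = 1` give the steps `s` and `2 * s` with the weights `3/10` and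
  -- `1/10` of `small_distance_contraction`.
  have g1 := integral_oddShift_le hg hc₀0 hQ0 hs.le (x₀ := 1 / 2) (by norm_num)
  have g2 := integral_oddShift_le hg hc₀0 hQ0 hs.le (x₀ := 1) (by norm_num)
  rw [show 2 * s * (1 / 2) = s by ring] at g1
  rw [mul_one] at g2
  have hr := rs_le_R1 S hc.1
  rw [rs_eq] at hr
  have hn := norm_posDiff_eulerStep_le S B c.1 c.2 0 0
  rw [posDiff_eulerStep S.γ_pos.ne'] at hn
  have key := small_distance_contraction hg hα hη B.alpha_le hs
    (profile_mul_noiseScale_sq S B.h_pos) B.R₁_le (norm_nonneg (posDiff c.1 c.2)) hc.2 hr hc₀0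
    (mul_le_mul_of_nonneg_left hn hα.le) (abs_norm_shearDrift_sub_le S B.h_pos c.1 c.2)
    (c := c₀) (Q := Q) (E := ∫ x, oddShift (slope p K) c₀ (Q + 2 * s * x) ∂stdNormal)
    (g1.trans_eq (by norm_num)) (g2.trans_eq (by norm_num))
  refine key.trans ?_
  rw [rho_eq_of_le hc.1, ← f_eq, rs_eq]
  have hb := norm_nonneg (posDiff c.1 c.2)
  have hb' : 0 ≤ ‖shearDiff p c.1 c.2‖ := norm_nonneg _
  have h5 := rate_mul_f_le S B.h_pos hb hb' (x := ‖shearDiff p c.1 c.2‖) (by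
    have := mul_le_mul_of_nonneg_left hc.2.le hα.le
    linarith) hb'
  have h6 := hg.floor (alpha p * ‖posDiff c.1 c.2‖ + ‖shearDiff p c.1 c.2‖) (by positivity)
  have h7 := mul_le_mul_of_nonneg_left h6
    (by positivity : 0 ≤ h * p.γ * alpha p * ‖shearDiff p c.1 c.2‖)
  linarith

/-- The coupled step contracts `ρ` in expectation. -/
lemma lintegral_coupledStep_le (S : Admissible p U G K) {h : ℝ} (B : StepBounds p (R1 p K) h)
    (c : Phase d × Phase d) :
    ∫⁻ t, ENNReal.ofReal (rho p K (coupledStep p U K h (c, t)).1 (coupledStep p U K h (c, t)).2)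
        ∂seed d
      ≤ ENNReal.ofReal (Real.exp (-(rate p K * h))) * ENNReal.ofReal (rho p K c.1 c.2) := by
  refine le_trans ?_ (one_sub_mul_rho_le S _ _ _)
  by_cases hc : c ∈ coalescing p K
  · exact lintegral_coupledStep_of_mem S B hc
  · exact lintegral_coupledStep_of_notMem S B hc

/-! ### Contraction of the transport cost by one step -/

/-- The law after one Euler step. -/
noncomputable def stepLaw (U : Pos d → ℝ) (γ h : ℝ) (μ : Measure (Phase d)) :
    Measure (Phase d) :=
  (μ.prod (stdGaussian (Pos d))).map fun t => eulerStep U γ h t.1 t.2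

lemma lintegral_stepLaw (hU : PotentialAssumption p U) (γ h : ℝ) (μ : Measure (Phase d))
    {F : Phase d → ℝ≥0∞} (hF : Measurable F) :
    ∫⁻ a, F a ∂stepLaw U γ h μ
      = ∫⁻ a, ∫⁻ ξ, F (eulerStep U γ h a ξ) ∂stdGaussian (Pos d) ∂μ := by
  have h1 := (continuous_eulerStep hU γ h).measurable
  rw [stepLaw, lintegral_map hF h1]
  exact lintegral_prod_eq _ _ (fun a ξ => F (eulerStep U γ h a ξ)) (hF.comp h1)

lemma isProbabilityMeasure_stepLaw (hU : PotentialAssumption p U) (γ h : ℝ) (μ : Measure (Phase d))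
    [IsProbabilityMeasure μ] : IsProbabilityMeasure (stepLaw U γ h μ) :=
  Measure.isProbabilityMeasure_map (continuous_eulerStep hU γ h).measurable.aemeasurable

lemma isProbabilityMeasure_of_fst {ω : Measure (Phase d × Phase d)} {μ : Measure (Phase d)}
    [IsProbabilityMeasure μ] (h : ω.fst = μ) : IsProbabilityMeasure ω := by
  refine ⟨?_⟩
  rw [← Measure.fst_univ, h, measure_univ]

lemma wasserstein_le {D : Phase d → Phase d → ℝ} {μ ν : Measure (Phase d)}
    {ω : Measure (Phase d × Phase d)} (h1 : ω.fst = μ) (h2 : ω.snd = ν) :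
    wasserstein D μ ν ≤ ∫⁻ t, ENNReal.ofReal (D t.1 t.2) ∂ω :=
  iInf₂_le (f := fun (ω : Measure (Phase d × Phase d)) (_ : ω ∈ {ω | ω.fst = μ ∧ ω.snd = ν}) =>
    ∫⁻ t, ENNReal.ofReal (D t.1 t.2) ∂ω) ω ⟨h1, h2⟩

/-- No optimal coupling is needed: a finite nonzero factor passes through the infimum, so it
suffices to treat each coupling. -/
lemma le_mul_wasserstein {D : Phase d → Phase d → ℝ} {μ ν : Measure (Phase d)}
    {A C : ℝ≥0∞} (hC : C ≠ 0) (hC' : C ≠ ⊤)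
    (h : ∀ ω : Measure (Phase d × Phase d), ω.fst = μ → ω.snd = ν →
      A ≤ C * ∫⁻ t, ENNReal.ofReal (D t.1 t.2) ∂ω) : A ≤ C * wasserstein D μ ν := by
  rw [wasserstein, ENNReal.mul_iInf_of_ne hC hC']
  refine le_iInf fun ω => ?_
  rw [ENNReal.mul_iInf_of_ne hC hC']
  exact le_iInf fun hω => h ω hω.1 hω.2

/-- An arbitrary coupling is joined with an independent seed and pushed through `coupledStep`. For
each fixed pair both noises are standard Gaussian, so the marginals are the one-step laws. -/
lemma wasserstein_stepLaw_le (S : Admissible p U G K) {h : ℝ} (B : StepBounds p (R1 p K) h)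
    (μ ν : Measure (Phase d)) [IsProbabilityMeasure μ] :
    wasserstein (rho p K) (stepLaw U p.γ h μ) (stepLaw U p.γ h ν)
      ≤ ENNReal.ofReal (Real.exp (-(rate p K * h))) * wasserstein (rho p K) μ ν := by
  refine le_mul_wasserstein (by simpa using Real.exp_pos _) ENNReal.ofReal_ne_top ?_
  intro ω h1 h2
  have hω := isProbabilityMeasure_of_fst h1
  have hm := measurable_coupledStep (K := K) S.potential h
  have hstep := continuous_eulerStep S.potential p.γ h
  have hfst : ((ω.prod (seed d)).map (coupledStep p U K h)).fst = stepLaw U p.γ h μ := by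
    refine Measure.ext_of_lintegral _ fun F hF => ?_
    have hF1 : Measurable fun c : Phase d × Phase d => F c.1 := hF.comp measurable_fst
    have hF2 : Measurable fun a : Phase d => ∫⁻ ξ, F (eulerStep U p.γ h a ξ)
        ∂stdGaussian (Pos d) := (hF.comp hstep.measurable).lintegral_prod_right'
    rw [Measure.fst, lintegral_map hF measurable_fst, lintegral_map hF1 hm,
      lintegral_stepLaw S.potential p.γ h μ hF, ← h1, Measure.fst,
      lintegral_map hF2 measurable_fst]
    refine (lintegral_prod_eq _ _ (fun c t => F (coupledStep p U K h (c, t)).1)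
      (hF1.comp hm)).trans (lintegral_congr fun c => ?_)
    exact lintegral_seed_fst h c (F := fun ξ => F (eulerStep U p.γ h c.1 ξ))
      (hF.comp (measurable_eulerStep S.potential _ _ measurable_const measurable_id))
  have hsnd : ((ω.prod (seed d)).map (coupledStep p U K h)).snd = stepLaw U p.γ h ν := by
    refine Measure.ext_of_lintegral _ fun F hF => ?_
    have hF1 : Measurable fun c : Phase d × Phase d => F c.2 := hF.comp measurable_snd
    have hF2 : Measurable fun a : Phase d => ∫⁻ ξ, F (eulerStep U p.γ h a ξ)
        ∂stdGaussian (Pos d) := (hF.comp hstep.measurable).lintegral_prod_right'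
    rw [Measure.snd, lintegral_map hF measurable_snd, lintegral_map hF1 hm,
      lintegral_stepLaw S.potential p.γ h ν hF, ← h2, Measure.snd,
      lintegral_map hF2 measurable_snd]
    refine (lintegral_prod_eq _ _ (fun c t => F (coupledStep p U K h (c, t)).2)
      (hF1.comp hm)).trans (lintegral_congr fun c => ?_)
    exact lintegral_seed_snd S.potential h c (F := fun ξ => F (eulerStep U p.γ h c.2 ξ))
      (hF.comp (measurable_eulerStep S.potential _ _ measurable_const measurable_id))
  have hρ := (continuous_rho (p := p) (K := K)).measurable.ennreal_ofReal
  refine (wasserstein_le hfst hsnd).trans ?_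
  rw [lintegral_map hρ hm, ← lintegral_const_mul _ hρ]
  refine (lintegral_prod_eq _ _ (fun c t => ENNReal.ofReal (rho p K
    (coupledStep p U K h (c, t)).1 (coupledStep p U K h (c, t)).2)) (hρ.comp hm)).trans_le ?_
  exact lintegral_mono fun c => lintegral_coupledStep_le S B c

end Coupling

/-! ### The law of the Euler chain -/

section Chain

variable {d : ℕ} {p : Params} {U G : Pos d → ℝ} {K : Pos d →L[ℝ] Pos d}

/-- The law of the driving sequence. -/
noncomputable abbrev noiseLaw (d : ℕ) : Measure (ℕ → Pos d) :=
  Measure.infinitePi fun _ : ℕ => stdGaussian (Pos d)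

lemma measurable_eulerChain (hU : PotentialAssumption p U) (γ h : ℝ) (k : ℕ) :
    Measurable fun t : Phase d × (ℕ → Pos d) => eulerChain U γ h t.1 t.2 k := by
  induction k with
  | zero => exact measurable_fst
  | succ k ih =>
    exact measurable_eulerStep hU γ h ih ((measurable_pi_apply (k + 1)).comp measurable_snd)

/-- The state at time `k` reads only noises of index at most `k`, which is what makes it independent
of the next one. -/
lemma eulerChain_congr (U : Pos d → ℝ) (γ h : ℝ) (a : Phase d) {ξ ξ' : ℕ → Pos d} (k : ℕ)
    (hξ : ∀ i, i < k + 1 → ξ i = ξ' i) : eulerChain U γ h a ξ k = eulerChain U γ h a ξ' k := by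
  induction k with
  | zero => rfl
  | succ k ih =>
    rw [eulerChain, eulerChain, ih fun i hi => hξ i (by omega), hξ (k + 1) (by omega)]

lemma indepFun_eulerChain (hU : PotentialAssumption p U) (γ h : ℝ) (a : Phase d) (k : ℕ) :
    IndepFun (fun ξ : ℕ → Pos d => eulerChain U γ h a ξ k) (fun ξ => ξ (k + 1)) (noiseLaw d) := by
  have hind : iIndepFun (fun (i : ℕ) (ξ : ℕ → Pos d) => ξ i) (noiseLaw d) :=
    iIndepFun_infinitePi (P := fun _ : ℕ => stdGaussian (Pos d)) (X := fun _ x => x)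
      fun _ => measurable_id
  have h1 := hind.indepFun_finset (Finset.range (k + 1)) {k + 1} (by simp)
    fun i => measurable_pi_apply i
  let ext : ((Finset.range (k + 1)) → Pos d) → ℕ → Pos d :=
    fun y i => if hi : i ∈ Finset.range (k + 1) then y ⟨i, hi⟩ else 0
  have hm1 : Measurable ext := by
    refine measurable_pi_lambda _ fun i => ?_
    by_cases hi : i ∈ Finset.range (k + 1)
    · simp only [ext, dif_pos hi]; exact measurable_pi_apply _
    · simp only [ext, dif_neg hi]; exact measurable_const
  have hm2 : Measurable fun y : (Finset.range (k + 1)) → Pos d =>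
      eulerChain U γ h a (ext y) k :=
    (measurable_eulerChain hU γ h k).comp (measurable_const.prodMk hm1)
  have h2 := h1.comp hm2 (measurable_pi_apply (⟨k + 1, by simp⟩ : ({k + 1} : Finset ℕ)))
  refine h2.congr (Filter.EventuallyEq.of_eq ?_) (Filter.EventuallyEq.of_eq rfl)
  funext ξ
  refine eulerChain_congr U γ h a k fun i hi => ?_
  exact dif_pos (Finset.mem_range.mpr hi)

lemma lintegral_eulerLaw (hU : PotentialAssumption p U) (γ h : ℝ) (μ : Measure (Phase d)) (k : ℕ)
    {F : Phase d → ℝ≥0∞} (hF : Measurable F) :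
    ∫⁻ a, F a ∂eulerLaw U γ h μ k
      = ∫⁻ a, ∫⁻ ξ, F (eulerChain U γ h a ξ k) ∂noiseLaw d ∂μ := by
  have hm := measurable_eulerChain hU γ h k
  rw [eulerLaw, lintegral_map hF hm]
  exact lintegral_prod_eq _ _ (fun a ξ => F (eulerChain U γ h a ξ k)) (hF.comp hm)

lemma isProbabilityMeasure_eulerLaw (hU : PotentialAssumption p U) (γ h : ℝ)
    (μ : Measure (Phase d)) [IsProbabilityMeasure μ] (k : ℕ) :
    IsProbabilityMeasure (eulerLaw U γ h μ k) :=
  Measure.isProbabilityMeasure_map (measurable_eulerChain hU γ h k).aemeasurable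

lemma eulerLaw_zero (hU : PotentialAssumption p U) (γ h : ℝ) (μ : Measure (Phase d)) :
    eulerLaw U γ h μ 0 = μ := by
  refine Measure.ext_of_lintegral _ fun F hF => ?_
  rw [lintegral_eulerLaw hU γ h μ 0 hF]
  simp [eulerChain]

lemma eulerLaw_succ (hU : PotentialAssumption p U) (γ h : ℝ) (μ : Measure (Phase d)) (k : ℕ) :
    eulerLaw U γ h μ (k + 1) = stepLaw U γ h (eulerLaw U γ h μ k) := by
  refine Measure.ext_of_lintegral _ fun F hF => ?_
  have hG : Measurable fun a : Phase d => ∫⁻ η, F (eulerStep U γ h a η) ∂stdGaussian (Pos d) :=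
    (hF.comp (continuous_eulerStep hU γ h).measurable).lintegral_prod_right'
  rw [lintegral_eulerLaw hU γ h μ (k + 1) hF, lintegral_stepLaw hU γ h _ hF,
    lintegral_eulerLaw hU γ h μ k hG]
  refine lintegral_congr fun a => ?_
  have hm : Measurable fun ξ : ℕ → Pos d => eulerChain U γ h a ξ k :=
    (measurable_eulerChain hU γ h k).comp measurable_prodMk_left
  have hm' : Measurable fun ξ : ℕ → Pos d => ξ (k + 1) := measurable_pi_apply _
  have hind := (indepFun_iff_map_prod_eq_prod_map_map hm.aemeasurable hm'.aemeasurable).mp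
    (indepFun_eulerChain hU γ h a k)
  have heval : (noiseLaw d).map (fun ξ => ξ (k + 1)) = stdGaussian (Pos d) :=
    Measure.infinitePi_map_eval (fun _ : ℕ => stdGaussian (Pos d)) (k + 1)
  rw [heval] at hind
  have hF2 : Measurable fun t : Phase d × Pos d => F (eulerStep U γ h t.1 t.2) :=
    hF.comp (continuous_eulerStep hU γ h).measurable
  have e1 : ∫⁻ ξ, F (eulerChain U γ h a ξ (k + 1)) ∂noiseLaw d
      = ∫⁻ t, F (eulerStep U γ h t.1 t.2)
        ∂(noiseLaw d).map (fun ξ => (eulerChain U γ h a ξ k, ξ (k + 1))) := by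
    rw [lintegral_map hF2 (hm.prodMk hm')]
    rfl
  rw [e1, hind, lintegral_prod_eq _ _ (fun x η => F (eulerStep U γ h x η)) hF2,
    lintegral_map hG hm]

lemma eulerLaw_one (hU : PotentialAssumption p U) (γ h : ℝ) (μ : Measure (Phase d)) :
    eulerLaw U γ h μ 1 = stepLaw U γ h μ := by
  rw [eulerLaw_succ hU, eulerLaw_zero hU]

lemma eulerLaw_of_invariant (hU : PotentialAssumption p U) {γ h : ℝ} {μ : Measure (Phase d)}
    (hμ : IsInvariantMeasure U γ h μ) (k : ℕ) : eulerLaw U γ h μ k = μ := by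
  induction k with
  | zero => exact eulerLaw_zero hU γ h μ
  | succ k ih => rw [eulerLaw_succ hU, ih, ← eulerLaw_one hU, hμ.2]

/-- Contraction of the chain in the transport cost of `ρ`. -/
lemma wasserstein_rho_eulerLaw_le (S : Admissible p U G K) {h : ℝ} (B : StepBounds p (R1 p K) h)
    (μ ν : Measure (Phase d)) [IsProbabilityMeasure μ] (k : ℕ) :
    wasserstein (rho p K) (eulerLaw U p.γ h μ k) (eulerLaw U p.γ h ν k)
      ≤ ENNReal.ofReal (Real.exp (-(rate p K * k * h))) * wasserstein (rho p K) μ ν := by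
  induction k with
  | zero => simp [eulerLaw_zero S.potential]
  | succ k ih =>
    have := isProbabilityMeasure_eulerLaw S.potential p.γ h μ k
    rw [eulerLaw_succ S.potential, eulerLaw_succ S.potential]
    refine (wasserstein_stepLaw_le S B _ _).trans ?_
    refine (mul_le_mul_right ih _).trans_eq ?_
    rw [← mul_assoc, ← ENNReal.ofReal_mul (Real.exp_pos _).le, ← Real.exp_add]
    congr 3
    push_cast; ring

/-! ### Comparison with the Euclidean distance -/

lemma wasserstein_le_of_le {D D' : Phase d → Phase d → ℝ} {C : ℝ} (hC : 0 < C)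
    (h : ∀ a b, D' a b ≤ C * D a b) (μ ν : Measure (Phase d)) :
    wasserstein D' μ ν ≤ ENNReal.ofReal C * wasserstein D μ ν := by
  refine le_mul_wasserstein (by simpa using hC) ENNReal.ofReal_ne_top fun ω h1 h2 => ?_
  refine (wasserstein_le h1 h2).trans ?_
  rw [← lintegral_const_mul' _ _ ENNReal.ofReal_ne_top]
  refine lintegral_mono fun t => ?_
  rw [← ENNReal.ofReal_mul hC.le]
  exact ENNReal.ofReal_le_ofReal (h _ _)

/-- The factor in the bound of the Euclidean distance by `ρ`. -/
noncomputable def lowerFactor (p : Params) (K : Pos d →L[ℝ] Pos d) : ℝ :=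
  √2 * p.γ / (min √(2 * p.κ) 1 * (slope p K (R1 p K) * eps p))

/-- The factor in the bound of `ρ` by the Euclidean distance. -/
noncomputable def upperFactor (p : Params) : ℝ := √2 * p.γ⁻¹ * max (p.γ * (1 + alpha p)) 1

lemma min_sqrt_pos (S : Admissible p U G K) : 0 < min √(2 * p.κ) 1 := by
  have := S.κ_pos
  exact lt_min (by positivity) one_pos

lemma lowerFactor_pos (S : Admissible p U G K) : 0 < lowerFactor p K := by
  have h1 := S.γ_pos
  have h2 := S.eps_pos
  have h3 := slope_R1_pos S
  have h4 := min_sqrt_pos S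
  unfold lowerFactor; positivity

lemma upperFactor_pos (S : Admissible p U G K) : 0 < upperFactor p := by
  have h1 := S.γ_pos
  have : 0 < max (p.γ * (1 + alpha p)) 1 := lt_max_of_lt_right one_pos
  unfold upperFactor; positivity

lemma lowerFactor_mul_upperFactor (S : Admissible p U G K) :
    lowerFactor p K * upperFactor p = constM p K := by
  have h1 := S.γ_pos
  have h2 := S.eps_pos
  have h3 := slope_R1_pos S
  have h4 := min_sqrt_pos S
  have h5 : √2 * √2 = (2 : ℝ) := Real.mul_self_sqrt (by norm_num)
  rw [constM, deriv_f, lowerFactor, upperFactor]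
  change _ = (slope p K (R1 p K))⁻¹ * _
  field_simp
  linear_combination h5

lemma euclid_nonneg (a b : Phase d) : 0 ≤ euclid a b := Real.sqrt_nonneg _

lemma euclid_sq (a b : Phase d) : euclid a b ^ 2 = ‖a.1 - b.1‖ ^ 2 + ‖a.2 - b.2‖ ^ 2 :=
  Real.sq_sqrt (by positivity)

/-- `f` is at least `f'(R₁)` times its argument, which is at least `eps * rl`; and `√2 γ rl`
dominates the Euclidean distance up to the factor `min √(2κ) 1`. -/
lemma euclid_le (S : Admissible p U G K) (a b : Phase d) :
    euclid a b ≤ lowerFactor p K * rho p K a b := by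
  have h1 := S.γ_pos
  have h2 := S.eps_pos
  have h3 := slope_R1_pos S
  have h4 := min_sqrt_pos S
  have hκ := S.κ_pos
  have hrl : min √(2 * p.κ) 1 * euclid a b ≤ √2 * p.γ * rl p K a b := by
    have := rl_nonneg (p := p) (K := K) a b
    apply le_of_sq_le_sq _ (by positivity)
    have hsq : rl p K a b ^ 2 = p.γ⁻¹ ^ 2 * ⟪a.1 - b.1, K (a.1 - b.1)⟫
        + 1 / 2 * ‖shearDiff p a b - (2 * tau p) • posDiff a b‖ ^ 2
        + 1 / 2 * (p.γ⁻¹ ^ 2 * ‖a.2 - b.2‖ ^ 2) := by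
      have e2 : shearDiff p a b - posDiff a b = p.γ⁻¹ • (a.2 - b.2) := by
        rw [shearDiff, posDiff, add_sub_cancel_left]
      rw [rl_sq S, e2, norm_smul, Real.norm_of_nonneg (inv_nonneg.mpr h1.le), mul_pow]
      rfl
    have hq := mul_norm_sq_le_quadForm S.splitting (a.1 - b.1)
    have hm1 : min √(2 * p.κ) 1 ^ 2 ≤ 2 * p.κ := by
      have : min √(2 * p.κ) 1 ^ 2 ≤ √(2 * p.κ) ^ 2 := by gcongr; exact min_le_left _ _
      rwa [Real.sq_sqrt (by positivity)] at this
    have hm2 : min √(2 * p.κ) 1 ^ 2 ≤ 1 := by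
      have : min √(2 * p.κ) 1 ^ 2 ≤ 1 ^ 2 := by gcongr; exact min_le_right _ _
      linarith
    rw [mul_pow, mul_pow, mul_pow, Real.sq_sqrt (by norm_num), euclid_sq]
    have e3 : p.γ ^ 2 * p.γ⁻¹ ^ 2 = 1 := by field_simp
    have e4 := mul_le_mul_of_nonneg_right hm1 (sq_nonneg ‖a.1 - b.1‖)
    have e5 := mul_le_mul_of_nonneg_right hm2 (sq_nonneg ‖a.2 - b.2‖)
    have e6 : 2 * p.γ ^ 2 * rl p K a b ^ 2
        = 2 * ⟪a.1 - b.1, K (a.1 - b.1)⟫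
          + p.γ ^ 2 * ‖shearDiff p a b - (2 * tau p) • posDiff a b‖ ^ 2
          + ‖a.2 - b.2‖ ^ 2 := by
      rw [hsq]
      linear_combination (2 * ⟪a.1 - b.1, K (a.1 - b.1)⟫ + ‖a.2 - b.2‖ ^ 2) * e3
    rw [e6]
    have e7 : 0 ≤ p.γ ^ 2 * ‖shearDiff p a b - (2 * tau p) • posDiff a b‖ ^ 2 := by positivity
    linarith
  have hρ : slope p K (R1 p K) * (eps p * rl p K a b) ≤ rho p K a b := by
    have h5 : 0 ≤ min (Delta p K a b) (DK p K) := le_min (Delta_nonneg S a b) (DK_nonneg S)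
    have h6 : 0 ≤ eps p * rl p K a b := mul_nonneg h2.le (rl_nonneg a b)
    refine le_trans ?_ ((isProfile_slope S).mul_le_integral_self (add_nonneg h5 h6))
    gcongr
    linarith
  have hpos : 0 < min √(2 * p.κ) 1 * (slope p K (R1 p K) * eps p) := by positivity
  rw [lowerFactor, div_mul_eq_mul_div, le_div_iff₀ hpos]
  have h7 := mul_le_mul_of_nonneg_left hrl (by positivity : 0 ≤ slope p K (R1 p K) * eps p)
  have h8 := mul_le_mul_of_nonneg_left hρ (by positivity : 0 ≤ √2 * p.γ)
  linarith

lemma rho_le (S : Admissible p U G K) (a b : Phase d) :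
    rho p K a b ≤ upperFactor p * euclid a b := by
  have h1 := S.γ_pos
  have hα := S.alpha_pos
  refine (rho_le_f_rs S a b).trans ?_
  refine ((isProfile_slope S).integral_le_self (rs_nonneg S a b)).trans ?_
  have h2 : ‖(a.1 - b.1) + p.γ⁻¹ • (a.2 - b.2)‖ ≤ ‖a.1 - b.1‖ + p.γ⁻¹ * ‖a.2 - b.2‖ := by
    refine (norm_add_le _ _).trans_eq ?_
    rw [norm_smul, Real.norm_of_nonneg (inv_nonneg.mpr h1.le)]
  set m := max (p.γ * (1 + alpha p)) 1 with hm
  have h3 : 1 + alpha p ≤ p.γ⁻¹ * m := by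
    have := le_max_left (p.γ * (1 + alpha p)) 1
    rw [← hm] at this
    calc 1 + alpha p = p.γ⁻¹ * (p.γ * (1 + alpha p)) := by field_simp
      _ ≤ _ := by gcongr
  have h4 : p.γ⁻¹ ≤ p.γ⁻¹ * m :=
    le_mul_of_one_le_right (by positivity) (le_max_right _ _)
  have h5 : ‖a.1 - b.1‖ + ‖a.2 - b.2‖ ≤ √2 * euclid a b := by
    have := euclid_nonneg a b
    apply le_of_sq_le_sq _ (by positivity)
    rw [mul_pow, Real.sq_sqrt (by norm_num), euclid_sq]
    nlinarith [sq_nonneg (‖a.1 - b.1‖ - ‖a.2 - b.2‖)]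
  have h6 := mul_le_mul_of_nonneg_right h3 (norm_nonneg (a.1 - b.1))
  have h7 := mul_le_mul_of_nonneg_right h4 (norm_nonneg (a.2 - b.2))
  have hm0 : 0 ≤ p.γ⁻¹ * m := (inv_nonneg.mpr h1.le).trans h4
  have h8 := mul_le_mul_of_nonneg_left h5 hm0
  rw [rs, upperFactor]
  linarith

/-- Contraction of the chain in the Wasserstein distance. -/
lemma wasserstein_euclid_eulerLaw_le (S : Admissible p U G K) {h : ℝ}
    (B : StepBounds p (R1 p K) h) (μ ν : Measure (Phase d)) [IsProbabilityMeasure μ] (k : ℕ) :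
    wasserstein euclid (eulerLaw U p.γ h μ k) (eulerLaw U p.γ h ν k)
      ≤ ENNReal.ofReal (constM p K * Real.exp (-(rate p K * k * h)))
        * wasserstein euclid μ ν := by
  have hl := lowerFactor_pos S
  have hu := upperFactor_pos S
  refine (wasserstein_le_of_le hl (euclid_le S) _ _).trans ?_
  refine (mul_le_mul_right (wasserstein_rho_eulerLaw_le S B μ ν k) _).trans ?_
  refine (mul_le_mul_right (mul_le_mul_right (wasserstein_le_of_le hu (rho_le S) μ ν) _)
    _).trans_eq ?_
  rw [← lowerFactor_mul_upperFactor S, ENNReal.ofReal_mul (by positivity),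
    ENNReal.ofReal_mul hl.le]
  ring

end Chain

/-! ### The invariant measure -/

section Invariant

variable {d : ℕ} {p : Params} {U G : Pos d → ℝ} {K : Pos d →L[ℝ] Pos d}

open Filter Topology

/-- The first moment of a measure on phase space. -/
noncomputable def firstMoment (μ : Measure (Phase d)) : ℝ≥0∞ :=
  ∫⁻ a, ENNReal.ofReal (euclid a 0) ∂μ

lemma continuous_euclid : Continuous fun c : Phase d × Phase d => euclid c.1 c.2 := by
  unfold euclid; fun_prop

lemma continuous_euclid_zero : Continuous fun a : Phase d => euclid a 0 := by
  unfold euclid; fun_prop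

lemma measurable_euclid_zero : Measurable fun a : Phase d => ENNReal.ofReal (euclid a 0) :=
  continuous_euclid_zero.measurable.ennreal_ofReal

lemma norm_sub_le_euclid (a b : Phase d) : ‖a - b‖ ≤ euclid a b := by
  rw [Prod.norm_def]
  refine max_le ?_ ?_ <;> refine Real.le_sqrt_of_sq_le ?_ <;> simp

lemma euclid_le_add_norm (a b : Phase d) : euclid a b ≤ ‖a.1 - b.1‖ + ‖a.2 - b.2‖ := by
  refine Real.sqrt_le_iff.mpr ⟨by positivity, ?_⟩
  nlinarith [mul_nonneg (norm_nonneg (a.1 - b.1)) (norm_nonneg (a.2 - b.2))]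

lemma euclid_zero_le (a b : Phase d) : euclid a 0 ≤ euclid a b + euclid b 0 := by
  have h : ∀ c e : Phase d, euclid c e = ‖WithLp.toLp 2 (c - e)‖ := by
    intro c e
    rw [WithLp.prod_norm_eq_of_L2]; rfl
  rw [h, h, h, sub_zero, sub_zero]
  refine le_trans (le_of_eq ?_) (norm_add_le _ _)
  rw [← WithLp.toLp_add, sub_add_cancel]

lemma firstMoment_le (α β : Measure (Phase d)) :
    firstMoment α ≤ wasserstein euclid α β + firstMoment β := by
  rw [← tsub_le_iff_right, wasserstein]
  refine le_iInf₂ fun ω hω => ?_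
  have hm := measurable_euclid_zero (d := d)
  rw [tsub_le_iff_right, firstMoment, firstMoment, ← hω.1, ← hω.2, Measure.fst, Measure.snd,
    lintegral_map hm measurable_fst, lintegral_map hm measurable_snd,
    ← lintegral_add_right _
      (show Measurable fun t : Phase d × Phase d => ENNReal.ofReal (euclid t.2 0) from
        hm.comp measurable_snd)]
  refine lintegral_mono fun t => ?_
  rw [← ENNReal.ofReal_add (euclid_nonneg _ _) (euclid_nonneg _ _)]
  exact ENNReal.ofReal_le_ofReal (euclid_zero_le _ _)

lemma wasserstein_dirac_zero_le (μ : Measure (Phase d)) [IsProbabilityMeasure μ] :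
    wasserstein euclid μ (Measure.dirac 0) ≤ firstMoment μ := by
  have h1 : (μ.prod (Measure.dirac (0 : Phase d))).fst = μ := by simp
  have h2 : (μ.prod (Measure.dirac (0 : Phase d))).snd = Measure.dirac 0 := by simp
  refine (wasserstein_le h1 h2).trans_eq ?_
  refine (lintegral_prod_eq _ _ (fun a b => ENNReal.ofReal (euclid a b))
    continuous_euclid.measurable.ennreal_ofReal).trans ?_
  refine lintegral_congr fun a => ?_
  have h3 : Continuous fun b : Phase d => euclid a b := by unfold euclid; fun_prop
  exact lintegral_dirac' _ h3.measurable.ennreal_ofReal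

lemma firstMoment_stepLaw_dirac_lt_top (hU : PotentialAssumption p U) (γ h : ℝ) :
    firstMoment (stepLaw U γ h (Measure.dirac (0 : Phase d))) < ⊤ := by
  have hm := measurable_euclid_zero (d := d)
  have hm' : Measurable fun a : Phase d => ∫⁻ ξ, ENNReal.ofReal (euclid (eulerStep U γ h a ξ) 0)
      ∂stdGaussian (Pos d) :=
    (hm.comp (continuous_eulerStep hU γ h).measurable).lintegral_prod_right'
  rw [firstMoment, lintegral_stepLaw hU γ h _ hm, lintegral_dirac' _ hm']
  have hle : ∀ ξ : Pos d, ENNReal.ofReal (euclid (eulerStep U γ h (0 : Phase d) ξ) 0)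
      ≤ ENNReal.ofReal (‖h • ∇ U 0‖ + √(2 * γ * h) * ‖ξ‖) := by
    intro ξ
    refine ENNReal.ofReal_le_ofReal ((euclid_le_add_norm _ _).trans ?_)
    simp only [eulerStep, Prod.fst_zero, Prod.snd_zero, smul_zero, add_zero, sub_zero, norm_zero,
      zero_add, zero_sub]
    refine (norm_add_le _ _).trans_eq ?_
    rw [norm_neg, norm_smul (√(2 * γ * h)), Real.norm_of_nonneg (Real.sqrt_nonneg _)]
  refine (lintegral_mono hle).trans_lt ?_
  have hint : Integrable (fun ξ : Pos d => ‖h • ∇ U 0‖ + √(2 * γ * h) * ‖ξ‖)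
      (stdGaussian (Pos d)) :=
    (integrable_const _).add ((IsGaussian.integrable_id (μ := stdGaussian (Pos d))).norm.const_mul _)
  exact hint.lintegral_lt_top

/-- The easy half of Kantorovich duality; the sup norm on the product is below `euclid`. The
constant is `L + 1` so that it never vanishes, as `le_mul_wasserstein` requires. -/
lemma ofReal_abs_integral_sub_le {g : Phase d → ℝ} {C : ℝ} {L : NNReal}
    (hg : ∀ x y, dist (g x) (g y) ≤ C) (hL : LipschitzWith L g) (α β : Measure (Phase d))
    [IsProbabilityMeasure α] [IsProbabilityMeasure β] :
    ENNReal.ofReal |∫ a, g a ∂α - ∫ a, g a ∂β|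
      ≤ ((L + 1 : NNReal) : ℝ≥0∞) * wasserstein euclid α β := by
  refine le_mul_wasserstein (by simp) ENNReal.coe_ne_top fun ω h1 h2 => ?_
  have hω := isProbabilityMeasure_of_fst h1
  have hc := hL.continuous
  have hb : ∀ x, ‖g x‖ ≤ C + ‖g 0‖ := by
    intro x
    have h3 := hg x 0
    rw [dist_eq_norm] at h3
    have h4 := norm_add_le (g x - g 0) (g 0)
    rw [sub_add_cancel] at h4
    linarith
  have i1 : Integrable (fun t : Phase d × Phase d => g t.1) ω :=
    .of_bound (by fun_prop) (C + ‖g 0‖) (ae_of_all _ fun t => hb _)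
  have i2 : Integrable (fun t : Phase d × Phase d => g t.2) ω :=
    .of_bound (by fun_prop) (C + ‖g 0‖) (ae_of_all _ fun t => hb _)
  rw [← h1, ← h2, Measure.fst, Measure.snd, integral_map (by fun_prop) (by fun_prop),
    integral_map (by fun_prop) (by fun_prop), ← integral_sub i1 i2, ← Real.norm_eq_abs,
    ofReal_norm]
  refine (enorm_integral_le_lintegral_enorm _).trans ?_
  rw [← lintegral_const_mul' _ _ ENNReal.coe_ne_top]
  refine lintegral_mono fun t => ?_
  rw [← ofReal_norm, ← ENNReal.ofReal_coe_nnreal, ← ENNReal.ofReal_mul (by positivity)]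
  apply ENNReal.ofReal_le_ofReal
  have h3 := hL.norm_sub_le t.1 t.2
  have h4 := norm_sub_le_euclid t.1 t.2
  push_cast
  have h5 := mul_le_mul_of_nonneg_left h4 L.coe_nonneg
  have h6 := euclid_nonneg t.1 t.2
  linarith

/-- Weak limits are not changed by perturbations that are small in the Wasserstein distance. -/
lemma tendsto_of_wasserstein_tendsto_zero {α β : ℕ → ProbabilityMeasure (Phase d)}
    {μ : ProbabilityMeasure (Phase d)} (hα : Tendsto α atTop (𝓝 μ))
    (hW : Tendsto (fun n => wasserstein euclid (α n : Measure (Phase d)) (β n)) atTop (𝓝 0)) :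
    Tendsto β atTop (𝓝 μ) := by
  rw [tendsto_iff_forall_lipschitz_integral_tendsto] at hα ⊢
  rintro g ⟨C, hg⟩ ⟨L, hL⟩
  have h1 : Tendsto (fun n => ENNReal.ofReal |∫ a, g a ∂(α n : Measure (Phase d))
      - ∫ a, g a ∂(β n : Measure (Phase d))|) atTop (𝓝 0) := by
    have h2 := ENNReal.Tendsto.const_mul (a := ((L + 1 : NNReal) : ℝ≥0∞)) hW
      (Or.inr ENNReal.coe_ne_top)
    rw [mul_zero] at h2
    exact tendsto_of_tendsto_of_tendsto_of_le_of_le tendsto_const_nhds h2 (fun _ => zero_le)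
      fun n => ofReal_abs_integral_sub_le hg hL _ _
  have h3 := (ENNReal.tendsto_toReal ENNReal.zero_ne_top).comp h1
  have h4 : Tendsto (fun n => ∫ a, g a ∂(α n : Measure (Phase d))
      - ∫ a, g a ∂(β n : Measure (Phase d))) atTop (𝓝 0) := by
    rw [tendsto_zero_iff_abs_tendsto_zero]
    refine h3.congr fun n => ?_
    simp
  simpa using (hα g ⟨C, hg⟩ ⟨L, hL⟩).sub h4

lemma tendsto_exp_bound {c h M : ℝ} (hc : 0 < c) (hh : 0 < h) {W : ℝ≥0∞} (hW : W ≠ ⊤) :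
    Tendsto (fun n : ℕ => ENNReal.ofReal (M * Real.exp (-(c * n * h))) * W) atTop (𝓝 0) := by
  have h1 : Tendsto (fun n : ℕ => M * Real.exp (-(c * n * h))) atTop (𝓝 (M * 0)) := by
    refine Tendsto.const_mul _ (Real.tendsto_exp_neg_atTop_nhds_zero.comp ?_)
    exact (tendsto_natCast_atTop_atTop.const_mul_atTop hc).atTop_mul_const hh
  rw [mul_zero] at h1
  have h2 := ENNReal.Tendsto.mul_const (ENNReal.tendsto_ofReal h1) (Or.inr hW)
  simpa using h2

lemma tsum_exp_bound_lt_top {c h M : ℝ} (hc : 0 < c) (hh : 0 < h) {W : ℝ≥0∞}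
    (hW : W ≠ ⊤) : ∑' n : ℕ, ENNReal.ofReal (M * Real.exp (-(c * n * h))) * W < ⊤ := by
  rw [ENNReal.tsum_mul_right]
  refine ENNReal.mul_lt_top ?_ hW.lt_top
  have h1 : Summable fun n : ℕ => M * Real.exp (-(c * n * h)) := by
    refine Summable.mul_left _ ?_
    refine (Real.summable_exp_nat_mul_iff.mpr (by nlinarith [mul_pos hc hh] : -(c * h) < 0)).congr
      fun n => ?_
    congr 1; ring
  exact h1.tsum_ofReal_lt_top

lemma eulerLaw_stepLaw (hU : PotentialAssumption p U) (γ h : ℝ) (μ : Measure (Phase d)) (k : ℕ) :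
    eulerLaw U γ h (stepLaw U γ h μ) k = eulerLaw U γ h μ (k + 1) := by
  induction k with
  | zero => rw [eulerLaw_zero hU, zero_add, eulerLaw_one hU]
  | succ k ih => rw [eulerLaw_succ hU, ih, ← eulerLaw_succ hU]

/-- The law of the chain started in `0`. -/
noncomputable def originLaw (hU : PotentialAssumption p U) (γ h : ℝ) (k : ℕ) :
    ProbabilityMeasure (Phase d) :=
  ⟨eulerLaw U γ h (Measure.dirac 0) k, isProbabilityMeasure_eulerLaw hU γ h _ k⟩

/-- The Euler step as a map of probability measures. -/
noncomputable def stepMap (hU : PotentialAssumption p U) (γ h : ℝ)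
    (μ : ProbabilityMeasure (Phase d)) : ProbabilityMeasure (Phase d) :=
  (μ.prod ⟨stdGaussian (Pos d), inferInstance⟩).map
    (continuous_eulerStep hU γ h).measurable.aemeasurable

lemma coe_stepMap (hU : PotentialAssumption p U) (γ h : ℝ) (μ : ProbabilityMeasure (Phase d)) :
    (stepMap hU γ h μ : Measure (Phase d)) = stepLaw U γ h μ := rfl

lemma continuous_stepMap (hU : PotentialAssumption p U) (γ h : ℝ) :
    Continuous (stepMap (d := d) hU γ h) := by
  have h1 : Continuous fun μ : ProbabilityMeasure (Phase d) =>
      μ.prod (⟨stdGaussian (Pos d), inferInstance⟩ : ProbabilityMeasure (Pos d)) :=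
    ProbabilityMeasure.continuous_prod.comp (continuous_id.prodMk continuous_const)
  exact (ProbabilityMeasure.continuous_map (continuous_eulerStep hU γ h)).comp h1

lemma stepMap_originLaw (hU : PotentialAssumption p U) (γ h : ℝ) (k : ℕ) :
    stepMap hU γ h (originLaw hU γ h k) = originLaw (d := d) hU γ h (k + 1) :=
  Subtype.ext (eulerLaw_succ hU γ h _ k).symm

/-- The later law is that of the chain started from the one-step law, so contraction applies to the
two starting laws and the increments decay geometrically. -/
lemma wasserstein_originLaw_succ_le (S : Admissible p U G K) {h : ℝ}
    (B : StepBounds p (R1 p K) h) (k : ℕ) :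
    wasserstein euclid (originLaw S.potential p.γ h (k + 1) : Measure (Phase d))
        (originLaw S.potential p.γ h k)
      ≤ ENNReal.ofReal (constM p K * Real.exp (-(rate p K * k * h)))
        * firstMoment (stepLaw U p.γ h (Measure.dirac (0 : Phase d))) := by
  have := isProbabilityMeasure_stepLaw S.potential p.γ h (Measure.dirac (0 : Phase d))
  have h1 := wasserstein_euclid_eulerLaw_le S B (stepLaw U p.γ h (Measure.dirac 0))
    (Measure.dirac 0) k
  rw [eulerLaw_stepLaw S.potential] at h1
  exact h1.trans (mul_le_mul_right (wasserstein_dirac_zero_le _) _)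

lemma firstMoment_originLaw_le (S : Admissible p U G K) {h : ℝ}
    (B : StepBounds p (R1 p K) h) (k : ℕ) :
    firstMoment (originLaw S.potential p.γ h k : Measure (Phase d))
      ≤ ∑ n ∈ Finset.range k, ENNReal.ofReal (constM p K * Real.exp (-(rate p K * n * h)))
        * firstMoment (stepLaw U p.γ h (Measure.dirac (0 : Phase d))) := by
  induction k with
  | zero =>
    rw [originLaw, ProbabilityMeasure.coe_mk, eulerLaw_zero S.potential, firstMoment,
      lintegral_dirac' _ measurable_euclid_zero]
    simp [euclid]
  | succ k ih =>
    rw [Finset.sum_range_succ]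
    exact (firstMoment_le _ _).trans ((add_comm _ _).trans_le
      (add_le_add ih (wasserstein_originLaw_succ_le S B k)))

lemma isTightMeasureSet_of_firstMoment_le {s : Set (Measure (Phase d))} {C : ℝ≥0∞} (hC : C ≠ ⊤)
    (hs : ∀ μ ∈ s, firstMoment μ ≤ C) : IsTightMeasureSet s := by
  apply isTightMeasureSet_of_tendsto_measure_norm_gt
  have h1 : Tendsto (fun r : ℝ => C / ENNReal.ofReal r) atTop (𝓝 0) := by
    have := ENNReal.Tendsto.const_div (a := C) (ENNReal.tendsto_ofReal_atTop)
      (Or.inr hC)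
    simpa using this
  refine tendsto_of_tendsto_of_tendsto_of_le_of_le' tendsto_const_nhds h1
    (Eventually.of_forall fun _ => zero_le) ?_
  filter_upwards [eventually_gt_atTop 0] with r hr
  refine iSup₂_le fun μ hμ => ?_
  rw [ENNReal.le_div_iff_mul_le (Or.inl (by simpa using hr)) (Or.inl ENNReal.ofReal_ne_top),
    mul_comm]
  refine le_trans ?_ ((mul_meas_ge_le_lintegral measurable_euclid_zero (ENNReal.ofReal r)).trans
    (hs μ hμ))
  refine mul_le_mul_right (measure_mono fun a (ha : r < ‖a‖) => ?_) _
  have := norm_sub_le_euclid a 0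
  rw [sub_zero] at this
  exact ENNReal.ofReal_le_ofReal (ha.le.trans this)

lemma firstMoment_le_of_tendsto {α : ℕ → ProbabilityMeasure (Phase d)}
    {μ : ProbabilityMeasure (Phase d)} (hα : Tendsto α atTop (𝓝 μ)) {C : ℝ≥0∞}
    (hC : ∀ n, firstMoment (α n : Measure (Phase d)) ≤ C) :
    firstMoment (μ : Measure (Phase d)) ≤ C := by
  refine (lintegral_le_liminf_lintegral_of_forall_isOpen_measure_le_liminf_measure
    continuous_euclid_zero
    (fun a => euclid_nonneg a 0) fun O hO =>
      ProbabilityMeasure.le_liminf_measure_open_of_tendsto hα hO).trans ?_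
  exact (liminf_le_liminf (Eventually.of_forall hC)).trans_eq (liminf_const C)

lemma exists_isInvariantMeasure (S : Admissible p U G K) {h : ℝ} (B : StepBounds p (R1 p K) h) :
    ∃ μ : Measure (Phase d), IsInvariantMeasure U p.γ h μ ∧ firstMoment μ < ⊤ := by
  have hU := S.potential
  have hW := (firstMoment_stepLaw_dirac_lt_top (d := d) hU p.γ h).ne
  set W := firstMoment (stepLaw U p.γ h (Measure.dirac (0 : Phase d)))
  have hC := tsum_exp_bound_lt_top (rate_pos S) (M := constM p K) B.h_pos hW
  have hmom := fun k => (firstMoment_originLaw_le S B k).trans (ENNReal.sum_le_tsum _)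
  have htight : IsTightMeasureSet {((μ : ProbabilityMeasure (Phase d)) : Measure (Phase d)) |
      μ ∈ Set.range (originLaw hU p.γ h)} := by
    refine isTightMeasureSet_of_firstMoment_le hC.ne ?_
    rintro _ ⟨_, ⟨k, rfl⟩, rfl⟩
    exact hmom k
  obtain ⟨μ, -, θ, hθ, hlim⟩ := (isCompact_closure_of_isTightMeasureSet htight).tendsto_subseq
    fun k => subset_closure (Set.mem_range_self k)
  refine ⟨μ, ⟨inferInstance, ?_⟩, (firstMoment_le_of_tendsto hlim fun n => hmom _).trans_lt hC⟩
  have h1 : Tendsto (fun n => originLaw hU p.γ h (θ n + 1)) atTop (𝓝 (stepMap hU p.γ h μ)) := by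
    simpa only [Function.comp_def, stepMap_originLaw] using
      ((continuous_stepMap hU p.γ h).tendsto μ).comp hlim
  -- Along the subsequence, consecutive laws become close in the Wasserstein distance, so the
  -- unshifted laws also converge to `stepMap μ`; uniqueness of the limit gives invariance.
  have h2 : Tendsto (fun n => originLaw hU p.γ h (θ n)) atTop (𝓝 (stepMap hU p.γ h μ)) := by
    refine tendsto_of_wasserstein_tendsto_zero h1 ?_
    refine tendsto_of_tendsto_of_tendsto_of_le_of_le tendsto_const_nhds
      ((tendsto_exp_bound (M := constM p K) (rate_pos S) B.h_pos hW).comp hθ.tendsto_atTop)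
      (fun _ => zero_le) fun n => wasserstein_originLaw_succ_le S B (θ n)
  rw [eulerLaw_one hU, ← coe_stepMap hU, tendsto_nhds_unique h2 hlim]

lemma integral_eulerLaw (hU : PotentialAssumption p U) (γ h : ℝ) (μ : Measure (Phase d))
    [IsProbabilityMeasure μ] (k : ℕ) {g : Phase d → ℝ} (hg : Continuous g) {C : ℝ}
    (hC : ∀ x, ‖g x‖ ≤ C) :
    ∫ a, g a ∂eulerLaw U γ h μ k
      = ∫ a, ∫ ξ, g (eulerChain U γ h a ξ k) ∂noiseLaw d ∂μ := by
  have hm := measurable_eulerChain hU γ h k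
  have hgm : Measurable fun t : Phase d × (ℕ → Pos d) => g (eulerChain U γ h t.1 t.2 k) :=
    hg.measurable.comp hm
  rw [eulerLaw, integral_map hm.aemeasurable hg.aestronglyMeasurable]
  exact integral_prod _ (.of_bound hgm.aestronglyMeasurable C (ae_of_all _ fun t => hC _))

/-- The invariant measure may a priori have infinite first moment, so the Wasserstein bound against
it could be void. Between two deterministic starting points it is finite and tends to zero;
dominated convergence then integrates the starting point against `μ`. -/
lemma tendsto_originLaw (S : Admissible p U G K) {h : ℝ} (B : StepBounds p (R1 p K) h)
    (μ : ProbabilityMeasure (Phase d)) (hμ : IsInvariantMeasure U p.γ h μ) :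
    Tendsto (originLaw S.potential p.γ h) atTop (𝓝 μ) := by
  have hU := S.potential
  rw [tendsto_iff_forall_lipschitz_integral_tendsto]
  rintro g ⟨C, hg⟩ ⟨L, hL⟩
  have hc := hL.continuous
  have hb : ∀ x, ‖g x‖ ≤ C + ‖g 0‖ := by
    intro x
    have h3 := hg x 0
    rw [dist_eq_norm] at h3
    have h4 := norm_add_le (g x - g 0) (g 0)
    rw [sub_add_cancel] at h4
    linarith
  set T : ℕ → Phase d → ℝ := fun n a => ∫ ξ, g (eulerChain U p.γ h a ξ n) ∂noiseLaw d with hT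
  have hTm : ∀ n, StronglyMeasurable (T n) := fun n =>
    (hc.measurable.comp (measurable_eulerChain hU p.γ h n)).stronglyMeasurable.integral_prod_right'
  have hTd : ∀ n a, ∫ x, g x ∂eulerLaw U p.γ h (Measure.dirac a) n = T n a := by
    intro n a
    rw [integral_eulerLaw hU p.γ h _ n hc hb, integral_dirac' _ _ (hTm n)]
  have hTb : ∀ n a, ‖T n a‖ ≤ C + ‖g 0‖ := by
    intro n a
    refine (norm_integral_le_of_norm_le_const (ae_of_all _ fun ξ => hb _)).trans_eq ?_
    simp
  have hpt : ∀ a, Tendsto (fun n => T n a - T n 0) atTop (𝓝 0) := by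
    intro a
    have hfin : firstMoment (Measure.dirac a) ≠ ⊤ := by
      rw [firstMoment, lintegral_dirac' _ measurable_euclid_zero]
      exact ENNReal.ofReal_ne_top
    have h1 := ENNReal.Tendsto.const_mul (a := ((L + 1 : NNReal) : ℝ≥0∞))
      (tendsto_exp_bound (M := constM p K) (rate_pos S) B.h_pos hfin)
      (Or.inr ENNReal.coe_ne_top)
    rw [mul_zero] at h1
    have h2 : Tendsto (fun n => ENNReal.ofReal |T n a - T n 0|) atTop (𝓝 0) := by
      refine tendsto_of_tendsto_of_tendsto_of_le_of_le tendsto_const_nhds h1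
        (fun _ => zero_le) fun n => ?_
      have p1 := isProbabilityMeasure_eulerLaw hU p.γ h (Measure.dirac a) n
      have p2 := isProbabilityMeasure_eulerLaw hU p.γ h (Measure.dirac (0 : Phase d)) n
      change ENNReal.ofReal |T n a - T n 0| ≤ _
      rw [← hTd, ← hTd]
      refine (ofReal_abs_integral_sub_le hg hL _ _).trans (mul_le_mul_right ?_ _)
      exact (wasserstein_euclid_eulerLaw_le S B _ _ n).trans
        (mul_le_mul_right (wasserstein_dirac_zero_le _) _)
    rw [tendsto_zero_iff_abs_tendsto_zero]
    refine ((ENNReal.tendsto_toReal ENNReal.zero_ne_top).comp h2).congr fun n => ?_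
    simp
  have hint : ∀ n, Integrable (T n) (μ : Measure (Phase d)) := fun n =>
    .of_bound (hTm n).aestronglyMeasurable _ (ae_of_all _ (hTb n))
  have h3 : Tendsto (fun n => ∫ a, (T n a - T n 0) ∂(μ : Measure (Phase d))) atTop
      (𝓝 (∫ _, (0 : ℝ) ∂(μ : Measure (Phase d)))) := by
    refine tendsto_integral_of_dominated_convergence (fun _ => (C + ‖g 0‖) + (C + ‖g 0‖))
      (fun n => ((hTm n).sub stronglyMeasurable_const).aestronglyMeasurable)
      (integrable_const _) (fun n => ae_of_all _ fun a => ?_) (ae_of_all _ hpt)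
    exact (norm_sub_le _ _).trans (add_le_add (hTb n a) (hTb n 0))
  have h4 : ∀ n, ∫ a, (T n a - T n 0) ∂(μ : Measure (Phase d))
      = ∫ a, g a ∂(μ : Measure (Phase d)) - T n 0 := by
    intro n
    rw [integral_sub (hint n) (integrable_const _), ← integral_eulerLaw hU p.γ h _ n hc hb,
      eulerLaw_of_invariant hU hμ]
    simp
  simp_rw [h4, integral_zero] at h3
  have h5 := (tendsto_const_nhds (x := ∫ a, g a ∂(μ : Measure (Phase d)))).sub h3
  simp only [sub_sub_cancel, sub_zero] at h5
  refine h5.congr fun n => (hTd n 0).symm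

lemma isInvariantMeasure_unique (S : Admissible p U G K) {h : ℝ} (B : StepBounds p (R1 p K) h)
    {μ ν : Measure (Phase d)} (hμ : IsInvariantMeasure U p.γ h μ)
    (hν : IsInvariantMeasure U p.γ h ν) : μ = ν := by
  obtain ⟨μ', rfl⟩ : ∃ μ' : ProbabilityMeasure (Phase d), μ = μ' := ⟨⟨μ, hμ.1⟩, rfl⟩
  obtain ⟨ν', rfl⟩ : ∃ ν' : ProbabilityMeasure (Phase d), ν = ν' := ⟨⟨ν, hν.1⟩, rfl⟩
  rw [tendsto_nhds_unique (tendsto_originLaw S B μ' hμ) (tendsto_originLaw S B ν' hν)]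

end Invariant

end KineticLangevin

theorem mainTheorem8 (p : KineticLangevin.Params)
    (hκ : 0 < p.κ) (hR : 0 ≤ p.R) (hγ : 0 < p.γ) (hγ_large : 4 * p.LG / √p.κ ≤ p.γ) :
    -- the constants are chosen before the dimension, the potential and the step size
    ∃ c M : ℝ, 0 < c ∧ 0 < M ∧
      ∀ (d : ℕ), 0 < d →
      ∀ (U G : KineticLangevin.Pos d → ℝ)
        (K : KineticLangevin.Pos d →L[ℝ] KineticLangevin.Pos d),
        KineticLangevin.PotentialAssumption p U →
        KineticLangevin.IsSplitting p U K G →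
        c = KineticLangevin.rate p K ∧ M = KineticLangevin.constM p K ∧
        ∀ h : ℝ, 0 < h → KineticLangevin.StepSizeCondition p K h →
          (∀ μ₀ ν₀ : Measure (KineticLangevin.Phase d),
            IsProbabilityMeasure μ₀ → IsProbabilityMeasure ν₀ → ∀ k : ℕ,
            KineticLangevin.wasserstein (KineticLangevin.rho p K)
                (KineticLangevin.eulerLaw U p.γ h μ₀ k) (KineticLangevin.eulerLaw U p.γ h ν₀ k)
              ≤ ENNReal.ofReal (Real.exp (-(c * k * h))) *
                KineticLangevin.wasserstein (KineticLangevin.rho p K) μ₀ ν₀ ∧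
            KineticLangevin.wasserstein KineticLangevin.euclid
                (KineticLangevin.eulerLaw U p.γ h μ₀ k) (KineticLangevin.eulerLaw U p.γ h ν₀ k)
              ≤ ENNReal.ofReal (M * Real.exp (-(c * k * h))) *
                KineticLangevin.wasserstein KineticLangevin.euclid μ₀ ν₀) ∧
          ∃ μinf : Measure (KineticLangevin.Phase d),
            KineticLangevin.IsInvariantMeasure U p.γ h μinf ∧
            (∀ μ, KineticLangevin.IsInvariantMeasure U p.γ h μ → μ = μinf) ∧
            ∫⁻ a, ENNReal.ofReal (KineticLangevin.euclid a 0) ∂μinf < ⊤ ∧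
            ∀ μ₀ : Measure (KineticLangevin.Phase d), IsProbabilityMeasure μ₀ → ∀ k : ℕ,
              KineticLangevin.wasserstein (KineticLangevin.rho p K)
                  (KineticLangevin.eulerLaw U p.γ h μ₀ k) μinf
                ≤ ENNReal.ofReal (Real.exp (-(c * k * h))) *
                  KineticLangevin.wasserstein (KineticLangevin.rho p K) μ₀ μinf ∧
              KineticLangevin.wasserstein KineticLangevin.euclid
                  (KineticLangevin.eulerLaw U p.γ h μ₀ k) μinf
                ≤ ENNReal.ofReal (M * Real.exp (-(c * k * h))) *
                  KineticLangevin.wasserstein KineticLangevin.euclid μ₀ μinf := by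
  -- Any admissible instance supplies the constants, as `R1_congr` makes them common to all
  -- dimensions. If there is none, the claim is vacuous and any positive values serve.
  by_cases hex : ∃ (d : ℕ) (U G : KineticLangevin.Pos d → ℝ)
      (K : KineticLangevin.Pos d →L[ℝ] KineticLangevin.Pos d), KineticLangevin.Admissible p U G K
  · obtain ⟨d', U', G', K', S'⟩ := hex
    refine ⟨KineticLangevin.rate p K', KineticLangevin.constM p K',
      KineticLangevin.rate_pos S', KineticLangevin.constM_pos S', ?_⟩
    intro d hd U G K hU hK
    have S : KineticLangevin.Admissible p U G K := ⟨hd, hκ, hR, hγ, hγ_large, hU, hK⟩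
    have hR1 := KineticLangevin.R1_congr S' S
    rw [KineticLangevin.rate_congr hR1, KineticLangevin.constM_congr hR1]
    refine ⟨rfl, rfl, fun h hh hS => ?_⟩
    have B := KineticLangevin.stepBounds S hh hS
    refine ⟨fun μ₀ ν₀ _ _ k => ⟨KineticLangevin.wasserstein_rho_eulerLaw_le S B μ₀ ν₀ k,
      KineticLangevin.wasserstein_euclid_eulerLaw_le S B μ₀ ν₀ k⟩, ?_⟩
    obtain ⟨μ, hμ, hmom⟩ := KineticLangevin.exists_isInvariantMeasure S B
    refine ⟨μ, hμ, fun ν hν => KineticLangevin.isInvariantMeasure_unique S B hν hμ, hmom, ?_⟩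
    intro μ₀ _ k
    have h1 := KineticLangevin.wasserstein_rho_eulerLaw_le S B μ₀ μ k
    have h2 := KineticLangevin.wasserstein_euclid_eulerLaw_le S B μ₀ μ k
    rw [KineticLangevin.eulerLaw_of_invariant hU hμ] at h1 h2
    exact ⟨h1, h2⟩
  · refine ⟨1, 1, one_pos, one_pos, fun d hd U G K hU hK => absurd ?_ hex⟩
    exact ⟨d, U, G, K, hd, hκ, hR, hγ, hγ_large, hU, hK⟩
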